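/- Let $d\ge 1$ be an integer. For $\sigma\in\mathbb R$ and $q\in(1,\infty)$ let $H^{\sigma,q}(\mathbb R^d)$ be the Bessel potential space of all tempered distributions $v$ with $\|v\|_{H^{\sigma,q}}=\|(1-\Delta)^{\sigma/2}v\|_{L^q(\mathbb R^d)}<\infty$. Let $(\gamma_n)_{n\ge1}$ be a sequence of independent standard Gaussian random variables on a probability space $\Omega$, and let $(h_n)_{n\ge 1}$ be an orthonormal basis of the real Hilbert space $L^2(\mathbb R^d)$. A bounded linear operator $T:L^2(\mathbb R^d)\to X$ into a Banach space $X$ is called $\gamma$-radonifying, written $T\in\gamma(L^2(\mathbb R^d),X)$, if $\sum_{n\ge1}\gamma_nTh_n$ converges in $L^2(\Omega;X)$, and then $\|T\|_{\gamma(L^2(\mathbb R^d),X)}=\big(\mathbb E\|\sum_{n\ge1}\gamma_nTh_n\|_X^2\big)^{1/2}$. For a measurable function $g:\mathbb R^d\to\mathbb R$ let $M_g$ be the multiplication operator $f\mapsto gf$. Let $s,q,\eta\in\mathbb R$. (1) (Sufficient conditions) Suppose that one of the following holds: (a) $s\in(\frac d2,d)$, $q\in(2,\infty)$, $\eta\in(2,q)$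 and $\frac sd+\frac1q\ge\frac1\eta+\frac12$; (b) $s>\frac d2$ and $\eta=q\in[2,\infty)$; (c) $s>\frac d2$, $\eta=2$, $q\in[2,\infty)$ and $\frac sd+\frac1q>1$. Then there is a constant $C$, depending only on $d,s,q,\eta$, such that for all $g\in L^\eta(\mathbb R^d)$ one has $M_g\in\gamma(L^2(\mathbb R^d),H^{-s,q}(\mathbb R^d))$ and $$\|M_g\|_{\gamma(L^2(\mathbb R^d),H^{-s,q}(\mathbb R^d))}\le C\,\|g\|_{L^\eta(\mathbb R^d)}.$$ (2) (Necessary conditions) Let $s\ge0$ and $\eta,q\in[2,\infty)$, and suppose that there is a constant $C$ such that for all $g\in L^\eta(\mathbb R^d)$ one has $M_g\in\gamma(L^2(\mathbb R^d),H^{-s,q}(\mathbb R^d))$ and $\|M_g\|_{\gamma(L^2(\mathbb R^d),H^{-s,q}(\mathbb R^d))}\le C\,\|g\|_{L^\eta(\mathbb R^d)}$. Then $\frac sd+\frac1q\ge\frac1\eta+\frac12$, $\eta\le q$ and $s>\frac d2$. (3) If, in the situation of (2), moreover $\frac sd+\frac1q=\frac1\eta+\frac12$, then $s\in(\frac d2,d)$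 and $\eta\in(2,q)$. -/

import Mathlib

open MeasureTheory ProbabilityTheory Filter Topology TemperedDistribution
open scoped ENNReal NNReal SchwartzMap

universe u

/-- The Euclidean space `ℝ^d`. -/
abbrev Rd (d : ℕ) : Type := EuclideanSpace ℝ (Fin d)

/-- The real Hilbert space `L²(ℝ^d)`. -/
abbrev L2 (d : ℕ) : Type := Lp ℝ 2 (volume : Measure (Rd d))

instance fact_one_le_ofReal {q : ℝ} [hq : Fact (1 ≤ q)] : Fact (1 ≤ ENNReal.ofReal q) :=
  ⟨by simpa using hq.out⟩

/-! ### Bessel potential spaces -/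

/-- The operator `(1 - Δ)^(σ/2)` on tempered distributions. In the normalization
`𝓕 φ ξ = ∫ exp (-2πi x·ξ) φ x dx` of the Fourier transform it is the Fourier multiplier with
symbol `(1 + 4π²|ξ|²)^(σ/2)`. -/
noncomputable def besselOp (d : ℕ) (σ : ℝ) : 𝓢'(Rd d, ℂ) →L[ℂ] 𝓢'(Rd d, ℂ) :=
  fourierMultiplierCLM ℂ
    (fun ξ : Rd d ↦ (((1 + 4 * Real.pi ^ 2 * ‖ξ‖ ^ 2) ^ (σ / 2) : ℝ) : ℂ))

theorem besselSymbol_hasTemperateGrowth (d : ℕ) (σ : ℝ) :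
    (fun ξ : Rd d ↦
      (((1 + 4 * Real.pi ^ 2 * ‖ξ‖ ^ 2) ^ (σ / 2) : ℝ) : ℂ)).HasTemperateGrowth := by
  have h1 : (fun ξ : Rd d ↦
      (((1 + ‖ξ‖ ^ 2) ^ (σ / 2) : ℝ) : ℂ)).HasTemperateGrowth := by fun_prop
  have h2 : (fun ξ : Rd d ↦ (2 * Real.pi) • ξ).HasTemperateGrowth := by fun_prop
  have h3 := h1.comp h2
  convert h3 using 2 with ξ
  simp only [Function.comp, norm_smul, mul_pow, Real.norm_eq_abs, sq_abs]
  norm_num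

theorem besselOp_neg_besselOp (d : ℕ) (σ : ℝ) (v : 𝓢'(Rd d, ℂ)) :
    besselOp d (-σ) (besselOp d σ v) = v := by
  unfold besselOp
  rw [fourierMultiplierCLM_fourierMultiplierCLM_apply (besselSymbol_hasTemperateGrowth d σ)
    (besselSymbol_hasTemperateGrowth d (-σ))]
  have : ((fun ξ : Rd d ↦ (((1 + 4 * Real.pi ^ 2 * ‖ξ‖ ^ 2) ^ (σ / 2) : ℝ) : ℂ)) *
      (fun ξ : Rd d ↦ (((1 + 4 * Real.pi ^ 2 * ‖ξ‖ ^ 2) ^ (-σ / 2) : ℝ) : ℂ))) =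
      fun _ ↦ 1 := by
    ext ξ
    have hpos : (0 : ℝ) < 1 + 4 * Real.pi ^ 2 * ‖ξ‖ ^ 2 := by positivity
    simp only [Pi.mul_apply]
    rw [← Complex.ofReal_mul, ← Real.rpow_add hpos]
    ring_nf
    simp
  rw [this]
  simp

/-- The tempered distributions `v` such that `(1 - Δ)^(σ/2) v` is (represented by) a function in
`L^q(ℝ^d)`. -/
noncomputable def besselSubmodule (d : ℕ) (σ q : ℝ) [Fact (1 ≤ q)] :
    Submodule ℂ 𝓢'(Rd d, ℂ) :=
  (LinearMap.range (Lp.toTemperedDistributionCLM ℂ (volume : Measure (Rd d))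
    (ENNReal.ofReal q)).toLinearMap).comap (besselOp d σ).toLinearMap

/-- The Bessel potential space `H^{σ,q}(ℝ^d)`. (A plain `def`, so that it carries the norm below
and not the topology of `𝓢'`.) -/
def BesselSpace (d : ℕ) (σ q : ℝ) [Fact (1 ≤ q)] : Type := besselSubmodule d σ q

namespace BesselSpace

variable {d : ℕ} {σ q : ℝ} [Fact (1 ≤ q)]

noncomputable instance : AddCommGroup (BesselSpace d σ q) :=
  inferInstanceAs (AddCommGroup (besselSubmodule d σ q))

noncomputable instance : Module ℂ (BesselSpace d σ q) :=
  inferInstanceAs (Module ℂ (besselSubmodule d σ q))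

/-- The tempered distribution underlying an element of `H^{σ,q}(ℝ^d)`. -/
noncomputable def toDistribution : BesselSpace d σ q →ₗ[ℂ] 𝓢'(Rd d, ℂ) :=
  (besselSubmodule d σ q).subtype

theorem exists_lp (v : BesselSpace d σ q) :
    ∃ w : Lp ℂ (ENNReal.ofReal q) (volume : Measure (Rd d)),
      Lp.toTemperedDistributionCLM ℂ volume (ENNReal.ofReal q) w =
        besselOp d σ v.toDistribution :=
  v.2

theorem lp_injective : Function.Injective
    (Lp.toTemperedDistributionCLM ℂ (volume : Measure (Rd d)) (ENNReal.ofReal q)) :=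
  LinearMap.ker_eq_bot.mp Lp.ker_toTemperedDistributionCLM_eq_bot

/-- The map `v ↦ (1 - Δ)^(σ/2) v` from `H^{σ,q}(ℝ^d)` to `L^q(ℝ^d)`. -/
noncomputable def toLp :
    BesselSpace d σ q →ₗ[ℂ] Lp ℂ (ENNReal.ofReal q) (volume : Measure (Rd d)) where
  toFun v := (exists_lp v).choose
  map_add' v w := lp_injective <| by
    refine (exists_lp (v + w)).choose_spec.trans ?_
    rw [map_add, map_add, map_add]
    exact (congrArg₂ (· + ·) (exists_lp v).choose_spec (exists_lp w).choose_spec).symm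
  map_smul' c v := lp_injective <| by
    refine (exists_lp (c • v)).choose_spec.trans ?_
    rw [RingHom.id_apply, map_smul, map_smul, map_smul]
    exact (congrArg (c • ·) (exists_lp v).choose_spec).symm

theorem toLp_spec (v : BesselSpace d σ q) :
    (toLp v : 𝓢'(Rd d, ℂ)) = besselOp d σ v.toDistribution :=
  (exists_lp v).choose_spec

theorem toLp_injective : Function.Injective (toLp : BesselSpace d σ q →ₗ[ℂ] _) := by
  intro v w h
  have h1 : besselOp d σ v.toDistribution = besselOp d σ w.toDistribution := by
    rw [← toLp_spec, ← toLp_spec, h]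
  have h2 := congrArg (besselOp d (-σ)) h1
  rw [besselOp_neg_besselOp, besselOp_neg_besselOp] at h2
  exact Subtype.ext h2

/-- The norm `‖v‖_{H^{σ,q}} = ‖(1 - Δ)^(σ/2) v‖_{L^q}`. -/
noncomputable instance : NormedAddCommGroup (BesselSpace d σ q) :=
  NormedAddCommGroup.induced _ _ toLp toLp_injective

noncomputable instance : NormedSpace ℂ (BesselSpace d σ q) :=
  NormedSpace.induced ℂ _ _ toLp

end BesselSpace

/-! ### `γ`-radonifying operators -/

/-- `γ` is a sequence of independent standard Gaussian random variables on `(Ω, P)`. -/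
def IsGaussianSequence {Ω : Type u} [MeasurableSpace Ω] (P : Measure Ω) (γ : ℕ → Ω → ℝ) : Prop :=
  (∀ n, HasLaw (γ n) (gaussianReal 0 1) P) ∧ iIndepFun γ P

section Radonifying

variable {Ω : Type u} [MeasurableSpace Ω] (P : Measure Ω) (γ : ℕ → Ω → ℝ)
  {H X : Type*} [NormedAddCommGroup H] [InnerProductSpace ℝ H]
  [NormedAddCommGroup X] [NormedSpace ℝ X]

/-- The series `∑ γ_n T h_n` converges in `L²(Ω; X)` to `S`. -/
def HasGaussianSum (h : HilbertBasis ℕ ℝ H) (T : H →L[ℝ] X) (S : Ω → X) : Prop :=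
  MemLp S 2 P ∧
    Tendsto (fun N : ℕ ↦
      eLpNorm (fun ω ↦ (∑ n ∈ Finset.range N, γ n ω • T (h n)) - S ω) 2 P) atTop (𝓝 0)

/-- `T` is `γ`-radonifying: `∑ γ_n T h_n` converges in `L²(Ω; X)`. -/
def IsGammaRadonifying (h : HilbertBasis ℕ ℝ H) (T : H →L[ℝ] X) : Prop :=
  ∃ S : Ω → X, HasGaussianSum P γ h T S

/-- The norm `‖T‖_{γ(H,X)} = (𝔼 ‖∑ γ_n T h_n‖²)^{1/2}`. The sum `S` is unique up to almost sure
equality, so the infimum only picks its value; it is `∞` if `T` is not `γ`-radonifying. -/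
noncomputable def gammaNorm (h : HilbertBasis ℕ ℝ H) (T : H →L[ℝ] X) : ℝ≥0∞ :=
  ⨅ (S : Ω → X) (_ : HasGaussianSum P γ h T S), eLpNorm S 2 P

end Radonifying

/-! ### Multiplication operators -/

/-- `T : L²(ℝ^d) → H^{σ,q}(ℝ^d)` is the multiplication operator `M_g`: for every `f ∈ L²(ℝ^d)`,
the tempered distribution `T f` is the function `g f`. -/
def IsMulOperator {d : ℕ} {σ q : ℝ} [Fact (1 ≤ q)] (g : Rd d → ℝ)
    (T : L2 d →L[ℝ] BesselSpace d σ q) : Prop :=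
  ∀ (f : L2 d) (φ : 𝓢(Rd d, ℂ)),
    Integrable (fun x ↦ φ x * ((g x * f x : ℝ) : ℂ)) ∧
      (T f).toDistribution φ = ∫ x, φ x * ((g x * f x : ℝ) : ℂ)

/-! ### Minkowski's integral inequality in `ℝ≥0∞`. -/

section Minkowski

/-! Since `(1 - Δ)^{-s/2}` is an isometry of `H^{-s,q}` onto `L^q` and acts as convolution with the
Bessel kernel `G_s`, the operator `M_g` becomes the integral operator with kernel `G_s(x - y) g(y)`
from `L²` to `L^q`. For such an operator a Gaussian sum is, at each fixed `x`, a scalar Gaussian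
whose variance is given by Parseval. The `γ`-norm is therefore comparable to the `L^q` norm of the
square function `(∫ G_s(x - y)² g(y)² dy)^{1/2}` (`isGammaRadonifying_of_kernel` and
`lintegral_square_function_le_gammaNorm`). The theorem thus asks when convolution with `G_s²` maps
`L^{η/2}` to `L^{q/2}`.

Sufficiency is `exists_lintegral_besselKernel_sq_conv_le`. Cases (b) and (c) are Young's inequality
with `G_s² ∈ L¹` and `G_s² ∈ L^{q/2}`. Case (a) is a Hardy–Littlewood–Sobolev inequality, obtained
by cutting the subordination integral of `G_s` over heat kernels at a time that depends on the
height of the level set.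

Necessity tests indicators of balls (`exists_lintegral_ball_le`). The unit ball forces `s > d/2`,
because `|x|^{-d}` is not integrable at the origin; large balls force `η ≤ q`; small balls force the
scaling inequality, because `G_s ≳ |x|^{s-d}` near `0` when `s ≤ d`. When scaling is an equality, `s
≥ d` and `η = q` are excluded by arithmetic. For `η = 2`, shrinking balls would again make
`|x|^{-d}` integrable (`not_lintegral_ball_le`). -/

theorem ENNReal.rpow_one_div_le_iff {x y : ℝ≥0∞} {z : ℝ} (hz : 0 < z) :
    x ^ (1 / z) ≤ y ↔ x ≤ y ^ z := by
  rw [one_div, ENNReal.rpow_inv_le_iff hz]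

variable {α β : Type*} [MeasurableSpace α] [MeasurableSpace β] {μ : Measure α} {ν : Measure β}

/-- Minkowski's integral inequality, with the inner norms dominated by a weight. -/
theorem lintegral_minkowski_of_weight [SFinite μ] [SFinite ν] {p : ℝ} (hp : 1 ≤ p)
    {F : α → β → ℝ≥0∞} (hF : Measurable (Function.uncurry F)) {b : β → ℝ≥0∞} (hb : Measurable b)
    (hb0 : ∀ᵐ y ∂ν, b y ≠ 0) (hbt : ∀ᵐ y ∂ν, b y ≠ ∞)
    (h : ∀ᵐ y ∂ν, ∫⁻ x, F x y ^ p ∂μ ≤ b y ^ p) :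
    ∫⁻ x, (∫⁻ y, F x y ∂ν) ^ p ∂μ ≤ (∫⁻ y, b y ∂ν) ^ p := by
  rcases hp.eq_or_lt with rfl | hp1
  · simp only [ENNReal.rpow_one] at *
    rw [lintegral_lintegral_swap hF.aemeasurable]
    exact lintegral_mono_ae h
  set q := p.conjExponent
  have hpq : p.HolderConjugate q := Real.HolderConjugate.conjExponent hp1
  have hp0 : 0 < p := hpq.pos
  have hq0 : 0 < q := hpq.symm.pos
  have hFx : ∀ x, Measurable (F x) := fun x ↦ hF.comp measurable_prodMk_left
  -- Hölder for the factorization `F = (F b^{-1/q}) · b^{1/q}`. Integrating over `x` first then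
  -- turns `F^p b^{-(p-1)}` into at most `b`.
  have key : ∀ x, (∫⁻ y, F x y ∂ν) ^ p ≤
      (∫⁻ y, b y ∂ν) ^ (p - 1) * ∫⁻ y, F x y ^ p * b y ^ (-(p - 1)) ∂ν := by
    intro x
    have h1 : ∫⁻ y, F x y ∂ν =
        ∫⁻ y, ((fun y ↦ F x y * b y ^ (-(1 / q))) * (fun y ↦ b y ^ (1 / q))) y ∂ν := by
      refine lintegral_congr_ae ?_
      filter_upwards [hb0, hbt] with y h0 ht
      simp only [Pi.mul_apply]
      rw [mul_assoc, ← ENNReal.rpow_add _ _ h0 ht]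
      simp
    have h2 := ENNReal.lintegral_mul_le_Lp_mul_Lq ν hpq
      (f := fun y ↦ F x y * b y ^ (-(1 / q))) (g := fun y ↦ b y ^ (1 / q))
      ((hFx x).mul (hb.pow_const _)).aemeasurable (hb.pow_const _).aemeasurable
    rw [← h1] at h2
    refine (ENNReal.rpow_le_rpow h2 hp0.le).trans (le_of_eq ?_)
    rw [ENNReal.mul_rpow_of_nonneg _ _ hp0.le, ← ENNReal.rpow_mul, ← ENNReal.rpow_mul,
      one_div_mul_cancel hp0.ne', ENNReal.rpow_one, mul_comm]
    congr 1
    · rw [one_div_mul_eq_div, hpq.div_conj_eq_sub_one]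
      congr 1
      refine lintegral_congr fun y ↦ ?_
      rw [← ENNReal.rpow_mul, one_div_mul_cancel hq0.ne', ENNReal.rpow_one]
    · refine lintegral_congr fun y ↦ ?_
      rw [ENNReal.mul_rpow_of_nonneg _ _ hp0.le, ← ENNReal.rpow_mul, neg_mul, one_div_mul_eq_div,
        hpq.div_conj_eq_sub_one]
  calc ∫⁻ x, (∫⁻ y, F x y ∂ν) ^ p ∂μ
      ≤ ∫⁻ x, (∫⁻ y, b y ∂ν) ^ (p - 1) * ∫⁻ y, F x y ^ p * b y ^ (-(p - 1)) ∂ν ∂μ :=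
        lintegral_mono key
    _ = (∫⁻ y, b y ∂ν) ^ (p - 1) * ∫⁻ y, ∫⁻ x, F x y ^ p * b y ^ (-(p - 1)) ∂μ ∂ν := by
        rw [lintegral_const_mul, lintegral_lintegral_swap]
        · exact ((hF.pow_const p).mul ((hb.comp measurable_snd).pow_const _)).aemeasurable
        · exact ((hF.pow_const p).mul
            ((hb.comp measurable_snd).pow_const _)).lintegral_prod_right'
    _ ≤ (∫⁻ y, b y ∂ν) ^ (p - 1) * ∫⁻ y, b y ∂ν := by
        refine mul_le_mul_right (lintegral_mono_ae ?_) _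
        filter_upwards [hb0, hbt, h] with y h0 ht hy
        rw [lintegral_mul_const]
        · refine (mul_le_mul_left hy _).trans (le_of_eq ?_)
          rw [← ENNReal.rpow_add _ _ h0 ht]
          simp
        · exact (hF.comp measurable_prodMk_right).pow_const p
    _ = (∫⁻ y, b y ∂ν) ^ p := by
        nth_rewrite 2 [← ENNReal.rpow_one (∫⁻ y, b y ∂ν)]
        rw [← ENNReal.rpow_add_of_nonneg _ _ (by linarith) zero_le_one]
        simp

/-- Minkowski's integral inequality. -/
theorem lintegral_minkowski [SFinite μ] [SigmaFinite ν] {p : ℝ} (hp : 1 ≤ p)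
    {F : α → β → ℝ≥0∞} (hF : Measurable (Function.uncurry F)) :
    ∫⁻ x, (∫⁻ y, F x y ∂ν) ^ p ∂μ ≤ (∫⁻ y, (∫⁻ x, F x y ^ p ∂μ) ^ (1 / p) ∂ν) ^ p := by
  have hp0 : 0 < p := by linarith
  set b : β → ℝ≥0∞ := fun y ↦ (∫⁻ x, F x y ^ p ∂μ) ^ (1 / p) with hbdef
  have hb : Measurable b := ((hF.pow_const p).lintegral_prod_left').pow_const _
  by_cases hbi : ∫⁻ y, b y ∂ν = ∞
  · rw [hbi, ENNReal.top_rpow_of_pos hp0]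
    exact le_top
  rw [← ENNReal.rpow_one_div_le_iff hp0]
  refine ENNReal.le_of_forall_pos_le_add fun ε hε _ ↦ ?_
  -- The natural weight `b` may vanish; adding a strictly positive `u` of integral less than `ε`
  -- makes it admissible.
  obtain ⟨u, hu0, hum, hu⟩ := exists_pos_lintegral_lt_of_sigmaFinite ν
    (ε := (ε : ℝ≥0∞)) (by simpa using hε.ne')
  rw [ENNReal.rpow_one_div_le_iff hp0]
  refine (lintegral_minkowski_of_weight hp hF (b := fun y ↦ b y + u y)
    (hb.add hum.coe_nnreal_ennreal) ?_ ?_ ?_).trans ?_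
  · exact Eventually.of_forall fun y ↦ by simp [(hu0 y).ne']
  · filter_upwards [ae_lt_top hb hbi] with y hy
    simp [hy.ne]
  · refine Eventually.of_forall fun y ↦ ?_
    rw [← ENNReal.rpow_one_div_le_iff hp0]
    exact le_self_add
  · refine ENNReal.rpow_le_rpow ?_ hp0.le
    rw [lintegral_add_left hb]
    exact add_le_add_right hu.le _

end Minkowski

/-! ### Young's inequality when one factor is in `L¹`. -/

section Convolution

variable {d : ℕ}

theorem measurable_conv_kernel {k f : Rd d → ℝ≥0∞} (hk : Measurable k) (hf : Measurable f) :
    Measurable (Function.uncurry fun x y : Rd d ↦ k (x - y) * f y) :=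
  (hk.comp measurable_sub).mul (hf.comp measurable_snd)

theorem lintegral_conv {k f : Rd d → ℝ≥0∞} (hk : Measurable k) (hf : Measurable f) :
    ∫⁻ x, ∫⁻ y, k (x - y) * f y = (∫⁻ x, k x) * ∫⁻ y, f y := by
  rw [lintegral_lintegral_swap (measurable_conv_kernel hk hf).aemeasurable]
  have : ∀ y, ∫⁻ x, k (x - y) * f y = (∫⁻ x, k x) * f y := fun y ↦ by
    rw [lintegral_mul_const (f := fun x ↦ k (x - y)) _ (hk.comp (measurable_sub_const y)),
      lintegral_sub_right_eq_self k y]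
  simp_rw [this]
  rw [lintegral_const_mul _ hf]

theorem lintegral_conv_comm (k f : Rd d → ℝ≥0∞) (x : Rd d) :
    ∫⁻ y, k (x - y) * f y = ∫⁻ y, f (x - y) * k y := by
  rw [← lintegral_sub_left_eq_self (fun y ↦ f (x - y) * k y) x]
  simp [mul_comm]

/-- Young's inequality `L^p * L^1 → L^p`. -/
theorem lintegral_conv_rpow_le {p : ℝ} (hp : 1 ≤ p) {k f : Rd d → ℝ≥0∞} (hk : Measurable k)
    (hf : Measurable f) :
    ∫⁻ x, (∫⁻ y, k (x - y) * f y) ^ p ≤ (∫⁻ x, k x ^ p) * (∫⁻ y, f y) ^ p := by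
  have hp0 : 0 < p := by linarith
  refine (lintegral_minkowski hp (measurable_conv_kernel hk hf)).trans (le_of_eq ?_)
  have : ∀ y, (∫⁻ x, (k (x - y) * f y) ^ p) ^ (1 / p) = (∫⁻ x, k x ^ p) ^ (1 / p) * f y := by
    intro y
    simp_rw [ENNReal.mul_rpow_of_nonneg _ _ hp0.le]
    rw [lintegral_mul_const (f := fun x ↦ k (x - y) ^ p) _ ((hk.comp (measurable_sub_const y)).pow_const p),
      lintegral_sub_right_eq_self (fun z ↦ k z ^ p) y,
      ENNReal.mul_rpow_of_nonneg _ _ (by positivity), ← ENNReal.rpow_mul,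
      mul_one_div_cancel hp0.ne', ENNReal.rpow_one]
  simp_rw [this]
  rw [lintegral_const_mul _ hf, ENNReal.mul_rpow_of_nonneg _ _ hp0.le, ← ENNReal.rpow_mul,
    one_div_mul_cancel hp0.ne', ENNReal.rpow_one]

/-- Young's inequality `L^1 * L^p → L^p`. -/
theorem lintegral_conv_rpow_le' {p : ℝ} (hp : 1 ≤ p) {k f : Rd d → ℝ≥0∞} (hk : Measurable k)
    (hf : Measurable f) :
    ∫⁻ x, (∫⁻ y, k (x - y) * f y) ^ p ≤ (∫⁻ x, k x) ^ p * ∫⁻ y, f y ^ p := by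
  simp_rw [lintegral_conv_comm k f]
  rw [mul_comm]
  exact lintegral_conv_rpow_le hp hf hk

end Convolution

/-! ### Layer cake formula. -/

section HardyLittlewoodSobolev

/-- The pointwise layer cake identity, with `a = ∞` allowed. It serves twice: for the formula below,
and to carry out the integral over heights in the Hardy–Littlewood–Sobolev bound. -/
theorem lintegral_rpow_sub_one_of_lt {r : ℝ} (hr : 0 < r) (a : ℝ≥0∞) :
    ∫⁻ t in Set.Ioi (0 : ℝ), {t : ℝ | ENNReal.ofReal t < a}.indicator
      (fun t ↦ ENNReal.ofReal (t ^ (r - 1))) t = ENNReal.ofReal r⁻¹ * a ^ r := by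
  have hm : MeasurableSet {t : ℝ | ENNReal.ofReal t < a} :=
    measurableSet_lt ENNReal.measurable_ofReal measurable_const
  have fin : ∀ b : ℝ, 0 ≤ b → ∫⁻ t in Set.Ioo (0 : ℝ) b, ENNReal.ofReal (t ^ (r - 1)) =
      ENNReal.ofReal (r⁻¹ * b ^ r) := by
    intro b hb
    have hint : IntervalIntegrable (fun t : ℝ ↦ t ^ (r - 1)) volume 0 b :=
      intervalIntegral.intervalIntegrable_rpow' (by linarith)
    rw [restrict_Ioo_eq_restrict_Ioc, ← ofReal_integral_eq_lintegral_ofReal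
      ((intervalIntegrable_iff_integrableOn_Ioc_of_le hb).1 hint)
      ((ae_restrict_mem measurableSet_Ioc).mono fun t ht ↦ Real.rpow_nonneg ht.1.le _),
      ← intervalIntegral.integral_of_le hb, integral_rpow (Or.inl (by linarith))]
    rw [sub_add_cancel, Real.zero_rpow hr.ne', sub_zero, div_eq_inv_mul]
  rw [lintegral_indicator hm, Measure.restrict_restrict hm]
  induction a with
  | top =>
    simp only [ENNReal.ofReal_lt_top, Set.ofPred_true, Set.univ_inter]
    rw [ENNReal.top_rpow_of_pos hr, ENNReal.mul_top (by simpa using hr), eq_top_iff]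
    refine ENNReal.le_of_forall_nnreal_lt fun c _ ↦ ?_
    set b : ℝ := (r * c) ^ r⁻¹ with hb
    have hb0 : 0 ≤ b := by positivity
    calc (c : ℝ≥0∞) = ENNReal.ofReal (r⁻¹ * b ^ r) := by
          rw [hb, ← Real.rpow_mul (by positivity), inv_mul_cancel₀ hr.ne', Real.rpow_one,
            inv_mul_cancel_left₀ hr.ne', ENNReal.ofReal_coe_nnreal]
      _ = ∫⁻ t in Set.Ioo (0 : ℝ) b, ENNReal.ofReal (t ^ (r - 1)) := (fin b hb0).symm
      _ ≤ _ := lintegral_mono_set Set.Ioo_subset_Ioi_self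
  | coe a =>
    have : {t : ℝ | ENNReal.ofReal t < a} ∩ Set.Ioi 0 = Set.Ioo (0 : ℝ) a := by
      ext t
      simp only [Set.mem_inter_iff, Set.mem_ofPred_eq, Set.mem_Ioi, Set.mem_Ioo]
      constructor
      · rintro ⟨h1, h2⟩
        exact ⟨h2, by rwa [← ENNReal.ofReal_coe_nnreal, ENNReal.ofReal_lt_ofReal_iff_of_nonneg h2.le] at h1⟩
      · rintro ⟨h1, h2⟩
        exact ⟨by rwa [← ENNReal.ofReal_coe_nnreal, ENNReal.ofReal_lt_ofReal_iff_of_nonneg h1.le], h1⟩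
    rw [this, fin a a.coe_nonneg, ENNReal.ofReal_mul (by positivity),
      ← ENNReal.ofReal_rpow_of_nonneg a.coe_nonneg hr.le, ENNReal.ofReal_coe_nnreal]

/-- Layer cake formula for functions with values in `[0, ∞]`. -/
theorem lintegral_rpow_eq_lintegral_meas_ofReal_lt {α : Type*} [MeasurableSpace α] {μ : Measure α}
    [SFinite μ] {h : α → ℝ≥0∞} (hh : Measurable h) {r : ℝ} (hr : 0 < r) :
    ∫⁻ x, h x ^ r ∂μ = ENNReal.ofReal r *
      ∫⁻ t in Set.Ioi (0 : ℝ), ENNReal.ofReal (t ^ (r - 1)) * μ {x | ENNReal.ofReal t < h x} := by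
  have h1 : ∀ x, h x ^ r = ENNReal.ofReal r * ∫⁻ t in Set.Ioi (0 : ℝ),
      {t : ℝ | ENNReal.ofReal t < h x}.indicator (fun t ↦ ENNReal.ofReal (t ^ (r - 1))) t := by
    intro x
    rw [lintegral_rpow_sub_one_of_lt hr, ← mul_assoc, ← ENNReal.ofReal_mul hr.le,
      mul_inv_cancel₀ hr.ne', ENNReal.ofReal_one, one_mul]
  have hm : MeasurableSet {z : α × ℝ | ENNReal.ofReal z.2 < h z.1} :=
    measurableSet_lt (ENNReal.measurable_ofReal.comp measurable_snd) (hh.comp measurable_fst)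
  have hm' : Measurable (Function.uncurry fun (x : α) (t : ℝ) ↦
      {t : ℝ | ENNReal.ofReal t < h x}.indicator (fun t ↦ ENNReal.ofReal (t ^ (r - 1))) t) := by
    refine (Measurable.indicator (f := fun z : α × ℝ ↦ ENNReal.ofReal (z.2 ^ (r - 1)))
      (by fun_prop) hm)
  simp_rw [h1]
  rw [lintegral_const_mul (f := fun x ↦ ∫⁻ t in Set.Ioi (0 : ℝ),
      {t : ℝ | ENNReal.ofReal t < h x}.indicator (fun t ↦ ENNReal.ofReal (t ^ (r - 1))) t) _
      hm'.lintegral_prod_right', lintegral_lintegral_swap hm'.aemeasurable]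
  congr 1
  refine lintegral_congr fun t ↦ ?_
  rw [← lintegral_indicator_const (measurableSet_lt measurable_const hh)]
  rfl

end HardyLittlewoodSobolev

/-! ### Hardy–Littlewood–Sobolev inequality from a splitting of the kernel. -/

section HardyLittlewoodSobolev

variable {d : ℕ}

/-- Truncate `f` at height `β` into `f₁ + f₂`. The terms `k₁ * f₁` and `k₂ * f` are everywhere at
most `t/4`, the second by Hölder, so `K * f > t` forces `k₁ * f₂ ≥ t/2`. Chebyshev and the `L¹`
bound on `k₁` finish, since `f₂` lives where `f > β`. -/
theorem meas_lt_conv_le {p q r A t : ℝ} (hpq : p.HolderConjugate q) (hA : 0 < A) (ht : 0 < t)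
    {K f k₁ k₂ : Rd d → ℝ≥0∞} (hf : Measurable f) (hk₁ : Measurable k₁) (hk₂ : Measurable k₂)
    (hK : ∀ x, K x ≤ k₁ x + k₂ x) (h₁ : ∫⁻ x, k₁ x ≤ ENNReal.ofReal (A * t ^ (1 - r / p)))
    (h₂ : (∫⁻ x, k₂ x ^ q) ^ (1 / q) ≤ ENNReal.ofReal (t / 4)) (hf1 : ∫⁻ x, f x ^ p ≤ 1) :
    volume {x | ENNReal.ofReal t < ∫⁻ y, K (x - y) * f y} ≤
      ENNReal.ofReal (2 * A * t ^ (-(r / p))) *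
        ∫⁻ y, {y | ENNReal.ofReal (t ^ (r / p)) < ENNReal.ofReal (4 * A) * f y}.indicator f y := by
  have hp0 : 0 < p := hpq.pos
  -- Chosen so that `A t^{1 - r/p} · β = t/4`.
  set β : ℝ := t ^ (r / p) / (4 * A) with hβ
  have hβ0 : 0 < β := by positivity
  set f₁ : Rd d → ℝ≥0∞ := fun y ↦ min (f y) (ENNReal.ofReal β) with hf₁
  set f₂ : Rd d → ℝ≥0∞ := fun y ↦ f y - ENNReal.ofReal β with hf₂
  have hf₂m : Measurable f₂ := hf.sub_const _
  have hsplit : ∀ y, f y = f₁ y + f₂ y := fun y ↦ by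
    simp only [hf₁, hf₂]
    rcases le_total (f y) (ENNReal.ofReal β) with h | h
    · simp [h, tsub_eq_zero_of_le h]
    · rw [min_eq_right h, add_tsub_cancel_of_le h]
  have hf₂le : ∀ y, f₂ y ≤
      {y | ENNReal.ofReal (t ^ (r / p)) < ENNReal.ofReal (4 * A) * f y}.indicator f y := fun y ↦ by
    by_cases hy : ENNReal.ofReal (t ^ (r / p)) < ENNReal.ofReal (4 * A) * f y
    · rw [Set.indicator_of_mem (by exact hy)]
      exact tsub_le_self
    · rw [Set.indicator_of_notMem (by exact hy)]
      refine (tsub_eq_zero_of_le ?_).le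
      rw [hβ, ENNReal.ofReal_div_of_pos (by positivity), ENNReal.le_div_iff_mul_le
        (Or.inl (by simpa using hA)) (Or.inl ENNReal.ofReal_ne_top), mul_comm]
      exact not_lt.1 hy
  have hmk : ∀ {k : Rd d → ℝ≥0∞} (_ : Measurable k) (x : Rd d), Measurable fun y ↦ k (x - y) :=
    fun hk x ↦ hk.comp (measurable_const_sub x)
  have hb1 : ∀ x, ∫⁻ y, k₁ (x - y) * f₁ y ≤ ENNReal.ofReal (t / 4) := fun x ↦ by
    calc ∫⁻ y, k₁ (x - y) * f₁ y ≤ ∫⁻ y, k₁ (x - y) * ENNReal.ofReal β :=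
          lintegral_mono fun y ↦ mul_le_mul_right (min_le_right _ _) _
      _ = (∫⁻ y, k₁ y) * ENNReal.ofReal β := by
          rw [lintegral_mul_const _ (hmk hk₁ x), lintegral_sub_left_eq_self]
      _ ≤ ENNReal.ofReal (A * t ^ (1 - r / p)) * ENNReal.ofReal β := mul_le_mul_left h₁ _
      _ = ENNReal.ofReal (t / 4) := by
          rw [← ENNReal.ofReal_mul (by positivity), hβ]
          congr 1
          have : t ^ (1 - r / p) * t ^ (r / p) = t := by
            rw [← Real.rpow_add ht]; simp
          rw [mul_div_assoc', mul_assoc, this]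
          field_simp
  have hb2 : ∀ x, ∫⁻ y, k₂ (x - y) * f y ≤ ENNReal.ofReal (t / 4) := fun x ↦ by
    refine (ENNReal.lintegral_mul_le_Lp_mul_Lq volume hpq.symm (hmk hk₂ x).aemeasurable
      hf.aemeasurable).trans ?_
    rw [lintegral_sub_left_eq_self (fun z ↦ k₂ z ^ q) x]
    refine (mul_le_mul' h₂ (ENNReal.rpow_le_rpow hf1 (by positivity))).trans ?_
    simp
  have hsub : {x | ENNReal.ofReal t < ∫⁻ y, K (x - y) * f y} ⊆
      {x | ENNReal.ofReal (t / 2) ≤ ∫⁻ y, k₁ (x - y) * f₂ y} := by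
    intro x hx
    simp only [Set.mem_ofPred_eq] at hx ⊢
    have hle : ∫⁻ y, K (x - y) * f y ≤
        ENNReal.ofReal (t / 2) + ∫⁻ y, k₁ (x - y) * f₂ y := by
      calc ∫⁻ y, K (x - y) * f y
          ≤ ∫⁻ y, (k₁ (x - y) * f₁ y + k₂ (x - y) * f y) + k₁ (x - y) * f₂ y := by
            refine lintegral_mono fun y ↦ (mul_le_mul_left (hK _) _).trans (le_of_eq ?_)
            rw [add_mul]
            nth_rewrite 1 [hsplit y]
            rw [mul_add]
            ring
        _ ≤ (ENNReal.ofReal (t / 4) + ENNReal.ofReal (t / 4)) + ∫⁻ y, k₁ (x - y) * f₂ y := by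
            rw [lintegral_add_right (g := fun y ↦ k₁ (x - y) * f₂ y) _ ((hmk hk₁ x).mul hf₂m),
              lintegral_add_right (g := fun y ↦ k₂ (x - y) * f y) _ ((hmk hk₂ x).mul hf)]
            exact add_le_add_left (add_le_add (hb1 x) (hb2 x)) _
        _ = _ := by
            rw [← ENNReal.ofReal_add (by positivity) (by positivity)]
            ring_nf
    by_contra hcon
    push Not at hcon
    refine (hx.trans_le (hle.trans (add_le_add_right hcon.le _))).ne ?_
    rw [← ENNReal.ofReal_add (by positivity) (by positivity)]
    ring_nf
  refine (measure_mono hsub).trans ?_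
  refine (meas_ge_le_lintegral_div (measurable_conv_kernel hk₁ hf₂m).lintegral_prod_right'.aemeasurable
    (by simpa using ht) ENNReal.ofReal_ne_top).trans ?_
  simp only [Function.uncurry_apply_pair]
  rw [lintegral_conv hk₁ hf₂m, ENNReal.div_eq_inv_mul, ← ENNReal.ofReal_inv_of_pos (by positivity),
    ← mul_assoc]
  refine mul_le_mul' ((mul_le_mul_right h₁ _).trans (le_of_eq ?_)) (lintegral_mono hf₂le)
  rw [← ENNReal.ofReal_mul (by positivity), sub_eq_add_neg, Real.rpow_add ht, Real.rpow_one]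
  congr 1
  field_simp

/-- A Hardy–Littlewood–Sobolev inequality for kernels that split into an integrable part and a
part in the dual exponent at every height. -/
theorem lintegral_conv_rpow_le_of_decomposition {p q r A : ℝ} (hpq : p.HolderConjugate q)
    (hpr : p < r) (hA : 0 < A) {K f : Rd d → ℝ≥0∞} (hK : Measurable K) (hf : Measurable f)
    (hdec : ∀ t : ℝ, 0 < t → ∃ k₁ k₂ : Rd d → ℝ≥0∞, Measurable k₁ ∧ Measurable k₂ ∧
      (∀ x, K x ≤ k₁ x + k₂ x) ∧ ∫⁻ x, k₁ x ≤ ENNReal.ofReal (A * t ^ (1 - r / p)) ∧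
      (∫⁻ x, k₂ x ^ q) ^ (1 / q) ≤ ENNReal.ofReal (t / 4)) (hf1 : ∫⁻ x, f x ^ p ≤ 1) :
    ∫⁻ x, (∫⁻ y, K (x - y) * f y) ^ r ≤
      ENNReal.ofReal (r * (2 * A) * (r - r / p)⁻¹ * (4 * A) ^ (p - 1)) := by
  have hp0 : 0 < p := hpq.pos
  have hp1 : 1 < p := hpq.lt
  have hr0 : 0 < r := hp0.trans hpr
  have hρ : 0 < r - r / p := by
    rw [sub_pos, div_lt_iff₀ hp0]
    nlinarith
  have hTm : Measurable fun x ↦ ∫⁻ y, K (x - y) * f y :=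
    (measurable_conv_kernel hK hf).lintegral_prod_right'
  rw [lintegral_rpow_eq_lintegral_meas_ofReal_lt hTm hr0]
  -- For fixed `y` the truncation condition is an upper bound on `t`. After Tonelli, the integral of
  -- `t^{r - r/p - 1}` up to that bound gives a multiple of `f(y)^{p-1}`, because `(p/r)(r - r/p) =
  -- p - 1`.
  have hset : ∀ (t : ℝ) (_ : 0 < t) (y : Rd d),
      ENNReal.ofReal (t ^ (r / p)) < ENNReal.ofReal (4 * A) * f y ↔
      ENNReal.ofReal t < (ENNReal.ofReal (4 * A) * f y) ^ (p / r) := by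
    intro t ht y
    rw [← ENNReal.ofReal_rpow_of_pos ht, ← inv_div p r, ENNReal.rpow_inv_lt_iff (by positivity)]
  have hm : MeasurableSet {z : ℝ × Rd d |
      ENNReal.ofReal z.1 < (ENNReal.ofReal (4 * A) * f z.2) ^ (p / r)} :=
    measurableSet_lt (by fun_prop) (by fun_prop)
  set ind : ℝ → Rd d → ℝ≥0∞ := fun t y ↦
    {t : ℝ | ENNReal.ofReal t < (ENNReal.ofReal (4 * A) * f y) ^ (p / r)}.indicator
      (fun t ↦ ENNReal.ofReal (t ^ (r - r / p - 1))) t with hind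
  have hindm : Measurable (Function.uncurry ind) :=
    Measurable.indicator (f := fun z : ℝ × Rd d ↦ ENNReal.ofReal (z.1 ^ (r - r / p - 1)))
      (by fun_prop) hm
  have hbound : ∀ t ∈ Set.Ioi (0 : ℝ), ENNReal.ofReal (t ^ (r - 1)) *
      volume {x | ENNReal.ofReal t < ∫⁻ y, K (x - y) * f y} ≤
      ENNReal.ofReal (2 * A) * ∫⁻ y, ind t y * f y := by
    intro t ht
    have ht : 0 < t := ht
    obtain ⟨k₁, k₂, hk₁, hk₂, hle, h₁, h₂⟩ := hdec t ht
    refine (mul_le_mul_right (meas_lt_conv_le hpq hA ht hf hk₁ hk₂ hle h₁ h₂ hf1) _).trans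
      (le_of_eq ?_)
    have hpow : t ^ (r - 1) * (2 * A * t ^ (-(r / p))) = 2 * A * t ^ (r - r / p - 1) := by
      rw [show r - r / p - 1 = (r - 1) + -(r / p) by ring, Real.rpow_add ht]
      ring
    rw [← mul_assoc, ← ENNReal.ofReal_mul (by positivity), hpow,
      ENNReal.ofReal_mul (by positivity), mul_assoc]
    congr 1
    rw [← lintegral_const_mul' _ _ ENNReal.ofReal_ne_top]
    refine lintegral_congr fun y ↦ ?_
    simp only [hind, Set.indicator_apply, Set.mem_ofPred_eq, hset t ht y]
    split_ifs <;> simp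
  calc ENNReal.ofReal r * ∫⁻ t in Set.Ioi (0 : ℝ), ENNReal.ofReal (t ^ (r - 1)) *
        volume {x | ENNReal.ofReal t < ∫⁻ y, K (x - y) * f y}
      ≤ ENNReal.ofReal r * ∫⁻ t in Set.Ioi (0 : ℝ), ENNReal.ofReal (2 * A) *
          ∫⁻ y, ind t y * f y :=
        mul_le_mul_right (setLIntegral_mono' measurableSet_Ioi hbound) _
    _ = ENNReal.ofReal (r * (2 * A)) * ∫⁻ y, (∫⁻ t in Set.Ioi (0 : ℝ), ind t y) * f y := by
        rw [lintegral_const_mul' _ _ ENNReal.ofReal_ne_top, ← mul_assoc,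
          ← ENNReal.ofReal_mul hr0.le, lintegral_lintegral_swap]
        · congr 1
          refine lintegral_congr fun y ↦ ?_
          rw [lintegral_mul_const]
          exact hindm.comp measurable_prodMk_right
        · exact (hindm.mul (hf.comp measurable_snd)).aemeasurable
    _ = ENNReal.ofReal (r * (2 * A)) * ∫⁻ y, ENNReal.ofReal ((r - r / p)⁻¹ * (4 * A) ^ (p - 1)) *
          f y ^ p := by
        congr 1
        refine lintegral_congr fun y ↦ ?_
        simp only [hind]
        rw [lintegral_rpow_sub_one_of_lt hρ, ← ENNReal.rpow_mul,
          show p / r * (r - r / p) = p - 1 by field_simp,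
          ENNReal.mul_rpow_of_nonneg _ _ (by linarith),
          ENNReal.ofReal_rpow_of_pos (by positivity), ← mul_assoc,
          ← ENNReal.ofReal_mul (by positivity), mul_assoc]
        congr 1
        nth_rewrite 2 [← ENNReal.rpow_one (f y)]
        rw [← ENNReal.rpow_add_of_nonneg _ _ (by linarith) zero_le_one, sub_add_cancel]
    _ ≤ _ := by
        rw [lintegral_const_mul' _ _ ENNReal.ofReal_ne_top, ← mul_assoc,
          ← ENNReal.ofReal_mul (by positivity), ← mul_assoc]
        exact mul_le_of_le_one_right zero_le hf1

/-- The Hardy–Littlewood–Sobolev inequality without normalization. -/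
theorem exists_lintegral_conv_rpow_le_of_decomposition {p q r A : ℝ} (hpq : p.HolderConjugate q)
    (hpr : p < r) (hA : 0 < A) {K : Rd d → ℝ≥0∞} (hK : Measurable K)
    (hdec : ∀ t : ℝ, 0 < t → ∃ k₁ k₂ : Rd d → ℝ≥0∞, Measurable k₁ ∧ Measurable k₂ ∧
      (∀ x, K x ≤ k₁ x + k₂ x) ∧ ∫⁻ x, k₁ x ≤ ENNReal.ofReal (A * t ^ (1 - r / p)) ∧
      (∫⁻ x, k₂ x ^ q) ^ (1 / q) ≤ ENNReal.ofReal (t / 4)) :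
    ∃ C : ℝ≥0, ∀ f : Rd d → ℝ≥0∞, Measurable f → ∫⁻ x, f x ^ p ≠ ∞ →
      ∫⁻ x, (∫⁻ y, K (x - y) * f y) ^ r ≤ C * (∫⁻ x, f x ^ p) ^ (r / p) := by
  have hp0 : 0 < p := hpq.pos
  have hr0 : 0 < r := hp0.trans hpr
  refine ⟨(r * (2 * A) * (r - r / p)⁻¹ * (4 * A) ^ (p - 1)).toNNReal, fun f hf hfin ↦ ?_⟩
  change _ ≤ ENNReal.ofReal _ * _
  set I := ∫⁻ x, f x ^ p with hI
  by_cases h0 : I = 0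
  · have hf0 : f =ᵐ[volume] 0 := by
      rw [hI, lintegral_eq_zero_iff (hf.pow_const p)] at h0
      filter_upwards [h0] with x hx
      simpa [hp0, hp0.le, not_lt.2 hp0.le] using hx
    have : ∀ x, ∫⁻ y, K (x - y) * f y = 0 := fun x ↦ by
      rw [lintegral_congr_ae (g := fun _ ↦ 0)]
      · simp
      · filter_upwards [hf0] with y hy
        simp [hy]
    simp [this, hr0]
  set N := I ^ (1 / p) with hN
  have hN0 : N ≠ 0 := by simp [hN, h0, hfin]
  have hNt : N ≠ ∞ := by simp [hN, h0, hfin]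
  have hNp : N ^ p = I := by
    rw [hN, ← ENNReal.rpow_mul, one_div_mul_cancel hp0.ne', ENNReal.rpow_one]
  have h := lintegral_conv_rpow_le_of_decomposition hpq hpr hA hK (f := fun y ↦ N⁻¹ * f y)
    (hf.const_mul _) hdec ?_
  · have hpull : ∀ x, (∫⁻ y, K (x - y) * f y) ^ r =
        N ^ r * (∫⁻ y, K (x - y) * (N⁻¹ * f y)) ^ r := fun x ↦ by
      rw [← ENNReal.mul_rpow_of_nonneg _ _ hr0.le, ← lintegral_const_mul' _ _ hNt]
      congr 1
      refine lintegral_congr fun y ↦ ?_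
      rw [mul_left_comm, ← mul_assoc N, ENNReal.mul_inv_cancel hN0 hNt, one_mul]
    simp_rw [hpull]
    rw [lintegral_const_mul' _ _ (ENNReal.rpow_ne_top_of_nonneg hr0.le hNt), mul_comm]
    refine mul_le_mul' h (le_of_eq ?_)
    rw [hN, ← ENNReal.rpow_mul]
    congr 1
    ring
  · simp_rw [ENNReal.mul_rpow_of_nonneg _ _ hp0.le]
    rw [lintegral_const_mul _ (hf.pow_const p), ENNReal.inv_rpow, hNp, ← hI,
      ENNReal.inv_mul_cancel h0 hfin]

end HardyLittlewoodSobolev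

/-! ### Heat kernel: `L^p` norms and Fourier transform. -/

section HeatKernel

/-- The heat kernel `(4πt)^{-d/2} exp (-|x|²/4t)`. -/
noncomputable def heatKernel (d : ℕ) (t : ℝ) (x : Rd d) : ℝ :=
  (4 * Real.pi * t) ^ (-((d : ℝ) / 2)) * Real.exp (-((4 * t)⁻¹ * ‖x‖ ^ 2))

variable {d : ℕ}

theorem heatKernel_nonneg {t : ℝ} (ht : 0 < t) (x : Rd d) : 0 ≤ heatKernel d t x := by
  unfold heatKernel; positivity

theorem measurable_heatKernel : Measurable fun z : ℝ × Rd d ↦ heatKernel d z.1 z.2 := by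
  unfold heatKernel; fun_prop

theorem integrable_exp_neg_mul_norm_sq {b : ℝ} (hb : 0 < b) :
    Integrable fun x : Rd d ↦ Real.exp (-b * ‖x‖ ^ 2) := by
  have h := GaussianFourier.integrable_cexp_neg_mul_sq_norm_add (V := Rd d) (b := b)
    (by simpa using hb) 0 0
  refine h.norm.congr (Eventually.of_forall fun x ↦ ?_)
  simp only [Complex.norm_exp]
  norm_cast
  simp

/-- The Gaussian integral is explicit; the factor `p^{-d/2} ≤ 1` is dropped. -/
theorem lintegral_heatKernel_rpow_le {t : ℝ} (ht : 0 < t) {p : ℝ} (hp : 1 ≤ p) :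
    ∫⁻ x, ENNReal.ofReal (heatKernel d t x) ^ p ≤
      ENNReal.ofReal ((4 * Real.pi * t) ^ (-((d : ℝ) / 2) * (p - 1))) := by
  have hp0 : 0 < p := by linarith
  have hpi := Real.pi_pos
  have h1 : ∀ x : Rd d, ENNReal.ofReal (heatKernel d t x) ^ p =
      ENNReal.ofReal ((4 * Real.pi * t) ^ (-((d : ℝ) / 2) * p) *
        Real.exp (-(p * (4 * t)⁻¹) * ‖x‖ ^ 2)) := fun x ↦ by
    rw [ENNReal.ofReal_rpow_of_nonneg (heatKernel_nonneg ht x) hp0.le, heatKernel,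
      Real.mul_rpow (by positivity) (by positivity), ← Real.rpow_mul (by positivity),
      ← Real.exp_mul]
    ring_nf
  have hb : 0 < p * (4 * t)⁻¹ := by positivity
  simp_rw [h1]
  rw [← ofReal_integral_eq_lintegral_ofReal ((integrable_exp_neg_mul_norm_sq hb).const_mul _)
    (Eventually.of_forall fun x ↦ by positivity), integral_const_mul,
    GaussianFourier.integral_rexp_neg_mul_sq_norm hb]
  refine ENNReal.ofReal_le_ofReal ?_
  rw [finrank_euclideanSpace_fin]
  calc (4 * Real.pi * t) ^ (-((d : ℝ) / 2) * p) * (Real.pi / (p * (4 * t)⁻¹)) ^ ((d : ℝ) / 2)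
      ≤ (4 * Real.pi * t) ^ (-((d : ℝ) / 2) * p) * (4 * Real.pi * t) ^ ((d : ℝ) / 2) := by
        gcongr
        rw [div_le_iff₀ hb]
        field_simp
        exact hp
    _ = _ := by
        rw [← Real.rpow_add (by positivity)]
        ring_nf

theorem lintegral_heatKernel_rpow_one_div_le {t : ℝ} (ht : 0 < t) {p : ℝ} (hp : 1 ≤ p) :
    (∫⁻ x, ENNReal.ofReal (heatKernel d t x) ^ p) ^ (1 / p) ≤
      ENNReal.ofReal ((4 * Real.pi * t) ^ (-((d : ℝ) / 2 * (1 - 1 / p)))) := by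
  have hp0 : 0 < p := by linarith
  have hpi := Real.pi_pos
  rw [ENNReal.rpow_one_div_le_iff hp0, ENNReal.ofReal_rpow_of_nonneg (by positivity) hp0.le,
    ← Real.rpow_mul (by positivity)]
  refine (lintegral_heatKernel_rpow_le ht hp).trans (le_of_eq ?_)
  congr 2
  field_simp

theorem lintegral_heatKernel_le {t : ℝ} (ht : 0 < t) :
    ∫⁻ x, ENNReal.ofReal (heatKernel d t x) ≤ 1 := by
  simpa using lintegral_heatKernel_rpow_le (d := d) ht le_rfl

open FourierTransform in
theorem fourier_heatKernel {t : ℝ} (ht : 0 < t) (ξ : Rd d) :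
    𝓕 (fun x : Rd d ↦ (heatKernel d t x : ℂ)) ξ =
      (Real.exp (-(4 * Real.pi ^ 2 * t * ‖ξ‖ ^ 2)) : ℝ) := by
  have hpi := Real.pi_pos
  have hb : 0 < (((4 * t)⁻¹ : ℝ) : ℂ).re := by
    rw [Complex.ofReal_re]; positivity
  have h1 : (fun x : Rd d ↦ (heatKernel d t x : ℂ)) =
      (((4 * Real.pi * t) ^ (-((d : ℝ) / 2)) : ℝ) : ℂ) •
        fun x : Rd d ↦ Complex.exp (-(((4 * t)⁻¹ : ℝ) : ℂ) * ‖x‖ ^ 2) := by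
    ext x
    simp only [heatKernel, Pi.smul_apply, smul_eq_mul]
    push_cast
    ring_nf
  rw [h1, Real.fourier_eq, ]
  simp only [Pi.smul_apply, smul_comm _ (((4 * Real.pi * t) ^ (-((d : ℝ) / 2)) : ℝ) : ℂ)]
  rw [integral_smul, ← Real.fourier_eq, fourier_gaussian_innerProductSpace hb,
    finrank_euclideanSpace_fin]
  have h2 : ((Real.pi : ℂ) / (((4 * t)⁻¹ : ℝ) : ℂ)) ^ ((d : ℂ) / 2) =
      (((4 * Real.pi * t) ^ ((d : ℝ) / 2) : ℝ) : ℂ) := by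
    rw [← Complex.ofReal_div, Complex.ofReal_cpow (by positivity)]
    push_cast
    congr 1
    field_simp
  rw [h2, smul_eq_mul, ← mul_assoc, ← Complex.ofReal_mul, ← Real.rpow_add (by positivity)]
  simp only [neg_add_cancel, Real.rpow_zero, Complex.ofReal_one, one_mul]
  push_cast
  congr 1
  field_simp

end HeatKernel

/-! ### Bessel kernel by subordination: integrability and lower bound at the origin. -/

section BesselKernel

/-- The density `t^{s/2-1} e^{-t}` of the subordination formula for the Bessel kernel. -/
noncomputable def besselWeight (s t : ℝ) : ℝ := t ^ (s / 2 - 1) * Real.exp (-t)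

/-- The Bessel kernel `Γ(s/2)⁻¹ ∫₀^∞ t^{s/2-1} e^{-t} p_t(x) dt`, where `p_t` is the heat kernel. -/
noncomputable def besselKernel (d : ℕ) (s : ℝ) (x : Rd d) : ℝ :=
  (Real.Gamma (s / 2))⁻¹ * ∫ t in Set.Ioi (0 : ℝ), besselWeight s t * heatKernel d t x

/-- The part of the (unnormalized) Bessel kernel that comes from times in `S`. -/
noncomputable def besselPart (d : ℕ) (s : ℝ) (S : Set ℝ) (x : Rd d) : ℝ≥0∞ :=
  ∫⁻ t in S, ENNReal.ofReal (besselWeight s t) * ENNReal.ofReal (heatKernel d t x)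

variable {d : ℕ} {s : ℝ}

theorem besselWeight_nonneg {t : ℝ} (ht : 0 < t) : 0 ≤ besselWeight s t := by
  unfold besselWeight; positivity

theorem measurable_besselWeight : Measurable (besselWeight s) := by
  unfold besselWeight; fun_prop

theorem integrableOn_besselWeight (hs : 0 < s) :
    IntegrableOn (besselWeight s) (Set.Ioi 0) := by
  refine (Real.GammaIntegral_convergent (half_pos hs)).congr_fun (fun t _ ↦ ?_) measurableSet_Ioi
  rw [besselWeight, mul_comm]

theorem measurable_besselIntegrand :
    Measurable fun z : ℝ × Rd d ↦ besselWeight s z.1 * heatKernel d z.1 z.2 :=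
  (measurable_besselWeight.comp measurable_fst).mul measurable_heatKernel

theorem measurable_besselKernel : Measurable (besselKernel d s) := by
  have h : StronglyMeasurable fun z : Rd d × ℝ ↦ besselWeight s z.2 * heatKernel d z.2 z.1 :=
    (measurable_besselIntegrand.comp measurable_swap).stronglyMeasurable
  exact (h.integral_prod_right' (ν := volume.restrict (Set.Ioi 0))).measurable.const_mul _

theorem measurable_besselPart (S : Set ℝ) : Measurable (besselPart d s S) := by
  have h : Measurable fun z : Rd d × ℝ ↦
      ENNReal.ofReal (besselWeight s z.2) * ENNReal.ofReal (heatKernel d z.2 z.1) :=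
    ((measurable_besselWeight.comp measurable_snd).ennreal_ofReal).mul
      (measurable_heatKernel.comp measurable_swap).ennreal_ofReal
  exact h.lintegral_prod_right'

theorem besselKernel_nonneg (hs : 0 < s) (x : Rd d) : 0 ≤ besselKernel d s x := by
  refine mul_nonneg (inv_nonneg.2 (Real.Gamma_pos_of_pos (half_pos hs)).le)
    (setIntegral_nonneg measurableSet_Ioi fun t ht ↦ ?_)
  exact mul_nonneg (besselWeight_nonneg ht) (heatKernel_nonneg ht x)

theorem enorm_besselKernel_le (hs : 0 < s) (x : Rd d) :
    ‖besselKernel d s x‖ₑ ≤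
      ENNReal.ofReal (Real.Gamma (s / 2))⁻¹ * besselPart d s (Set.Ioi 0) x := by
  have hΓ := Real.Gamma_pos_of_pos (half_pos hs)
  rw [besselKernel, enorm_mul, Real.enorm_eq_ofReal (inv_nonneg.2 hΓ.le)]
  refine mul_le_mul_right ((enorm_integral_le_lintegral_enorm _).trans (le_of_eq ?_)) _
  refine setLIntegral_congr_fun measurableSet_Ioi fun t ht ↦ ?_
  simp only [enorm_mul]
  rw [Real.enorm_eq_ofReal (besselWeight_nonneg ht), Real.enorm_eq_ofReal (heatKernel_nonneg ht x)]

theorem besselPart_union {S T : Set ℝ} (hT : MeasurableSet T) (h : Disjoint S T) (x : Rd d) :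
    besselPart d s (S ∪ T) x = besselPart d s S x + besselPart d s T x :=
  lintegral_union hT h

/-- Minkowski takes the `L^p` norm inside the time integral, where only the heat kernel depends on
`x`. -/
theorem lintegral_besselPart_rpow_le {S : Set ℝ} (hS : MeasurableSet S) (hS0 : S ⊆ Set.Ioi 0)
    {p : ℝ} (hp : 1 ≤ p) :
    ∫⁻ x, besselPart d s S x ^ p ≤
      (∫⁻ t in S, ENNReal.ofReal (besselWeight s t *
        (4 * Real.pi * t) ^ (-((d : ℝ) / 2 * (1 - 1 / p))))) ^ p := by
  have hp0 : 0 < p := by linarith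
  refine (lintegral_minkowski hp (F := fun (x : Rd d) t ↦
    ENNReal.ofReal (besselWeight s t) * ENNReal.ofReal (heatKernel d t x)) ?_).trans ?_
  · exact ((measurable_besselWeight.comp measurable_snd).ennreal_ofReal).mul
      (measurable_heatKernel.comp measurable_swap).ennreal_ofReal
  · refine ENNReal.rpow_le_rpow (setLIntegral_mono' hS fun t ht ↦ ?_) hp0.le
    have ht0 : 0 < t := hS0 ht
    simp_rw [ENNReal.mul_rpow_of_nonneg _ _ hp0.le]
    rw [lintegral_const_mul' _ _ (ENNReal.rpow_ne_top_of_nonneg hp0.le ENNReal.ofReal_ne_top),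
      ENNReal.mul_rpow_of_nonneg _ _ (by positivity), ← ENNReal.rpow_mul,
      mul_one_div_cancel hp0.ne', ENNReal.rpow_one, ENNReal.ofReal_mul (besselWeight_nonneg ht0)]
    exact mul_le_mul_right (lintegral_heatKernel_rpow_one_div_le ht0 hp) _

/-- After Minkowski the time integral is a Gamma integral with exponent `s/2 - (d/2)(1 - 1/p)`, and
the hypothesis says that this exponent is positive. -/
theorem lintegral_besselKernel_rpow_lt_top (hs : 0 < s) {p : ℝ} (hp : 1 ≤ p)
    (hsp : (d : ℝ) * (1 - 1 / p) < s) : ∫⁻ x, ‖besselKernel d s x‖ₑ ^ p < ∞ := by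
  have hp0 : 0 < p := by linarith
  have hpi := Real.pi_pos
  set θ : ℝ := (d : ℝ) / 2 * (1 - 1 / p) with hθ
  have hfin : ∫⁻ t in Set.Ioi (0 : ℝ), ENNReal.ofReal (besselWeight s t *
      (4 * Real.pi * t) ^ (-θ)) < ∞ := by
    have hint : IntegrableOn (fun t : ℝ ↦ (4 * Real.pi) ^ (-θ) * (Real.exp (-t) *
        t ^ ((s / 2 - θ) - 1))) (Set.Ioi 0) :=
      (Real.GammaIntegral_convergent (by rw [hθ]; linarith)).const_mul _
    refine lt_of_eq_of_lt (setLIntegral_congr_fun measurableSet_Ioi fun t ht ↦ ?_)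
      hint.lintegral_lt_top
    have ht : 0 < t := ht
    simp only [besselWeight]
    rw [Real.mul_rpow (by positivity) ht.le, show s / 2 - θ - 1 = (s / 2 - 1) + -θ by ring,
      Real.rpow_add ht]
    ring_nf
  calc ∫⁻ x, ‖besselKernel d s x‖ₑ ^ p
      ≤ ∫⁻ x, (ENNReal.ofReal (Real.Gamma (s / 2))⁻¹) ^ p * besselPart d s (Set.Ioi 0) x ^ p := by
        refine lintegral_mono fun x ↦ ?_
        rw [← ENNReal.mul_rpow_of_nonneg _ _ hp0.le]
        exact ENNReal.rpow_le_rpow (enorm_besselKernel_le hs x) hp0.le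
    _ = (ENNReal.ofReal (Real.Gamma (s / 2))⁻¹) ^ p * ∫⁻ x, besselPart d s (Set.Ioi 0) x ^ p :=
        lintegral_const_mul' _ _ (ENNReal.rpow_ne_top_of_nonneg hp0.le ENNReal.ofReal_ne_top)
    _ < ∞ := ENNReal.mul_lt_top (ENNReal.rpow_lt_top_of_nonneg hp0.le ENNReal.ofReal_ne_top)
        ((lintegral_besselPart_rpow_le measurableSet_Ioi subset_rfl hp).trans_lt
          (ENNReal.rpow_lt_top_of_nonneg hp0.le hfin.ne))

theorem lintegral_besselKernel_lt_top (hs : 0 < s) : ∫⁻ x, ‖besselKernel d s x‖ₑ < ∞ := by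
  simpa using lintegral_besselKernel_rpow_lt_top (d := d) hs le_rfl (by simpa using hs)

theorem integrable_besselKernel (hs : 0 < s) : Integrable (besselKernel d s) :=
  ⟨measurable_besselKernel.aestronglyMeasurable, lintegral_besselKernel_lt_top hs⟩

theorem lintegral_besselKernel_le_one (hs : 0 < s) : ∫⁻ x, ‖besselKernel d s x‖ₑ ≤ 1 := by
  have hΓ := Real.Gamma_pos_of_pos (half_pos hs)
  have h1 := lintegral_besselPart_rpow_le (d := d) (s := s) measurableSet_Ioi
    (subset_refl (Set.Ioi (0 : ℝ))) le_rfl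
  simp only [ENNReal.rpow_one, div_one, sub_self, mul_zero, neg_zero, Real.rpow_zero,
    mul_one] at h1
  have h2 : ∫⁻ t in Set.Ioi (0 : ℝ), ENNReal.ofReal (besselWeight s t) =
      ENNReal.ofReal (Real.Gamma (s / 2)) := by
    rw [← ofReal_integral_eq_lintegral_ofReal (integrableOn_besselWeight hs)
      ((ae_restrict_mem measurableSet_Ioi).mono fun t ht ↦ besselWeight_nonneg ht),
      Real.Gamma_eq_integral (half_pos hs)]
    simp only [besselWeight, mul_comm]
  rw [h2] at h1
  refine (lintegral_mono (enorm_besselKernel_le hs)).trans ?_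
  rw [lintegral_const_mul' _ _ ENNReal.ofReal_ne_top]
  refine (mul_le_mul_right h1 _).trans (le_of_eq ?_)
  rw [← ENNReal.ofReal_mul (by positivity), inv_mul_cancel₀ hΓ.ne', ENNReal.ofReal_one]

theorem exists_rpow_mul_exp_neg_le (δ : ℝ) (hδ : 0 ≤ δ) :
    ∃ C : ℝ, 0 < C ∧ ∀ t : ℝ, 0 < t → t ^ δ * Real.exp (-t) ≤ C := by
  obtain ⟨n, hn⟩ := exists_nat_ge δ
  refine ⟨n.factorial, by positivity, fun t ht ↦ ?_⟩
  rw [Real.exp_neg, ← div_eq_mul_inv, div_le_iff₀ (Real.exp_pos t)]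
  rcases le_total t 1 with h | h
  · calc t ^ δ ≤ 1 := Real.rpow_le_one ht.le h hδ
      _ ≤ n.factorial * 1 := by
        rw [mul_one]; exact_mod_cast n.factorial_pos
      _ ≤ n.factorial * Real.exp t := by
        gcongr; exact Real.one_le_exp ht.le
  · calc t ^ δ ≤ t ^ (n : ℝ) := Real.rpow_le_rpow_of_exponent_le h hn
      _ = t ^ n := Real.rpow_natCast t n
      _ ≤ n.factorial * Real.exp t := by
        have := Real.pow_div_factorial_le_exp t ht.le n
        rwa [div_le_iff₀' (by positivity)] at this

/-- Away from the origin the integral that defines the Bessel kernel converges. -/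
theorem integrableOn_besselIntegrand (hs : 0 < s) {x : Rd d} (hx : x ≠ 0) :
    IntegrableOn (fun t ↦ besselWeight s t * heatKernel d t x) (Set.Ioi 0) := by
  have hpi := Real.pi_pos
  have hr : 0 < ‖x‖ := norm_pos_iff.2 hx
  obtain ⟨C, hC, hCle⟩ := exists_rpow_mul_exp_neg_le ((d : ℝ) / 2) (by positivity)
  refine Integrable.mono' ((integrableOn_besselWeight hs).mul_const
    ((Real.pi * ‖x‖ ^ 2) ^ (-((d : ℝ) / 2)) * C)) ?_ ?_
  · exact (measurable_besselIntegrand.comp measurable_prodMk_right).aestronglyMeasurable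
  · refine (ae_restrict_mem measurableSet_Ioi).mono fun t ht ↦ ?_
    have ht : 0 < t := ht
    rw [norm_mul, Real.norm_of_nonneg (besselWeight_nonneg ht),
      Real.norm_of_nonneg (heatKernel_nonneg ht x)]
    refine mul_le_mul_of_nonneg_left ?_ (besselWeight_nonneg ht)
    have hv : 0 < (4 * t)⁻¹ * ‖x‖ ^ 2 := by positivity
    -- In the variable `v = |x|²/(4t)` the heat kernel is `(π|x|²)^{-d/2} v^{d/2} e^{-v}`, which is
    -- bounded in `t` for fixed `x ≠ 0`.
    have h1 : 4 * Real.pi * t = (Real.pi * ‖x‖ ^ 2) * ((4 * t)⁻¹ * ‖x‖ ^ 2)⁻¹ := by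
      field_simp
    rw [heatKernel, h1, Real.mul_rpow (by positivity) (by positivity), mul_assoc]
    refine mul_le_mul_of_nonneg_left ?_ (by positivity)
    rw [Real.inv_rpow hv.le, Real.rpow_neg hv.le, inv_inv]
    exact hCle _ hv

/-- Lower bound for the Bessel kernel near the origin. -/
theorem le_besselKernel (hs : 0 < s) (hsd : s ≤ d) {x : Rd d} (hx : x ≠ 0) (hx1 : ‖x‖ ≤ 1) :
    (Real.Gamma (s / 2))⁻¹ * ((4 * Real.pi) ^ (-((d : ℝ) / 2)) * Real.exp (-2) *
      Real.exp (-(1 / 4)) * 2 ^ ((s - d) / 2 - 1)) * ‖x‖ ^ (s - d) ≤ besselKernel d s x := by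
  have hpi := Real.pi_pos
  have hr : 0 < ‖x‖ := norm_pos_iff.2 hx
  have hΓ := Real.Gamma_pos_of_pos (half_pos hs)
  rw [besselKernel, mul_assoc]
  refine mul_le_mul_of_nonneg_left ?_ (by positivity)
  -- Times comparable to `|x|²` suffice: both exponentials are bounded below there, the remaining
  -- factor `t^{(s-d)/2-1}` is smallest at the right end, and the interval has length `|x|²`.
  have hsub : Set.Ioc (‖x‖ ^ 2) (2 * ‖x‖ ^ 2) ⊆ Set.Ioi 0 := fun t ht ↦ (sq_pos_of_pos hr).trans ht.1
  refine le_trans ?_ (setIntegral_mono_set (integrableOn_besselIntegrand hs hx)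
    ((ae_restrict_mem measurableSet_Ioi).mono fun t ht ↦
      mul_nonneg (besselWeight_nonneg ht) (heatKernel_nonneg ht x)) hsub.eventuallyLE)
  set c : ℝ := (4 * Real.pi) ^ (-((d : ℝ) / 2)) * Real.exp (-2) *
      Real.exp (-(1 / 4)) * (2 * ‖x‖ ^ 2) ^ ((s - d) / 2 - 1) with hc
  have hpt : ∀ t ∈ Set.Ioc (‖x‖ ^ 2) (2 * ‖x‖ ^ 2), c ≤ besselWeight s t * heatKernel d t x := by
    intro t ht
    have ht0 : 0 < t := hsub ht
    have e1 : Real.exp (-2) ≤ Real.exp (-t) := by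
      refine Real.exp_le_exp.2 (neg_le_neg (ht.2.trans ?_))
      nlinarith
    have e2 : Real.exp (-(1 / 4)) ≤ Real.exp (-((4 * t)⁻¹ * ‖x‖ ^ 2)) := by
      refine Real.exp_le_exp.2 (neg_le_neg ?_)
      rw [inv_mul_le_iff₀ (by positivity)]
      linarith [ht.1]
    have e3 : (2 * ‖x‖ ^ 2) ^ ((s - d) / 2 - 1) ≤ t ^ ((s - d) / 2 - 1) :=
      Real.rpow_le_rpow_of_nonpos ht0 ht.2 (by linarith)
    have e4 : besselWeight s t * heatKernel d t x = (4 * Real.pi) ^ (-((d : ℝ) / 2)) *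
        Real.exp (-t) * Real.exp (-((4 * t)⁻¹ * ‖x‖ ^ 2)) * t ^ ((s - d) / 2 - 1) := by
      rw [besselWeight, heatKernel, Real.mul_rpow (by positivity) ht0.le,
        show (s - d) / 2 - 1 = (s / 2 - 1) + -((d : ℝ) / 2) by ring, Real.rpow_add ht0]
      ring
    rw [e4, hc]
    gcongr
  have hvol : volume.real (Set.Ioc (‖x‖ ^ 2) (2 * ‖x‖ ^ 2)) = ‖x‖ ^ 2 := by
    rw [Real.volume_real_Ioc_of_le (by nlinarith)]; ring
  have hconst : ∫ _ in Set.Ioc (‖x‖ ^ 2) (2 * ‖x‖ ^ 2), c = ‖x‖ ^ 2 * c := by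
    rw [setIntegral_const, hvol, smul_eq_mul]
  refine le_trans (le_of_eq ?_) (hconst.symm.le.trans (setIntegral_mono_on ?_
    ((integrableOn_besselIntegrand hs hx).mono_set hsub) measurableSet_Ioc hpt))
  · rw [hc, Real.mul_rpow (x := 2) (y := ‖x‖ ^ 2) (by norm_num) (by positivity), ← Real.rpow_natCast, ← Real.rpow_mul hr.le]
    have : ‖x‖ ^ (s - d) = ‖x‖ ^ ((2 : ℕ) : ℝ) * ‖x‖ ^ (((2 : ℕ) : ℝ) * ((s - d) / 2 - 1)) := by
      rw [← Real.rpow_add hr]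
      push_cast
      ring_nf
    rw [this]
    ring
  · exact integrableOn_const (by simp)

end BesselKernel

/-! ### Fourier transform of the Bessel kernel, and convolution with its square. -/

section BesselKernel

variable {d : ℕ} {s : ℝ}

theorem lintegral_besselIntegrand_lt_top (hs : 0 < s) :
    ∫⁻ z : ℝ × Rd d, ‖besselWeight s z.1 * heatKernel d z.1 z.2‖ₑ
      ∂((volume.restrict (Set.Ioi (0 : ℝ))).prod volume) < ∞ := by
  rw [lintegral_prod _ (measurable_besselIntegrand.enorm).aemeasurable]
  refine lt_of_le_of_lt ?_ (integrableOn_besselWeight hs).2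
  refine setLIntegral_mono' measurableSet_Ioi fun t ht ↦ ?_
  have ht : 0 < t := ht
  simp_rw [enorm_mul]
  rw [lintegral_const_mul' _ _ enorm_ne_top]
  refine mul_le_of_le_one_right zero_le ((le_of_eq ?_).trans (lintegral_heatKernel_le (d := d) ht))
  exact lintegral_congr fun x ↦ Real.enorm_eq_ofReal (heatKernel_nonneg ht x)

open FourierTransform in
/-- The Fourier transform of the Bessel kernel. -/
theorem fourier_besselKernel (hs : 0 < s) (ξ : Rd d) :
    𝓕 (fun x : Rd d ↦ (besselKernel d s x : ℂ)) ξ =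
      (((1 + 4 * Real.pi ^ 2 * ‖ξ‖ ^ 2) ^ (-s / 2) : ℝ) : ℂ) := by
  have hΓ := Real.Gamma_pos_of_pos (half_pos hs)
  have h1 : ∀ x : Rd d, (besselKernel d s x : ℂ) = ((Real.Gamma (s / 2))⁻¹ : ℝ) *
      ∫ t in Set.Ioi (0 : ℝ), ((besselWeight s t * heatKernel d t x : ℝ) : ℂ) := fun x ↦ by
    rw [integral_complex_ofReal, ← Complex.ofReal_mul]
    rfl
  have hint : Integrable (Function.uncurry fun (x : Rd d) (t : ℝ) ↦
      Complex.exp (↑(-2 * Real.pi * inner ℝ x ξ) * Complex.I) •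
        ((besselWeight s t * heatKernel d t x : ℝ) : ℂ))
      (volume.prod (volume.restrict (Set.Ioi (0 : ℝ)))) := by
    rw [← integrable_swap_iff]
    refine Integrable.mono' (g := fun z ↦ ‖besselWeight s z.1 * heatKernel d z.1 z.2‖)
      ⟨measurable_besselIntegrand.norm.aestronglyMeasurable, ?_⟩ ?_ ?_
    · simpa [HasFiniteIntegral] using lintegral_besselIntegrand_lt_top (d := d) hs
    · have h2 : Measurable fun z : ℝ × Rd d ↦
          Complex.exp (↑(-2 * Real.pi * inner ℝ z.2 ξ) * Complex.I) := by fun_prop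
      exact (h2.smul
        (Complex.measurable_ofReal.comp measurable_besselIntegrand)).aestronglyMeasurable
    · refine Eventually.of_forall fun z ↦ ?_
      simp only [Function.comp, Prod.swap, Function.uncurry, norm_smul, Complex.norm_exp_ofReal_mul_I,
        one_mul, Complex.norm_real, le_refl]
  rw [Real.fourier_eq']
  simp_rw [h1]
  calc ∫ x : Rd d, Complex.exp (↑(-2 * Real.pi * inner ℝ x ξ) * Complex.I) •
        ((((Real.Gamma (s / 2))⁻¹ : ℝ) : ℂ) *
          ∫ t in Set.Ioi (0 : ℝ), ((besselWeight s t * heatKernel d t x : ℝ) : ℂ))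
      = (((Real.Gamma (s / 2))⁻¹ : ℝ) : ℂ) * ∫ x : Rd d, ∫ t in Set.Ioi (0 : ℝ),
          Complex.exp (↑(-2 * Real.pi * inner ℝ x ξ) * Complex.I) •
            ((besselWeight s t * heatKernel d t x : ℝ) : ℂ) := by
        rw [← integral_const_mul]
        congr 1 with x
        rw [integral_smul]
        simp only [smul_eq_mul]
        ring
    _ = (((Real.Gamma (s / 2))⁻¹ : ℝ) : ℂ) * ∫ t in Set.Ioi (0 : ℝ),
          ((besselWeight s t * Real.exp (-(4 * Real.pi ^ 2 * t * ‖ξ‖ ^ 2)) : ℝ) : ℂ) := by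
        rw [integral_integral_swap hint]
        congr 1
        refine setIntegral_congr_fun measurableSet_Ioi fun t ht ↦ ?_
        have := fourier_heatKernel (d := d) (t := t) ht ξ
        rw [Real.fourier_eq'] at this
        rw [Complex.ofReal_mul, ← this, ← integral_const_mul]
        congr 1 with x
        simp only [smul_eq_mul]
        push_cast
        ring
    _ = _ := by
        rw [integral_complex_ofReal, ← Complex.ofReal_mul]
        congr 1
        have hr : 0 < 1 + 4 * Real.pi ^ 2 * ‖ξ‖ ^ 2 := by positivity
        -- The two exponentials combine to `exp (-(1 + 4π²|ξ|²) t)`, so a rescaled Gamma integral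
        -- remains.
        have h2 : ∀ t, besselWeight s t * Real.exp (-(4 * Real.pi ^ 2 * t * ‖ξ‖ ^ 2)) =
            t ^ (s / 2 - 1) * Real.exp (-((1 + 4 * Real.pi ^ 2 * ‖ξ‖ ^ 2) * t)) := fun t ↦ by
          rw [besselWeight, mul_assoc, ← Real.exp_add]
          ring_nf
        simp_rw [h2]
        rw [Real.integral_rpow_mul_exp_neg_mul_Ioi (half_pos hs) hr, one_div, mul_left_comm,
          inv_mul_cancel₀ hΓ.ne', mul_one, Real.inv_rpow hr.le, ← Real.rpow_neg hr.le, neg_div]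

theorem lintegral_Ioc_const_mul_rpow {a T c : ℝ} (ha : 0 < a) (hT : 0 < T) (hc : 0 ≤ c) :
    ∫⁻ t in Set.Ioc 0 T, ENNReal.ofReal (c * t ^ (a - 1)) = ENNReal.ofReal (c * a⁻¹ * T ^ a) := by
  have hint : IntervalIntegrable (fun t : ℝ ↦ t ^ (a - 1)) volume 0 T :=
    intervalIntegral.intervalIntegrable_rpow' (by linarith)
  rw [← ofReal_integral_eq_lintegral_ofReal
    (((intervalIntegrable_iff_integrableOn_Ioc_of_le hT.le).1 hint).const_mul c)
    ((ae_restrict_mem measurableSet_Ioc).mono fun t ht ↦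
      mul_nonneg hc (Real.rpow_nonneg ht.1.le _)),
    integral_const_mul, ← intervalIntegral.integral_of_le hT.le,
    integral_rpow (Or.inl (by linarith)), sub_add_cancel, Real.zero_rpow ha.ne']
  congr 1
  ring

theorem lintegral_Ioi_const_mul_rpow {a T c : ℝ} (ha : a < 0) (hT : 0 < T) (hc : 0 ≤ c) :
    ∫⁻ t in Set.Ioi T, ENNReal.ofReal (c * t ^ (a - 1)) =
      ENNReal.ofReal (c * (-a)⁻¹ * T ^ a) := by
  rw [← ofReal_integral_eq_lintegral_ofReal
    ((integrableOn_Ioi_rpow_of_lt (by linarith) hT).const_mul c)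
    ((ae_restrict_mem measurableSet_Ioi).mono fun t ht ↦
      mul_nonneg hc (Real.rpow_nonneg (hT.le.trans (le_of_lt ht)) _)),
    integral_const_mul, integral_Ioi_rpow_of_lt (by linarith) hT, sub_add_cancel]
  congr 1
  rw [inv_neg]
  ring

/-- The exponential decay pays for lowering the order from `s` to `s₀`. The result is a pure power
of `t`, as the scaling argument of case (a) requires. -/
theorem exists_besselWeight_mul_le {s₀ : ℝ} (h : s₀ ≤ s) : ∃ C : ℝ, 0 < C ∧ ∀ t : ℝ, 0 < t →
    besselWeight s t ≤ C * t ^ (s₀ / 2 - 1) := by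
  obtain ⟨C, hC, hle⟩ := exists_rpow_mul_exp_neg_le ((s - s₀) / 2) (by linarith)
  refine ⟨C, hC, fun t ht ↦ ?_⟩
  have : besselWeight s t = t ^ ((s - s₀) / 2) * Real.exp (-t) * t ^ (s₀ / 2 - 1) := by
    rw [besselWeight, show s / 2 - 1 = (s - s₀) / 2 + (s₀ / 2 - 1) by ring, Real.rpow_add ht]
    ring
  rw [this]
  exact mul_le_mul_of_nonneg_right (hle t ht) (by positivity)

theorem besselPart_rpow_le_of_le {s₀ : ℝ} (h : s₀ ≤ s) {p : ℝ} (hp : 1 ≤ p) :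
    ∃ C : ℝ, 0 < C ∧ ∀ S : Set ℝ, MeasurableSet S → S ⊆ Set.Ioi 0 →
      ∫⁻ x, besselPart d s S x ^ p ≤ (∫⁻ t in S, ENNReal.ofReal
        (C * t ^ ((s₀ / 2 - (d : ℝ) / 2 * (1 - 1 / p)) - 1))) ^ p := by
  have hpi := Real.pi_pos
  obtain ⟨C, hC, hle⟩ := exists_besselWeight_mul_le h
  refine ⟨C * (4 * Real.pi) ^ (-((d : ℝ) / 2 * (1 - 1 / p))), by positivity, fun S hS hS0 ↦ ?_⟩
  refine (lintegral_besselPart_rpow_le hS hS0 hp).trans ?_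
  refine ENNReal.rpow_le_rpow (setLIntegral_mono' hS fun t ht ↦ ENNReal.ofReal_le_ofReal ?_)
    (by linarith)
  have ht : 0 < t := hS0 ht
  refine (mul_le_mul_of_nonneg_right (hle t ht) (by positivity)).trans (le_of_eq ?_)
  rw [Real.mul_rpow (by positivity) ht.le,
    show s₀ / 2 - (d : ℝ) / 2 * (1 - 1 / p) - 1 = (s₀ / 2 - 1) + -((d : ℝ) / 2 * (1 - 1 / p)) by
      ring, Real.rpow_add ht]
  ring

/-- The square of the Bessel kernel satisfies the decomposition hypothesis of the
Hardy–Littlewood–Sobolev inequality. -/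
theorem exists_besselKernel_sq_decomposition (hs : 0 < s) (hd : 0 < d) {η q Q : ℝ}
    (hη : 2 < η) (hηq : η < q) (hQ : (η / 2).HolderConjugate Q)
    (h : (d : ℝ) * (1 / η + 1 / 2 - 1 / q) ≤ s) :
    ∃ A : ℝ, 0 < A ∧ ∀ t : ℝ, 0 < t → ∃ k₁ k₂ : Rd d → ℝ≥0∞, Measurable k₁ ∧ Measurable k₂ ∧
      (∀ x, ‖besselKernel d s x‖ₑ ^ (2 : ℝ) ≤ k₁ x + k₂ x) ∧
      ∫⁻ x, k₁ x ≤ ENNReal.ofReal (A * t ^ (1 - (q / 2) / (η / 2))) ∧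
      (∫⁻ x, k₂ x ^ Q) ^ (1 / Q) ≤ ENNReal.ofReal (t / 4) := by
  have hd' : (0 : ℝ) < d := by exact_mod_cast hd
  have hη0 : 0 < η := by linarith
  have hq0 : 0 < q := by linarith
  have hQ1 : 1 < Q := hQ.symm.lt
  have hΓ := Real.Gamma_pos_of_pos (half_pos hs)
  set Γ := Real.Gamma (s / 2)
  -- The critical order, for which the scaling condition is an equality. Small times are measured in
  -- `L²` and large times in `L^{2Q}`, so that their squares lie in `L¹` and `L^Q`; the time
  -- integrals then have exponents `a > 0` and `b < 0`.
  set s₀ : ℝ := (d : ℝ) * (1 / η + 1 / 2 - 1 / q) with hs₀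
  obtain ⟨C₁, hC₁, h₁⟩ := besselPart_rpow_le_of_le (d := d) h (p := 2) one_le_two
  obtain ⟨C₂, hC₂, h₂⟩ := besselPart_rpow_le_of_le (d := d) h (p := 2 * Q) (by linarith)
  set a : ℝ := (d : ℝ) / 2 * (1 / η - 1 / q) with ha
  set b : ℝ := -((d : ℝ) / 2 * (1 / q)) with hb
  have ha0 : 0 < a := by
    have := one_div_lt_one_div_of_lt hη0 hηq
    have : 0 < 1 / η - 1 / q := by linarith
    positivity
  have hb0 : b < 0 := by
    rw [hb]
    have : 0 < (d : ℝ) / 2 * (1 / q) := by positivity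
    linarith
  have hQinv : 1 / (2 * Q) = 1 / 2 - 1 / η := by
    have := hQ.inv_add_inv_eq_one
    have h2 : Q⁻¹ = 1 - (η / 2)⁻¹ := by linarith
    rw [one_div, mul_inv, h2]
    field_simp
  have haeq : s₀ / 2 - (d : ℝ) / 2 * (1 - 1 / 2) = a := by rw [hs₀, ha]; ring
  have hbeq : s₀ / 2 - (d : ℝ) / 2 * (1 - 1 / (2 * Q)) = b := by rw [hs₀, hb, hQinv]; ring
  rw [haeq] at h₁
  rw [hbeq] at h₂
  set B : ℝ := 4 * (2 * (Γ⁻¹) ^ 2 * (C₂ * (-b)⁻¹) ^ 2) with hB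
  have hB0 : 0 < B := by
    have : 0 < -b := by linarith
    positivity
  set D : ℝ := 2 * (Γ⁻¹) ^ 2 * (C₁ * a⁻¹) ^ 2 with hD
  have hD0 : 0 < D := by positivity
  refine ⟨D * (B ^ (-(2 * b)⁻¹)) ^ (2 * a), by positivity, fun t ht ↦ ?_⟩
  -- The cut time solves `T^{2b} = t/B`, which makes the large-time part exactly `t/4`. The
  -- small-time part then has size `T^{2a}`, a multiple of `t^{a/b}`, and `a/b = 1 - q/η` is the
  -- required exponent.
  set T : ℝ := (t / B) ^ ((2 * b)⁻¹) with hT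
  have hT0 : 0 < T := by positivity
  set c : ℝ≥0∞ := ENNReal.ofReal (2 * (Γ⁻¹) ^ 2) with hc
  refine ⟨fun x ↦ c * besselPart d s (Set.Ioc 0 T) x ^ (2 : ℝ),
    fun x ↦ c * besselPart d s (Set.Ioi T) x ^ (2 : ℝ),
    ((measurable_besselPart _).pow_const _).const_mul _,
    ((measurable_besselPart _).pow_const _).const_mul _, fun x ↦ ?_, ?_, ?_⟩
  · have hu : besselPart d s (Set.Ioi 0) x =
        besselPart d s (Set.Ioc 0 T) x + besselPart d s (Set.Ioi T) x := by
      rw [← Set.Ioc_union_Ioi_eq_Ioi hT0.le, besselPart_union measurableSet_Ioi]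
      exact Set.disjoint_left.2 fun y hy hy' ↦ (not_lt.2 hy.2) hy'
    refine (ENNReal.rpow_le_rpow (enorm_besselKernel_le hs x) zero_le_two).trans ?_
    rw [ENNReal.mul_rpow_of_nonneg _ _ zero_le_two, ENNReal.ofReal_rpow_of_nonneg (by positivity)
      zero_le_two, hu, hc, ← mul_add, Real.rpow_two, mul_comm (2 : ℝ),
      ENNReal.ofReal_mul (by positivity), mul_assoc]
    refine mul_le_mul_right ?_ _
    have := ENNReal.rpow_add_le_mul_rpow_add_rpow (besselPart d s (Set.Ioc 0 T) x)
      (besselPart d s (Set.Ioi T) x) (p := 2) one_le_two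
    refine this.trans (le_of_eq ?_)
    norm_num
  · rw [lintegral_const_mul' _ _ ENNReal.ofReal_ne_top]
    refine (mul_le_mul_right (h₁ _ measurableSet_Ioc fun y hy ↦ hy.1) _).trans ?_
    rw [lintegral_Ioc_const_mul_rpow ha0 hT0 hC₁.le, ENNReal.ofReal_rpow_of_nonneg (by positivity)
      zero_le_two, ← ENNReal.ofReal_mul (by positivity)]
    refine ENNReal.ofReal_le_ofReal (le_of_eq ?_)
    have e : T ^ a * T ^ a = (B ^ (-(2 * b)⁻¹)) ^ (2 * a) * t ^ (1 - (q / 2) / (η / 2)) := by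
      rw [← Real.rpow_add hT0, hT, ← Real.rpow_mul (by positivity), ← Real.rpow_mul hB0.le,
        div_eq_mul_inv, Real.mul_rpow ht.le (by positivity), Real.inv_rpow hB0.le,
        ← Real.rpow_neg hB0.le, mul_comm]
      congr 2
      · ring
      · rw [ha, hb]
        field_simp
        ring
    rw [Real.rpow_two, hD]
    calc 2 * Γ⁻¹ ^ 2 * (C₁ * a⁻¹ * T ^ a) ^ 2
        = 2 * Γ⁻¹ ^ 2 * (C₁ * a⁻¹) ^ 2 * (T ^ a * T ^ a) := by ring
      _ = _ := by rw [e]; ring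
  · have hQ0 : 0 < Q := by linarith
    simp_rw [ENNReal.mul_rpow_of_nonneg _ _ hQ0.le, ← ENNReal.rpow_mul]
    rw [lintegral_const_mul' _ _ (ENNReal.rpow_ne_top_of_nonneg hQ0.le ENNReal.ofReal_ne_top),
      ENNReal.mul_rpow_of_nonneg _ _ (by positivity), ← ENNReal.rpow_mul,
      mul_one_div_cancel hQ0.ne', ENNReal.rpow_one]
    refine (mul_le_mul_right (ENNReal.rpow_le_rpow (h₂ _ measurableSet_Ioi
      fun y hy ↦ hT0.trans hy) (by positivity)) _).trans ?_
    rw [lintegral_Ioi_const_mul_rpow hb0 hT0 hC₂.le, ← ENNReal.rpow_mul,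
      show 2 * Q * (1 / Q) = 2 by field_simp,
      ENNReal.ofReal_rpow_of_nonneg (by have : 0 < -b := by linarith
                                        positivity) zero_le_two,
      ← ENNReal.ofReal_mul (by positivity)]
    refine ENNReal.ofReal_le_ofReal (le_of_eq ?_)
    have e : T ^ b * T ^ b = t / B := by
      rw [← Real.rpow_add hT0, hT, ← Real.rpow_mul (by positivity), ← two_mul,
        inv_mul_cancel₀ (by linarith), Real.rpow_one]
    rw [Real.rpow_two]
    calc 2 * Γ⁻¹ ^ 2 * (C₂ * (-b)⁻¹ * T ^ b) ^ 2
        = (2 * Γ⁻¹ ^ 2 * (C₂ * (-b)⁻¹) ^ 2) * (T ^ b * T ^ b) := by ring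
      _ = B / 4 * (t / B) := by rw [e, hB]; ring
      _ = t / 4 := by field_simp

/-- Convolution with the square of the Bessel kernel maps `L^{η/2}` to `L^{q/2}`. -/
theorem exists_lintegral_besselKernel_sq_conv_le (hd : 1 ≤ d) {q η : ℝ}
    (h : (d / 2 < s ∧ s < d ∧ 2 < η ∧ η < q ∧ 1 / η + 1 / 2 ≤ s / d + 1 / q) ∨
      (d / 2 < s ∧ η = q ∧ 2 ≤ q) ∨ (d / 2 < s ∧ η = 2 ∧ 2 ≤ q ∧ 1 < s / d + 1 / q)) :
    ∃ C : ℝ≥0, ∀ f : Rd d → ℝ≥0∞, Measurable f → ∫⁻ x, f x ^ (η / 2) ≠ ∞ →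
      ∫⁻ x, (∫⁻ y, ‖besselKernel d s (x - y)‖ₑ ^ (2 : ℝ) * f y) ^ (q / 2) ≤
        C * (∫⁻ x, f x ^ (η / 2)) ^ (q / η) := by
  have hd' : (0 : ℝ) < d := by exact_mod_cast hd
  have hKm : Measurable fun x : Rd d ↦ ‖besselKernel d s x‖ₑ ^ (2 : ℝ) :=
    measurable_besselKernel.enorm.pow_const _
  -- In order: Hardy–Littlewood–Sobolev; Young with the squared kernel in `L¹`; Young with the
  -- squared kernel in `L^{q/2}`.
  rcases h with ⟨h1, -, hη, hηq, h2⟩ | ⟨h1, rfl, hq⟩ | ⟨h1, rfl, hq, h2⟩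
  · have hs : 0 < s := lt_trans (by positivity) h1
    have hQ := Real.HolderConjugate.conjExponent (p := η / 2) (by linarith)
    have hle : (d : ℝ) * (1 / η + 1 / 2 - 1 / q) ≤ s := by
      rw [mul_comm, ← le_div_iff₀ hd']; linarith
    obtain ⟨A, hA, hdec⟩ := exists_besselKernel_sq_decomposition hs hd hη hηq hQ hle
    obtain ⟨C, hC⟩ := exists_lintegral_conv_rpow_le_of_decomposition hQ
      (show η / 2 < q / 2 by linarith) hA hKm hdec
    refine ⟨C, fun f hf hfin ↦ (hC f hf hfin).trans (le_of_eq ?_)⟩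
    congr 2
    field_simp
  · have hs : 0 < s := lt_trans (by positivity) h1
    have hfin := lintegral_besselKernel_rpow_lt_top (d := d) hs (p := 2) one_le_two
      (by linarith)
    refine ⟨((∫⁻ x : Rd d, ‖besselKernel d s x‖ₑ ^ (2 : ℝ)) ^ (η / 2)).toNNReal,
      fun f hf _ ↦ ?_⟩
    rw [ENNReal.coe_toNNReal (ENNReal.rpow_ne_top_of_nonneg (by linarith) hfin.ne),
      div_self (by linarith), ENNReal.rpow_one]
    exact lintegral_conv_rpow_le' (by linarith) hKm hf
  · have hs : 0 < s := lt_trans (by positivity) h1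
    have hfin := lintegral_besselKernel_rpow_lt_top (d := d) hs (p := q) (by linarith)
      (by rw [mul_comm, ← lt_div_iff₀ hd']; linarith)
    refine ⟨(∫⁻ x : Rd d, ‖besselKernel d s x‖ₑ ^ q).toNNReal, fun f hf _ ↦ ?_⟩
    rw [ENNReal.coe_toNNReal hfin.ne]
    have := lintegral_conv_rpow_le (p := q / 2) (by linarith) hKm hf
    simp_rw [← ENNReal.rpow_mul, mul_div_cancel₀ q two_ne_zero] at this
    simpa using this

end BesselKernel

/-! ### Negative Bessel powers as convolution operators on `L^p`. -/

section BesselConv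

variable {d : ℕ} {r p : ℝ}

/-- Convolution with the Bessel kernel. -/
noncomputable def besselConv (d : ℕ) (r : ℝ) (u : Rd d → ℂ) (x : Rd d) : ℂ :=
  ∫ y, (besselKernel d r (x - y) : ℂ) * u y

theorem lintegral_enorm_rpow_eq_eLpNorm_rpow {α E : Type*} [MeasurableSpace α] {μ : Measure α}
    [NormedAddCommGroup E] (hp : 0 < p) (f : α → E) :
    ∫⁻ x, ‖f x‖ₑ ^ p ∂μ = eLpNorm f (ENNReal.ofReal p) μ ^ p := by
  rw [eLpNorm_eq_lintegral_rpow_enorm_toReal (by simpa using hp) ENNReal.ofReal_ne_top,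
    ENNReal.toReal_ofReal hp.le, ← ENNReal.rpow_mul, one_div_mul_cancel hp.ne', ENNReal.rpow_one]

theorem eLpNorm_le_iff_lintegral_rpow_le {α E : Type*} [MeasurableSpace α] {μ : Measure α}
    [NormedAddCommGroup E] (hp : 0 < p) (f : α → E) (C : ℝ≥0∞) :
    eLpNorm f (ENNReal.ofReal p) μ ≤ C ↔ ∫⁻ x, ‖f x‖ₑ ^ p ∂μ ≤ C ^ p := by
  rw [lintegral_enorm_rpow_eq_eLpNorm_rpow hp, ENNReal.rpow_le_rpow_iff hp]

theorem lintegral_besselKernel_conv_rpow_le (hr : 0 < r) (hp : 1 ≤ p) {f : Rd d → ℝ≥0∞}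
    (hf : AEMeasurable f) :
    ∫⁻ x, (∫⁻ y, ‖besselKernel d r (x - y)‖ₑ * f y) ^ p ≤ ∫⁻ x, f x ^ p := by
  have h1 : ∀ x : Rd d, ∫⁻ y, ‖besselKernel d r (x - y)‖ₑ * f y =
      ∫⁻ y, ‖besselKernel d r (x - y)‖ₑ * hf.mk f y := fun x ↦
    lintegral_congr_ae (hf.ae_eq_mk.mono fun y hy ↦ by simp only [hy])
  have h2 : ∫⁻ x, f x ^ p = ∫⁻ x, hf.mk f x ^ p :=
    lintegral_congr_ae (hf.ae_eq_mk.mono fun y hy ↦ by simp only [← hy])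
  simp_rw [h1]
  rw [h2]
  refine (lintegral_conv_rpow_le' hp (k := fun x ↦ ‖besselKernel d r x‖ₑ)
    measurable_besselKernel.enorm hf.measurable_mk).trans ?_
  exact mul_le_of_le_one_left zero_le
    (ENNReal.rpow_le_one (lintegral_besselKernel_le_one hr) (by linarith))

theorem aestronglyMeasurable_besselConv_kernel {u : Rd d → ℂ} (hu : AEStronglyMeasurable u) :
    AEStronglyMeasurable (fun z : Rd d × Rd d ↦ (besselKernel d r (z.1 - z.2) : ℂ) * u z.2)
      (volume.prod volume) :=
  (Complex.measurable_ofReal.comp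
    (measurable_besselKernel.comp measurable_sub)).aestronglyMeasurable.mul hu.comp_snd

theorem aestronglyMeasurable_besselConv {u : Rd d → ℂ} (hu : AEStronglyMeasurable u) :
    AEStronglyMeasurable (besselConv d r u) :=
  (aestronglyMeasurable_besselConv_kernel hu).integral_prod_right'

theorem enorm_besselConv_le (u : Rd d → ℂ) (x : Rd d) :
    ‖besselConv d r u x‖ₑ ≤ ∫⁻ y, ‖besselKernel d r (x - y)‖ₑ * ‖u y‖ₑ := by
  refine (enorm_integral_le_lintegral_enorm _).trans (le_of_eq ?_)
  refine lintegral_congr fun y ↦ ?_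
  rw [enorm_mul]
  congr 1
  rw [← ofReal_norm, Complex.norm_real, ofReal_norm]

theorem eLpNorm_besselConv_le (hr : 0 < r) (hp : 1 ≤ p) {u : Rd d → ℂ}
    (hu : AEStronglyMeasurable u) :
    eLpNorm (besselConv d r u) (ENNReal.ofReal p) ≤ eLpNorm u (ENNReal.ofReal p) := by
  have hp0 : 0 < p := by linarith
  rw [eLpNorm_le_iff_lintegral_rpow_le hp0, ← lintegral_enorm_rpow_eq_eLpNorm_rpow hp0]
  exact (lintegral_mono fun x ↦ ENNReal.rpow_le_rpow (enorm_besselConv_le u x) hp0.le).trans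
    (lintegral_besselKernel_conv_rpow_le hr hp hu.enorm)

theorem MeasureTheory.MemLp.besselConv (hr : 0 < r) (hp : 1 ≤ p) {u : Rd d → ℂ}
    (hu : MemLp u (ENNReal.ofReal p)) : MemLp (besselConv d r u) (ENNReal.ofReal p) :=
  ⟨aestronglyMeasurable_besselConv hu.1, (eLpNorm_besselConv_le hr hp hu.1).trans_lt hu.2⟩

open FourierTransform in
-- The multiplication formula `∫ 𝓕G · h = ∫ G · 𝓕h` with `h` a modulation of `𝓕⁻ φ`. The kernel
-- appears as `y - x` because the multiplier here acts on the test function; transposing gives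
-- ordinary convolution without using that the kernel is even.
theorem besselMultiplier_apply (hr : 0 < r) (φ : 𝓢(Rd d, ℂ)) (x : Rd d) :
    (𝓕 (SchwartzMap.smulLeftCLM ℂ (fun ξ : Rd d ↦
      (((1 + 4 * Real.pi ^ 2 * ‖ξ‖ ^ 2) ^ (-r / 2) : ℝ) : ℂ)) (𝓕⁻ φ))) x =
      ∫ y, (besselKernel d r (y - x) : ℂ) * φ y := by
  have hG : Integrable fun x : Rd d ↦ (besselKernel d r x : ℂ) :=
    (integrable_besselKernel hr).ofReal
  set ψ : 𝓢(Rd d, ℂ) := 𝓕⁻ φ with hψ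
  have hφ : φ = 𝓕 ψ := by rw [hψ, FourierTransform.fourier_fourierInv_eq]
  have hg : Integrable fun ξ : Rd d ↦
      Complex.exp (↑(-2 * Real.pi * inner ℝ ξ x) * Complex.I) • ψ ξ := by
    refine ψ.integrable.norm.mono' (by fun_prop) (Eventually.of_forall fun ξ ↦ ?_)
    rw [norm_smul, Complex.norm_exp_ofReal_mul_I, one_mul]
  have h := VectorFourier.integral_fourierIntegral_smul_eq_flip (L := innerₗ (Rd d))
    Real.continuous_fourierChar continuous_inner hG hg (μ := volume) (ν := volume)
  rw [SchwartzMap.fourier_coe, Real.fourier_eq']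
  have hL : ∀ ξ : Rd d, VectorFourier.fourierIntegral Real.fourierChar volume (innerₗ (Rd d))
      (fun x ↦ (besselKernel d r x : ℂ)) ξ =
      (((1 + 4 * Real.pi ^ 2 * ‖ξ‖ ^ 2) ^ (-r / 2) : ℝ) : ℂ) := fun ξ ↦ fourier_besselKernel hr ξ
  have hR : ∀ z : Rd d, VectorFourier.fourierIntegral Real.fourierChar volume (innerₗ (Rd d)).flip
      (fun ξ : Rd d ↦ Complex.exp (↑(-2 * Real.pi * inner ℝ ξ x) * Complex.I) • ψ ξ) z =
      φ (z + x) := fun z ↦ by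
    rw [hφ, SchwartzMap.fourier_coe, Real.fourier_eq']
    simp only [VectorFourier.fourierIntegral, flip_innerₗ]
    refine integral_congr_ae (Eventually.of_forall fun ξ ↦ ?_)
    simp only [innerₗ_apply_apply, Circle.smul_def, smul_eq_mul]
    rw [Real.fourierChar_apply, ← mul_assoc, ← Complex.exp_add, inner_add_right]
    congr 2
    push_cast
    ring
  simp_rw [hL, hR] at h
  rw [← integral_add_right_eq_self (fun y ↦ (besselKernel d r (y - x) : ℂ) * φ y) x]
  simp only [add_sub_cancel_right, smul_eq_mul] at h ⊢
  rw [← h]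
  refine integral_congr_ae (Eventually.of_forall fun ξ ↦ ?_)
  simp only
  rw [SchwartzMap.smulLeftCLM_apply_apply (besselSymbol_hasTemperateGrowth d (-r)), smul_eq_mul]
  ring

/-- Justifies Fubini in the next theorem: Young puts `|G| * |u|` in `L^p`, and a Schwartz function
lies in the dual exponent. -/
theorem lintegral_schwartz_mul_conv_lt_top (hr : 0 < r) (hp : 1 ≤ p) {u : Rd d → ℂ}
    (hu : MemLp u (ENNReal.ofReal p)) (φ : 𝓢(Rd d, ℂ)) :
    ∫⁻ x, ‖φ x‖ₑ * ∫⁻ y, ‖besselKernel d r (x - y)‖ₑ * ‖u y‖ₑ < ∞ := by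
  have hp0 : 0 < p := by linarith
  set W : Rd d → ℝ≥0∞ := fun x ↦ ∫⁻ y, ‖besselKernel d r (x - y)‖ₑ * ‖u y‖ₑ with hW
  have hWm : AEMeasurable W := by
    have := (aestronglyMeasurable_besselConv_kernel (r := r) hu.1).enorm.lintegral_prod_right'
    refine this.congr (Eventually.of_forall fun x ↦ lintegral_congr fun y ↦ ?_)
    rw [enorm_mul]
    congr 1
    rw [← ofReal_norm, Complex.norm_real, ofReal_norm]
  have hWp : ∫⁻ x, W x ^ p < ∞ := by
    refine (lintegral_besselKernel_conv_rpow_le hr hp hu.1.enorm).trans_lt ?_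
    rw [lintegral_enorm_rpow_eq_eLpNorm_rpow hp0]
    exact ENNReal.rpow_lt_top_of_nonneg hp0.le hu.2.ne
  have hWt : ∀ᵐ x, W x ≠ ∞ := by
    filter_upwards [ae_lt_top' (hWm.pow_const p) hWp.ne] with x hx h
    simp [h, hp0] at hx
  have hWL : MemLp (fun x ↦ (W x).toReal) (ENNReal.ofReal p) := by
    refine ⟨hWm.ennreal_toReal.aestronglyMeasurable, ?_⟩
    have : eLpNorm (fun x ↦ (W x).toReal) (ENNReal.ofReal p) ^ p ≠ ∞ := by
      rw [← lintegral_enorm_rpow_eq_eLpNorm_rpow hp0]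
      refine ne_of_lt (lt_of_le_of_lt (lintegral_mono fun x ↦ ?_) hWp)
      refine ENNReal.rpow_le_rpow ?_ hp0.le
      rw [Real.enorm_eq_ofReal ENNReal.toReal_nonneg]
      exact ENNReal.ofReal_toReal_le
    exact lt_top_iff_ne_top.2 fun h ↦ this (by simp [h, hp0])
  have h1p : 1 ≤ ENNReal.ofReal p := by simpa using hp
  have := ENNReal.HolderConjugate.inv_one_sub_inv' h1p
  have hint := (hWL.integrable_mul (q := (1 - (ENNReal.ofReal p)⁻¹)⁻¹) (φ.memLp _ volume).norm).2
  refine lt_of_eq_of_lt (lintegral_congr_ae ?_) hint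
  filter_upwards [hWt] with x hx
  rw [Pi.mul_apply, enorm_mul, enorm_norm, mul_comm, Real.enorm_eq_ofReal ENNReal.toReal_nonneg,
    ENNReal.ofReal_toReal hx]

/-- `(1 - Δ)^{-r/2}` acts on `L^p` functions as convolution with the Bessel kernel. -/
theorem besselOp_neg_apply_of_integral (hr : 0 < r) (hp : 1 ≤ p) {u : Rd d → ℂ}
    (hu : MemLp u (ENNReal.ofReal p)) {U : 𝓢'(Rd d, ℂ)}
    (hU : ∀ φ : 𝓢(Rd d, ℂ), U φ = ∫ x, φ x * u x) (φ : 𝓢(Rd d, ℂ)) :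
    besselOp d (-r) U φ = ∫ x, φ x * besselConv d r u x := by
  have hint : Integrable (Function.uncurry fun (x y : Rd d) ↦
      φ x * ((besselKernel d r (x - y) : ℂ) * u y)) (volume.prod volume) := by
    refine ⟨φ.continuous.aestronglyMeasurable.comp_fst.mul
      (aestronglyMeasurable_besselConv_kernel hu.1), ?_⟩
    rw [HasFiniteIntegral, lintegral_prod]
    · refine lt_of_eq_of_lt (lintegral_congr fun x ↦ ?_)
        (lintegral_schwartz_mul_conv_lt_top hr hp hu φ)
      simp only [Function.uncurry_apply_pair, enorm_mul]
      rw [lintegral_const_mul' _ _ enorm_ne_top]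
      congr 1
      refine lintegral_congr fun y ↦ ?_
      congr 1
      rw [← ofReal_norm, Complex.norm_real, ofReal_norm]
    · exact (φ.continuous.aestronglyMeasurable.comp_fst.mul
        (aestronglyMeasurable_besselConv_kernel hu.1)).enorm
  rw [besselOp, TemperedDistribution.fourierMultiplierCLM_apply_apply, hU]
  simp_rw [besselMultiplier_apply hr, besselConv, ← integral_const_mul]
  rw [integral_integral_swap hint]
  refine integral_congr_ae (Eventually.of_forall fun x ↦ ?_)
  simp only
  rw [← integral_mul_const]
  refine integral_congr_ae (Eventually.of_forall fun y ↦ ?_)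
  simp only
  ring

theorem besselOp_neg_toTemperedDistribution (hr : 0 < r) (hp : 1 ≤ p) [Fact (1 ≤ p)]
    (w : Lp ℂ (ENNReal.ofReal p) (volume : Measure (Rd d))) (φ : 𝓢(Rd d, ℂ)) :
    besselOp d (-r) (w : 𝓢'(Rd d, ℂ)) φ = ∫ x, φ x * besselConv d r w x :=
  besselOp_neg_apply_of_integral hr hp (Lp.memLp w)
    (fun φ ↦ by simp [Lp.toTemperedDistribution_apply]) φ

theorem ae_eq_of_integral_schwartz_eq {f g : Rd d → ℂ} (hf : LocallyIntegrable f)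
    (hg : LocallyIntegrable g) (h : ∀ φ : 𝓢(Rd d, ℂ), ∫ x, φ x * f x = ∫ x, φ x * g x) :
    f =ᵐ[volume] g := by
  refine ae_eq_of_integral_contDiff_smul_eq hf hg fun ψ hψ hc ↦ ?_
  have hg₁ : HasCompactSupport (Complex.ofRealCLM ∘ ψ) := hc.comp_left rfl
  have hg₂ : ContDiff ℝ (⊤ : ℕ∞) (Complex.ofRealCLM ∘ ψ) := by fun_prop
  simpa using h (hg₁.toSchwartzMap hg₂)

theorem besselOp_add (a b : ℝ) (U : 𝓢'(Rd d, ℂ)) :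
    besselOp d a (besselOp d b U) = besselOp d (b + a) U := by
  unfold besselOp
  rw [fourierMultiplierCLM_fourierMultiplierCLM_apply (besselSymbol_hasTemperateGrowth d b)
    (besselSymbol_hasTemperateGrowth d a)]
  congr 2
  ext ξ
  have hpos : (0 : ℝ) < 1 + 4 * Real.pi ^ 2 * ‖ξ‖ ^ 2 := by positivity
  rw [Pi.mul_apply, ← Complex.ofReal_mul, ← Real.rpow_add hpos, add_div]

end BesselConv

/-! ### Isometry of `H^{σ,q}` with `L^q`. -/

namespace BesselSpace

variable {d : ℕ} {σ q : ℝ} [Fact (1 ≤ q)]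

theorem norm_eq (v : BesselSpace d σ q) : ‖v‖ = ‖toLp v‖ := rfl

/-- The element `(1 - Δ)^{-σ/2} w` of `H^{σ,q}` for `w ∈ L^q`. -/
noncomputable def ofLp (w : Lp ℂ (ENNReal.ofReal q) (volume : Measure (Rd d))) :
    BesselSpace d σ q :=
  ⟨besselOp d (-σ) (w : 𝓢'(Rd d, ℂ)), w, by
    have := besselOp_neg_besselOp d (-σ) (w : 𝓢'(Rd d, ℂ))
    rw [neg_neg] at this
    exact this.symm⟩

theorem toDistribution_ofLp (w : Lp ℂ (ENNReal.ofReal q) (volume : Measure (Rd d))) :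
    (ofLp w : BesselSpace d σ q).toDistribution = besselOp d (-σ) (w : 𝓢'(Rd d, ℂ)) := rfl

theorem toLp_ofLp (w : Lp ℂ (ENNReal.ofReal q) (volume : Measure (Rd d))) :
    toLp (ofLp w : BesselSpace d σ q) = w := by
  apply lp_injective
  have := besselOp_neg_besselOp d (-σ) (w : 𝓢'(Rd d, ℂ))
  rw [neg_neg] at this
  rw [Lp.toTemperedDistributionCLM_apply, Lp.toTemperedDistributionCLM_apply, toLp_spec,
    toDistribution_ofLp, this]

/-- `(1 - Δ)^{σ/2}` as an isometry of `H^{σ,q}` onto `L^q`. -/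
noncomputable def toLpEquiv :
    BesselSpace d σ q ≃ₗᵢ[ℂ] Lp ℂ (ENNReal.ofReal q) (volume : Measure (Rd d)) :=
  LinearIsometryEquiv.ofSurjective ⟨toLp, fun _ ↦ rfl⟩ fun w ↦ ⟨ofLp w, toLp_ofLp w⟩

instance : CompleteSpace (BesselSpace d σ q) :=
  (completeSpace_congr (e := (toLpEquiv (d := d) (σ := σ) (q := q)).toEquiv)
    (toLpEquiv (d := d) (σ := σ) (q := q)).isometry.isUniformEmbedding).2 inferInstance

end BesselSpace

/-! ### Moments of scalar Gaussian sums. -/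

section GaussianSums

variable {Ω : Type u} [MeasurableSpace Ω] {P : Measure Ω} {γ : ℕ → Ω → ℝ}

theorem map_sum_mul_gaussian [IsProbabilityMeasure P] (hγ : IsGaussianSequence P γ)
    (s : Finset ℕ) (a : ℕ → ℝ) :
    P.map (∑ n ∈ s, fun ω ↦ a n * γ n ω) = gaussianReal 0 (∑ n ∈ s, ‖a n‖₊ ^ 2) := by
  have hm : ∀ n, AEMeasurable (fun ω ↦ a n * γ n ω) P := fun n ↦
    (hγ.1 n).aemeasurable.const_mul _
  have hind : iIndepFun (fun n ω ↦ a n * γ n ω) P :=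
    hγ.2.comp (fun n x ↦ a n * x) fun n ↦ measurable_const_mul _
  have hlaw : ∀ n, P.map (fun ω ↦ a n * γ n ω) = gaussianReal 0 (‖a n‖₊ ^ 2) := fun n ↦ by
    rw [(gaussianReal_const_mul (hγ.1 n) (a n)).map_eq, mul_zero, mul_one]
    congr 1
    ext
    simp
  induction s using Finset.induction_on with
  | empty =>
    simp only [Finset.sum_empty, gaussianReal_zero_var]
    exact Measure.map_const P (0 : ℝ) |>.trans (by simp)
  | insert n s hn ih =>
    rw [Finset.sum_insert hn, Finset.sum_insert hn]
    have := gaussianReal_add_gaussianReal_of_indepFun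
      (hind.indepFun_finsetSum_of_notMem₀ hm hn).symm (hlaw n) ih
    rwa [add_zero] at this

/-- The absolute moments of a standard Gaussian random variable. -/
noncomputable def gaussianMoment (p : ℝ) : ℝ≥0∞ := ∫⁻ z, ‖z‖ₑ ^ p ∂(gaussianReal 0 1)

theorem gaussianMoment_ne_top {p : ℝ} (hp : 0 < p) : gaussianMoment p ≠ ∞ := by
  have h := memLp_id_gaussianReal' (μ := 0) (v := 1) (ENNReal.ofReal p) ENNReal.ofReal_ne_top
  have h2 := lintegral_enorm_rpow_eq_eLpNorm_rpow hp (id : ℝ → ℝ) (μ := gaussianReal 0 1)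
  simp only [id_eq] at h2
  rw [gaussianMoment, h2]
  exact ENNReal.rpow_ne_top_of_nonneg hp.le h.2.ne

theorem gaussianMoment_ne_zero {p : ℝ} (hp : 0 < p) : gaussianMoment p ≠ 0 := by
  intro h
  rw [gaussianMoment, lintegral_eq_zero_iff (by fun_prop)] at h
  have hns := nullSingletonClass_gaussianReal (μ := 0) (v := 1) one_ne_zero
  have h0 : ∀ᵐ z : ℝ ∂(gaussianReal 0 1), z ≠ 0 := by
    rw [ae_iff]
    simp
  have : ∀ᵐ z : ℝ ∂(gaussianReal 0 1), False := by
    filter_upwards [h, h0] with z hz hz0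
    simp [hp, not_lt.2 hp.le, hz0] at hz
  rw [eventually_false_iff_eq_bot, ae_eq_bot] at this
  exact IsProbabilityMeasure.ne_zero _ this

/-- By independence the sum is a centred Gaussian of variance `∑ a_n²`, hence has the law of a
multiple of a standard Gaussian. This makes the Khintchine inequality an identity. -/
theorem lintegral_sum_mul_gaussian_rpow [IsProbabilityMeasure P] (hγ : IsGaussianSequence P γ)
    (s : Finset ℕ) (a : ℕ → ℝ) {p : ℝ} (hp : 0 < p) :
    ∫⁻ ω, ‖∑ n ∈ s, γ n ω * a n‖ₑ ^ p ∂P =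
      gaussianMoment p * (∑ n ∈ s, ‖a n‖ₑ ^ (2 : ℝ)) ^ (p / 2) := by
  have hm : AEMeasurable (∑ n ∈ s, fun ω ↦ a n * γ n ω) P :=
    Finset.aemeasurable_sum _ fun n _ ↦ (hγ.1 n).aemeasurable.const_mul _
  set v : ℝ≥0 := ∑ n ∈ s, ‖a n‖₊ ^ 2 with hv
  have h1 : ∫⁻ ω, ‖∑ n ∈ s, γ n ω * a n‖ₑ ^ p ∂P = ∫⁻ z, ‖z‖ₑ ^ p ∂(gaussianReal 0 v) := by
    rw [← map_sum_mul_gaussian hγ s a, lintegral_map' (by fun_prop) hm]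
    refine lintegral_congr fun ω ↦ ?_
    simp [mul_comm]
  have h2 : gaussianReal 0 v = (gaussianReal 0 1).map (fun x ↦ (NNReal.sqrt v : ℝ) * x) := by
    rw [gaussianReal_map_const_mul, mul_zero, mul_one]
    congr 1
    ext
    simp
  rw [h1, h2, lintegral_map (by fun_prop) (by fun_prop)]
  simp_rw [enorm_mul, ENNReal.mul_rpow_of_nonneg _ _ hp.le]
  rw [lintegral_const_mul _ (by fun_prop), mul_comm, gaussianMoment]
  congr 1
  have h3 : (∑ n ∈ s, ‖a n‖ₑ ^ (2 : ℝ)) = (v : ℝ≥0∞) := by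
    rw [hv]
    push_cast
    simp [enorm_eq_nnnorm]
  have h4 : ‖(NNReal.sqrt v : ℝ)‖ₑ = (v : ℝ≥0∞) ^ (1 / 2 : ℝ) := by
    rw [enorm_eq_nnnorm, NNReal.nnnorm_eq, NNReal.sqrt_eq_rpow,
      ENNReal.coe_rpow_of_nonneg _ (by norm_num)]
  rw [h3, h4, ← ENNReal.rpow_mul]
  ring_nf

end GaussianSums

/-! ### `γ`-norms of integral operators and square functions. -/

section KernelOperators

variable {Ω : Type u} [MeasurableSpace Ω] {P : Measure Ω} {γ : ℕ → Ω → ℝ} {d : ℕ}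
  {K : Rd d → Rd d → ℝ}

theorem memLp_two_of_lintegral_ne_top {k : Rd d → ℝ} (hk : Measurable k)
    (h : ∫⁻ y, ‖k y‖ₑ ^ (2 : ℝ) ≠ ∞) : MemLp k 2 := by
  refine ⟨hk.aestronglyMeasurable, ?_⟩
  have h2 := lintegral_enorm_rpow_eq_eLpNorm_rpow two_pos k (μ := volume)
  rw [ENNReal.ofReal_ofNat] at h2
  rw [h2] at h
  exact lt_top_iff_ne_top.2 fun h' ↦ h (by simp [h'])

theorem integrable_mul_coeFn {k : Rd d → ℝ} (hk : Measurable k)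
    (h : ∫⁻ y, ‖k y‖ₑ ^ (2 : ℝ) ≠ ∞) (f : L2 d) : Integrable fun y ↦ k y * f y :=
  (memLp_two_of_lintegral_ne_top hk h).integrable_mul (Lp.memLp f)

/-- Parseval's identity for the coefficients of a square integrable function. -/
theorem tsum_enorm_coefficient_sq (h : HilbertBasis ℕ ℝ (L2 d)) {k : Rd d → ℝ}
    (hk : Measurable k) (hfin : ∫⁻ y, ‖k y‖ₑ ^ (2 : ℝ) ≠ ∞) :
    ∑' n, ‖∫ y, k y * h n y‖ₑ ^ (2 : ℝ) = ∫⁻ y, ‖k y‖ₑ ^ (2 : ℝ) := by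
  have hk2 := memLp_two_of_lintegral_ne_top hk hfin
  set k' : L2 d := hk2.toLp k with hk'
  have hcoef : ∀ n, ∫ y, k y * h n y = inner ℝ k' (h n) := fun n ↦ by
    rw [L2.inner_def]
    refine integral_congr_ae ?_
    filter_upwards [hk2.coeFn_toLp] with y hy
    rw [hk', hy]
    simp [mul_comm]
  have hsum := h.hasSum_inner_mul_inner k' k'
  have hsq : ∀ n, inner ℝ k' (h n) * inner ℝ (h n) k' = ‖inner ℝ k' (h n)‖ ^ 2 := fun n ↦ by
    rw [real_inner_comm k' (h n), Real.norm_eq_abs, sq_abs, sq]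
  simp_rw [hsq] at hsum
  have hnorm : ∫⁻ y, ‖k y‖ₑ ^ (2 : ℝ) = ENNReal.ofReal (inner ℝ k' k') := by
    have h2 := lintegral_enorm_rpow_eq_eLpNorm_rpow two_pos k (μ := volume)
    rw [ENNReal.ofReal_ofNat] at h2
    rw [h2, real_inner_self_eq_norm_sq, hk', Lp.norm_toLp, ENNReal.ofReal_pow
      ENNReal.toReal_nonneg, ENNReal.ofReal_toReal hk2.2.ne, ENNReal.rpow_ofNat]
  rw [hnorm, ← hsum.tsum_eq, ENNReal.ofReal_tsum_of_nonneg (fun n ↦ by positivity) hsum.summable]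
  refine tsum_congr fun n ↦ ?_
  rw [hcoef, ENNReal.rpow_ofNat, ← ofReal_norm, ENNReal.ofReal_pow (norm_nonneg _)]

theorem measurable_kernel_integral (hK : Measurable (Function.uncurry K)) (f : L2 d) :
    Measurable fun x ↦ ∫ y, K x y * f y := by
  have : StronglyMeasurable fun z : Rd d × Rd d ↦ K z.1 z.2 * f z.2 :=
    hK.stronglyMeasurable.mul ((Lp.stronglyMeasurable f).comp_measurable measurable_snd)
  exact this.integral_prod_right'.measurable

theorem measurable_lintegral_kernel_sq (hK : Measurable (Function.uncurry K)) :
    Measurable fun x ↦ ∫⁻ y, ‖K x y‖ₑ ^ (2 : ℝ) :=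
  (hK.enorm.pow_const _).lintegral_prod_right'

theorem kernel_integral_sum (hK : Measurable (Function.uncurry K))
    (h : HilbertBasis ℕ ℝ (L2 d)) (s : Finset ℕ) (c : ℕ → ℝ) {x : Rd d}
    (hx : ∫⁻ y, ‖K x y‖ₑ ^ (2 : ℝ) ≠ ∞) :
    ∫ y, K x y * (∑ n ∈ s, c n • h n : L2 d) y = ∑ n ∈ s, c n * ∫ y, K x y * h n y := by
  have hKx : Measurable (K x) := hK.comp measurable_prodMk_left
  simp_rw [← integral_const_mul]
  rw [← integral_finsetSum _ fun n _ ↦ (integrable_mul_coeFn hKx hx (h n)).const_mul _]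
  refine integral_congr_ae ?_
  have hae : ∀ᵐ y, ∀ n, (c n • h n : L2 d) y = c n * h n y := by
    refine ae_all_iff.2 fun n ↦ ?_
    filter_upwards [Lp.coeFn_smul (c n) (h n)] with y hy
    rw [hy]
    rfl
  filter_upwards [Lp.coeFn_finsetSum s fun n ↦ c n • h n, hae] with y hy hy2
  rw [hy, Finset.sum_apply, Finset.mul_sum]
  refine Finset.sum_congr rfl fun n _ ↦ ?_
  rw [hy2 n]
  ring

variable {X : Type*} [NormedAddCommGroup X] [NormedSpace ℝ X]

theorem sum_smul_apply_eq (h : HilbertBasis ℕ ℝ (L2 d)) (T : L2 d →L[ℝ] X) (s : Finset ℕ)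
    (c : ℕ → ℝ) : ∑ n ∈ s, c n • T (h n) = T (∑ n ∈ s, c n • h n) := by
  simp

theorem IsGaussianSequence.memLp [IsProbabilityMeasure P] (hγ : IsGaussianSequence P γ) (n : ℕ) :
    MemLp (γ n) 2 P := by
  have h := memLp_id_gaussianReal' (μ := 0) (v := 1) 2 (by simp)
  rw [← (hγ.1 n).map_eq, memLp_map_measure_iff aestronglyMeasurable_id (hγ.1 n).aemeasurable] at h
  exact h

theorem memLp_gaussian_sum [IsProbabilityMeasure P] (hγ : IsGaussianSequence P γ)
    (s : Finset ℕ) (v : ℕ → X) : MemLp (fun ω ↦ ∑ n ∈ s, γ n ω • v n) 2 P := by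
  refine memLp_finsetSum s fun n _ ↦ ?_
  refine (hγ.memLp n).of_le_mul (c := ‖v n‖)
    ((hγ.memLp n).1.smul aestronglyMeasurable_const) (Eventually.of_forall fun ω ↦ ?_)
  rw [norm_smul, mul_comm]

/-- Tonelli's theorem for the moments of a random kernel sum. -/
theorem lintegral_lintegral_gaussian_sum [IsProbabilityMeasure P] (hγ : IsGaussianSequence P γ)
    (s : Finset ℕ) {a : ℕ → Rd d → ℝ} (ha : ∀ n, Measurable (a n)) {q : ℝ} (hq : 0 < q) :
    ∫⁻ ω, (∫⁻ x, ‖∑ n ∈ s, γ n ω * a n x‖ₑ ^ q) ∂P =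
      gaussianMoment q * ∫⁻ x, (∑ n ∈ s, ‖a n x‖ₑ ^ (2 : ℝ)) ^ (q / 2) := by
  rw [lintegral_lintegral_swap]
  · simp_rw [lintegral_sum_mul_gaussian_rpow hγ s _ hq]
    rw [lintegral_const_mul]
    exact (Finset.measurable_sum _ fun n _ ↦ (ha n).enorm.pow_const _).pow_const _
  · refine AEMeasurable.pow_const (AEMeasurable.enorm ?_) _
    refine Finset.aemeasurable_fun_sum _ fun n _ ↦ ?_
    exact ((hγ.1 n).aemeasurable.comp_fst).mul ((ha n).comp measurable_snd).aemeasurable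

variable {q : ℝ}

/-- For each `ω` the sum is `T` applied to a finite combination of the basis, so it is controlled by
a kernel integral; the moments are then computed pointwise in `x`. -/
theorem lintegral_gaussian_sum_rpow_le [IsProbabilityMeasure P] (hγ : IsGaussianSequence P γ)
    (h : HilbertBasis ℕ ℝ (L2 d)) (hq : 0 < q) (hK : Measurable (Function.uncurry K))
    (hfin : ∀ᵐ x, ∫⁻ y, ‖K x y‖ₑ ^ (2 : ℝ) ≠ ∞) (T : L2 d →L[ℝ] X)
    (hT : ∀ f, ‖T f‖ₑ ^ q ≤ ∫⁻ x, ‖∫ y, K x y * f y‖ₑ ^ q) (s : Finset ℕ) :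
    ∫⁻ ω, ‖∑ n ∈ s, γ n ω • T (h n)‖ₑ ^ q ∂P ≤
      gaussianMoment q * ∫⁻ x, (∑ n ∈ s, ‖∫ y, K x y * h n y‖ₑ ^ (2 : ℝ)) ^ (q / 2) := by
  rw [← lintegral_lintegral_gaussian_sum hγ s (fun n ↦ measurable_kernel_integral hK (h n)) hq]
  refine lintegral_mono fun ω ↦ ?_
  rw [sum_smul_apply_eq]
  refine (hT _).trans (le_of_eq (lintegral_congr_ae ?_))
  filter_upwards [hfin] with x hx
  rw [kernel_integral_sum hK h s _ hx]

/-- A kernel operator into a space normed by `L^q` is `γ`-radonifying if its square function is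
in `L^q`. -/
theorem isGammaRadonifying_of_kernel [CompleteSpace X] [IsProbabilityMeasure P]
    (hγ : IsGaussianSequence P γ) (h : HilbertBasis ℕ ℝ (L2 d)) (hq : 2 ≤ q)
    (hK : Measurable (Function.uncurry K))
    (hF : ∫⁻ x, (∫⁻ y, ‖K x y‖ₑ ^ (2 : ℝ)) ^ (q / 2) ≠ ∞) (T : L2 d →L[ℝ] X)
    (hT : ∀ f, ‖T f‖ₑ ^ q ≤ ∫⁻ x, ‖∫ y, K x y * f y‖ₑ ^ q) :
    IsGammaRadonifying P γ h T ∧ gammaNorm P γ h T ≤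
      (gaussianMoment q * ∫⁻ x, (∫⁻ y, ‖K x y‖ₑ ^ (2 : ℝ)) ^ (q / 2)) ^ (1 / q) := by
  have hq0 : 0 < q := by linarith
  have hfin : ∀ᵐ x, ∫⁻ y, ‖K x y‖ₑ ^ (2 : ℝ) ≠ ∞ := by
    filter_upwards [ae_lt_top ((measurable_lintegral_kernel_sq hK).pow_const _) hF] with x hx hx'
    rw [hx', ENNReal.top_rpow_of_pos (by linarith)] at hx
    exact lt_irrefl _ hx
  set a : ℕ → Rd d → ℝ≥0∞ := fun n x ↦ ‖∫ y, K x y * h n y‖ₑ ^ (2 : ℝ) with ha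
  have ham : ∀ n, Measurable (a n) := fun n ↦ (measurable_kernel_integral hK (h n)).enorm.pow_const _
  have hpars : ∀ᵐ x, ∑' n, a n x = ∫⁻ y, ‖K x y‖ₑ ^ (2 : ℝ) := by
    filter_upwards [hfin] with x hx
    exact tsum_enorm_coefficient_sq h (hK.comp measurable_prodMk_left) hx
  -- The `L²(Ω)` norm is at most the `L^q(Ω)` norm, as `q ≥ 2` on a probability space; the `q`-th
  -- moment commutes with the integral over `x`.
  have hbound : ∀ s : Finset ℕ, eLpNorm (fun ω ↦ ∑ n ∈ s, γ n ω • T (h n)) 2 P ≤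
      (gaussianMoment q * ∫⁻ x, (∑ n ∈ s, a n x) ^ (q / 2)) ^ (1 / q) := by
    intro s
    have hmem := memLp_gaussian_sum hγ s fun n ↦ T (h n)
    refine (eLpNorm_le_eLpNorm_of_exponent_le (q := ENNReal.ofReal q) ?_ hmem.1).trans ?_
    · rw [← ENNReal.ofReal_ofNat]
      exact ENNReal.ofReal_le_ofReal hq
    · rw [eLpNorm_le_iff_lintegral_rpow_le hq0, ← ENNReal.rpow_mul, one_div_mul_cancel hq0.ne',
        ENNReal.rpow_one]
      exact lintegral_gaussian_sum_rpow_le hγ h hq0 hK hfin T hT s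
  set tail : ℕ → Rd d → ℝ≥0∞ := fun N x ↦ ∑' n, a (n + N) x with htail
  -- Tails of the Parseval series are dominated by the full square function. The factor `2` arises
  -- because the Cauchy estimate compares two partial sums through the `N`-th one.
  have htendsto : Tendsto (fun N ↦ 2 * (gaussianMoment q * ∫⁻ x, (tail N x) ^ (q / 2)) ^ (1 / q))
      atTop (𝓝 0) := by
    have h1 : Tendsto (fun N ↦ ∫⁻ x, (tail N x) ^ (q / 2)) atTop (𝓝 (∫⁻ _ : Rd d, 0)) := by
      refine tendsto_lintegral_of_dominated_convergence
        (fun x ↦ (∫⁻ y, ‖K x y‖ₑ ^ (2 : ℝ)) ^ (q / 2))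
        (fun N ↦ (Measurable.tsum fun n ↦ ham _).pow_const _) (fun N ↦ ?_) hF ?_
      · filter_upwards [hpars] with x hx
        refine ENNReal.rpow_le_rpow ?_ (by linarith)
        rw [← hx]
        exact ENNReal.tsum_comp_le_tsum_of_injective (add_left_injective N) fun n ↦ a n x
      · filter_upwards [hpars, hfin] with x hx hx'
        have := ENNReal.tendsto_sum_nat_add (fun n ↦ a n x) (by rw [hx]; exact hx')
        have h2 := (ENNReal.continuous_rpow_const (y := q / 2)).tendsto 0 |>.comp this
        rwa [ENNReal.zero_rpow_of_pos (by linarith)] at h2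
    rw [lintegral_zero] at h1
    have h2 := ENNReal.Tendsto.const_mul h1 (Or.inr (gaussianMoment_ne_top hq0))
    rw [mul_zero] at h2
    have h3 := (ENNReal.continuous_rpow_const (y := 1 / q)).tendsto 0 |>.comp h2
    rw [ENNReal.zero_rpow_of_pos (by positivity)] at h3
    have h4 := ENNReal.Tendsto.const_mul h3 (a := 2) (Or.inr (by simp))
    rwa [mul_zero] at h4
  have hmem : ∀ N : ℕ, MemLp (fun ω ↦ ∑ n ∈ Finset.range N, γ n ω • T (h n)) 2 P := fun N ↦
    memLp_gaussian_sum hγ _ _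
  set S : ℕ → Lp X 2 P := fun N ↦ (hmem N).toLp with hS
  have hdist : ∀ n N, N ≤ n →
      edist (S n) (S N) ≤ (gaussianMoment q * ∫⁻ x, (tail N x) ^ (q / 2)) ^ (1 / q) := by
    intro n N hN
    rw [hS, Lp.edist_toLp_toLp]
    have : ((fun ω ↦ ∑ i ∈ Finset.range n, γ i ω • T (h i)) -
        fun ω ↦ ∑ i ∈ Finset.range N, γ i ω • T (h i)) =
        fun ω ↦ ∑ i ∈ Finset.Ico N n, γ i ω • T (h i) := by
      ext ω
      simp only [Pi.sub_apply]
      rw [Finset.sum_Ico_eq_sub _ hN]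
    rw [this]
    refine (hbound _).trans (ENNReal.rpow_le_rpow (mul_le_mul_right (lintegral_mono fun x ↦
      ENNReal.rpow_le_rpow ?_ (by linarith)) _) (by positivity))
    rw [Finset.sum_Ico_eq_sum_range]
    simp_rw [add_comm N]
    exact ENNReal.sum_le_tsum (f := fun n ↦ a (n + N) x) _
  have hcauchy : CauchySeq S := by
    rw [EMetric.cauchySeq_iff_le_tendsto_0]
    refine ⟨_, fun n m N hn hm ↦ ?_, htendsto⟩
    rw [two_mul]
    refine (edist_triangle_right _ _ (S N)).trans (add_le_add (hdist n N hn) (hdist m N hm))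
  obtain ⟨S', hS'⟩ := cauchySeq_tendsto_of_complete hcauchy
  have hlim : Tendsto (fun N : ℕ ↦ eLpNorm (fun ω ↦
      (∑ n ∈ Finset.range N, γ n ω • T (h n)) - S' ω) 2 P) atTop (𝓝 0) := by
    rw [Lp.tendsto_Lp_iff_tendsto_eLpNorm'] at hS'
    refine hS'.congr fun N ↦ eLpNorm_congr_ae ?_
    filter_upwards [(hmem N).coeFn_toLp] with ω hω
    simp only [Pi.sub_apply, hS, hω]
  have hsum : HasGaussianSum P γ h T S' := ⟨Lp.memLp S', hlim⟩
  refine ⟨⟨S', hsum⟩, (iInf₂_le _ hsum).trans ?_⟩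
  set B := (gaussianMoment q * ∫⁻ x, (∫⁻ y, ‖K x y‖ₑ ^ (2 : ℝ)) ^ (q / 2)) ^ (1 / q) with hB
  have hle : ∀ N : ℕ, eLpNorm S' 2 P ≤ eLpNorm (fun ω ↦
      (∑ n ∈ Finset.range N, γ n ω • T (h n)) - S' ω) 2 P + B := by
    intro N
    have h1 : (S' : Ω → X) = (fun ω ↦ ∑ n ∈ Finset.range N, γ n ω • T (h n)) -
        fun ω ↦ (∑ n ∈ Finset.range N, γ n ω • T (h n)) - S' ω := by
      ext ω; simp
    have h2 : eLpNorm S' 2 P ≤ eLpNorm (fun ω ↦ ∑ n ∈ Finset.range N, γ n ω • T (h n)) 2 P +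
        eLpNorm (fun ω ↦ (∑ n ∈ Finset.range N, γ n ω • T (h n)) - S' ω) 2 P := by
      conv_lhs => rw [h1]
      exact eLpNorm_sub_le (hmem N).1 ((hmem N).sub (Lp.memLp S')).1 one_le_two
    rw [add_comm] at h2
    refine h2.trans (add_le_add_right ((hbound _).trans (ENNReal.rpow_le_rpow
      (mul_le_mul_right (lintegral_mono_ae ?_) _) (by positivity))) _)
    filter_upwards [hpars] with x hx
    rw [← hx]
    exact ENNReal.rpow_le_rpow (ENNReal.sum_le_tsum _) (by linarith)
  refine le_of_tendsto_of_tendsto' tendsto_const_nhds (hlim.add_const B) hle |>.trans ?_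
  rw [zero_add]

/-- The `γ`-norm of an operator controls the square function of a dominated kernel operator. -/
theorem lintegral_square_function_le_gammaNorm [IsProbabilityMeasure P]
    (hγ : IsGaussianSequence P γ) (h : HilbertBasis ℕ ℝ (L2 d)) (hq : 1 ≤ q)
    (hK : Measurable (Function.uncurry K))
    (hfin : ∀ᵐ x, ∫⁻ y, ‖K x y‖ₑ ^ (2 : ℝ) ≠ ∞) (T : L2 d →L[ℝ] X)
    (hT : ∀ f, ∫⁻ x, ‖∫ y, K x y * f y‖ₑ ^ q ≤ ‖T f‖ₑ ^ q) :
    gaussianMoment 1 ^ q * ∫⁻ x, (∫⁻ y, ‖K x y‖ₑ ^ (2 : ℝ)) ^ (q / 2) ≤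
      gammaNorm P γ h T ^ q := by
  have hq0 : 0 < q := by linarith
  rw [← ENNReal.rpow_one_div_le_iff hq0]
  refine le_iInf₂ fun S hS ↦ ?_
  rw [ENNReal.rpow_one_div_le_iff hq0]
  set a : ℕ → Rd d → ℝ := fun n x ↦ ∫ y, K x y * h n y with ha
  have ham : ∀ n, Measurable (a n) := fun n ↦ measurable_kernel_integral hK (h n)
  have hγm : ∀ n, AEMeasurable (γ n) P := fun n ↦ (hγ.1 n).aemeasurable
  -- Minkowski needs a jointly measurable integrand, so the `γ n` are replaced by measurable
  -- modifications.
  have hγae : ∀ᵐ ω ∂P, ∀ n, γ n ω = (hγm n).mk (γ n) ω := ae_all_iff.2 fun n ↦ (hγm n).ae_eq_mk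
  have hpart : ∀ N : ℕ, gaussianMoment 1 ^ q *
      ∫⁻ x, (∑ n ∈ Finset.range N, ‖a n x‖ₑ ^ (2 : ℝ)) ^ (q / 2) ≤
      (eLpNorm (fun ω ↦ ∑ n ∈ Finset.range N, γ n ω • T (h n)) 2 P) ^ q := by
    intro N
    set F : Rd d → Ω → ℝ≥0∞ := fun x ω ↦
      ‖∑ n ∈ Finset.range N, (hγm n).mk (γ n) ω * a n x‖ₑ with hF
    have hFm : Measurable (Function.uncurry F) := by
      refine Measurable.enorm (Finset.measurable_fun_sum _ fun n _ ↦ ?_)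
      exact ((hγm n).measurable_mk.comp measurable_snd).mul ((ham n).comp measurable_fst)
    have h1 : ∀ x, ∫⁻ ω, F x ω ∂P =
        gaussianMoment 1 * (∑ n ∈ Finset.range N, ‖a n x‖ₑ ^ (2 : ℝ)) ^ (1 / 2 : ℝ) := by
      intro x
      rw [← lintegral_sum_mul_gaussian_rpow hγ _ _ one_pos]
      simp_rw [ENNReal.rpow_one]
      refine lintegral_congr_ae ?_
      filter_upwards [hγae] with ω hω
      simp only [hF, hω]
    have h2 : ∀ᵐ ω ∂P, (∫⁻ x, F x ω ^ q) ^ (1 / q) ≤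
        ‖∑ n ∈ Finset.range N, γ n ω • T (h n)‖ₑ := by
      filter_upwards [hγae] with ω hω
      rw [ENNReal.rpow_one_div_le_iff hq0, sum_smul_apply_eq]
      refine le_trans (le_of_eq (lintegral_congr_ae ?_)) (hT _)
      filter_upwards [hfin] with x hx
      rw [kernel_integral_sum hK h _ _ hx]
      simp only [hF, hω, ha]
    -- The `L^q` norm in `x` of the first absolute moment is at most the mean of the `L^q` norm.
    -- Only `L¹(Ω) ≤ L²(Ω)` is needed afterwards, so no Kahane inequality enters.
    have h3 := lintegral_minkowski (μ := volume) (ν := P) hq hFm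
    simp_rw [h1, ENNReal.mul_rpow_of_nonneg _ _ hq0.le, ← ENNReal.rpow_mul] at h3
    rw [lintegral_const_mul' _ _ (ENNReal.rpow_ne_top_of_nonneg hq0.le
      (gaussianMoment_ne_top one_pos)), one_div_mul_eq_div] at h3
    refine h3.trans (ENNReal.rpow_le_rpow ?_ hq0.le)
    refine (lintegral_mono_ae h2).trans ?_
    rw [← eLpNorm_one_eq_lintegral_enorm]
    exact eLpNorm_le_eLpNorm_of_exponent_le one_le_two (memLp_gaussian_sum hγ _ _).1
  have hmono : Tendsto (fun N ↦ ∫⁻ x, (∑ n ∈ Finset.range N, ‖a n x‖ₑ ^ (2 : ℝ)) ^ (q / 2)) atTop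
      (𝓝 (∫⁻ x, (∫⁻ y, ‖K x y‖ₑ ^ (2 : ℝ)) ^ (q / 2))) := by
    refine lintegral_tendsto_of_tendsto_of_monotone (fun N ↦ ?_)
      (Eventually.of_forall fun x N M hNM ↦ ?_) ?_
    · exact ((Finset.measurable_fun_sum _ fun n _ ↦
        (ham n).enorm.pow_const _).pow_const _).aemeasurable
    · exact ENNReal.rpow_le_rpow (Finset.sum_le_sum_of_subset
        (Finset.range_subset_range.2 hNM)) (by linarith)
    · filter_upwards [hfin] with x hx
      refine ((ENNReal.continuous_rpow_const (y := q / 2)).tendsto _).comp ?_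
      rw [← tsum_enorm_coefficient_sq h (k := K x) (hK.comp measurable_prodMk_left) hx]
      exact ENNReal.tendsto_nat_tsum _
  have hlhs := ENNReal.Tendsto.const_mul hmono (a := gaussianMoment 1 ^ q)
    (Or.inr (ENNReal.rpow_ne_top_of_nonneg hq0.le (gaussianMoment_ne_top one_pos)))
  have hrhs := ((ENNReal.continuous_rpow_const (y := q)).tendsto _).comp
    (hS.2.add_const (eLpNorm S 2 P))
  rw [zero_add] at hrhs
  refine le_of_tendsto_of_tendsto' hlhs hrhs fun N ↦ (hpart N).trans
    (ENNReal.rpow_le_rpow ?_ hq0.le)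
  have hmem := memLp_gaussian_sum hγ (Finset.range N) fun n ↦ T (h n)
  have h1 : (fun ω ↦ ∑ n ∈ Finset.range N, γ n ω • T (h n)) =
      (fun ω ↦ (∑ n ∈ Finset.range N, γ n ω • T (h n)) - S ω) + S := by
    ext ω; simp
  conv_lhs => rw [h1]
  exact eLpNorm_add_le (hmem.sub hS.1).1 hS.1.1 one_le_two

end KernelOperators

/-! ### Construction of `M_g` and the sufficient conditions. -/

section Sufficiency

variable {d : ℕ} {q : ℝ}

theorem enorm_kernel_integral_le {k : Rd d → ℝ} (hk : Measurable k) (f : L2 d) :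
    ‖∫ y, k y * f y‖ₑ ≤ (∫⁻ y, ‖k y‖ₑ ^ (2 : ℝ)) ^ (1 / 2 : ℝ) * ‖f‖ₑ := by
  refine (enorm_integral_le_lintegral_enorm _).trans ?_
  simp_rw [enorm_mul]
  refine (ENNReal.lintegral_mul_le_Lp_mul_Lq volume Real.HolderConjugate.two_two
    hk.enorm.aemeasurable (Lp.stronglyMeasurable f).measurable.enorm.aemeasurable).trans
    (le_of_eq ?_)
  rw [lintegral_enorm_rpow_eq_eLpNorm_rpow two_pos f, ENNReal.ofReal_ofNat, ← ENNReal.rpow_mul,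
    Lp.enorm_def]
  norm_num

theorem enorm_lp_rpow_eq [Fact (1 ≤ q)] (w : Lp ℂ (ENNReal.ofReal q) (volume : Measure (Rd d))) :
    ‖w‖ₑ ^ q = ∫⁻ x, ‖w x‖ₑ ^ q := by
  rw [lintegral_enorm_rpow_eq_eLpNorm_rpow (zero_lt_one.trans_le Fact.out), Lp.enorm_def]

/-- The kernel operator `L² → L^q` of a kernel whose square function is in `L^q`. -/
theorem exists_kernelOperator [Fact (1 ≤ q)] {K : Rd d → Rd d → ℝ}
    (hK : Measurable (Function.uncurry K))
    (hF : ∫⁻ x, (∫⁻ y, ‖K x y‖ₑ ^ (2 : ℝ)) ^ (q / 2) ≠ ∞) :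
    ∃ A : L2 d →L[ℝ] Lp ℂ (ENNReal.ofReal q) (volume : Measure (Rd d)),
      ∀ f, A f =ᵐ[volume] fun x ↦ ((∫ y, K x y * f y : ℝ) : ℂ) := by
  have hq1 : 1 ≤ q := Fact.out
  have hq0 : 0 < q := by linarith
  have hfin : ∀ᵐ x, ∫⁻ y, ‖K x y‖ₑ ^ (2 : ℝ) ≠ ∞ := by
    filter_upwards [ae_lt_top ((measurable_lintegral_kernel_sq hK).pow_const _) hF] with x hx hx'
    rw [hx', ENNReal.top_rpow_of_pos (by linarith)] at hx
    exact lt_irrefl _ hx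
  have hKx : ∀ x, Measurable (K x) := fun x ↦ hK.comp measurable_prodMk_left
  set D : ℝ≥0∞ := (∫⁻ x, (∫⁻ y, ‖K x y‖ₑ ^ (2 : ℝ)) ^ (q / 2)) ^ (1 / q) with hD
  have hDt : D ≠ ∞ := ENNReal.rpow_ne_top_of_nonneg (by positivity) hF
  set W : L2 d → Rd d → ℂ := fun f x ↦ ((∫ y, K x y * f y : ℝ) : ℂ) with hW
  have hWm : ∀ f, Measurable (W f) := fun f ↦
    Complex.measurable_ofReal.comp (measurable_kernel_integral hK f)
  have hnorm : ∀ f, eLpNorm (W f) (ENNReal.ofReal q) ≤ D * ‖f‖ₑ := by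
    intro f
    rw [eLpNorm_le_iff_lintegral_rpow_le hq0, ENNReal.mul_rpow_of_nonneg _ _ hq0.le, hD,
      ← ENNReal.rpow_mul, one_div_mul_cancel hq0.ne', ENNReal.rpow_one,
      ← lintegral_mul_const' _ _ (ENNReal.rpow_ne_top_of_nonneg hq0.le enorm_ne_top)]
    refine lintegral_mono fun x ↦ ?_
    have h1 : ‖W f x‖ₑ = ‖∫ y, K x y * f y‖ₑ := by
      rw [← ofReal_norm, ← ofReal_norm, hW, Complex.norm_real]
    rw [h1]
    refine (ENNReal.rpow_le_rpow (enorm_kernel_integral_le (hKx x) f) hq0.le).trans (le_of_eq ?_)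
    rw [ENNReal.mul_rpow_of_nonneg _ _ hq0.le, ← ENNReal.rpow_mul, one_div_mul_eq_div]
  have hmem : ∀ f, MemLp (W f) (ENNReal.ofReal q) := fun f ↦
    ⟨(hWm f).aestronglyMeasurable, (hnorm f).trans_lt (ENNReal.mul_lt_top hDt.lt_top (by simp))⟩
  let A₀ : L2 d →ₗ[ℝ] Lp ℂ (ENNReal.ofReal q) (volume : Measure (Rd d)) :=
    { toFun := fun f ↦ (hmem f).toLp
      map_add' := fun f g ↦ by
        rw [← MemLp.toLp_add, MemLp.toLp_eq_toLp_iff]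
        filter_upwards [hfin] with x hx
        simp only [hW, Pi.add_apply, ← Complex.ofReal_add]
        rw [← integral_add (integrable_mul_coeFn (hKx x) hx f) (integrable_mul_coeFn (hKx x) hx g)]
        congr 1
        refine integral_congr_ae ?_
        filter_upwards [Lp.coeFn_add f g] with y hy
        rw [hy, Pi.add_apply, mul_add]
      map_smul' := fun c f ↦ by
        rw [RingHom.id_apply, ← MemLp.toLp_const_smul, MemLp.toLp_eq_toLp_iff]
        refine Eventually.of_forall fun x ↦ ?_
        simp only [hW, Pi.smul_apply, Complex.real_smul, ← Complex.ofReal_mul]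
        rw [← integral_const_mul]
        congr 1
        refine integral_congr_ae ?_
        filter_upwards [Lp.coeFn_smul c f] with y hy
        rw [hy, Pi.smul_apply, smul_eq_mul]
        ring }
  refine ⟨A₀.mkContinuous D.toReal fun f ↦ ?_, fun f ↦ (hmem f).coeFn_toLp⟩
  change ‖(hmem f).toLp‖ ≤ _
  rw [Lp.norm_toLp, ← toReal_enorm f, ← ENNReal.toReal_mul]
  exact ENNReal.toReal_mono (ENNReal.mul_ne_top hDt enorm_ne_top) (hnorm f)

/-- Hölder with `1/η + 1/2`. For `η ≥ 2` the resulting exponent is at least `1`, so `g f` is a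
tempered distribution on which the Bessel operator is a convolution. -/
theorem memLp_mul_coeFn {η : ℝ} (hη : 2 ≤ η) {g : Rd d → ℝ} (hg : MemLp g (ENNReal.ofReal η))
    (f : L2 d) : MemLp (fun x ↦ ((g x * f x : ℝ) : ℂ)) (ENNReal.ofReal ((1 / η + 1 / 2)⁻¹)) := by
  have hη0 : 0 < η := by linarith
  have : ENNReal.HolderTriple (ENNReal.ofReal η) 2 (ENNReal.ofReal ((1 / η + 1 / 2)⁻¹)) := by
    refine ⟨?_⟩
    rw [← ENNReal.ofReal_inv_of_pos hη0,
      ← ENNReal.ofReal_inv_of_pos (x := (1 / η + 1 / 2)⁻¹) (by positivity), inv_inv,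
      ENNReal.ofReal_add (by positivity) (by norm_num), one_div, one_div,
      ENNReal.ofReal_inv_of_pos two_pos, ENNReal.ofReal_ofNat]
  exact ((Lp.memLp f).mul (r := ENNReal.ofReal ((1 / η + 1 / 2)⁻¹)) hg).ofReal

theorem one_le_inv_one_div_add_half {η : ℝ} (hη : 2 ≤ η) : 1 ≤ (1 / η + 1 / 2)⁻¹ := by
  have : 1 / η ≤ 1 / 2 := one_div_le_one_div_of_le two_pos hη
  have h0 : 0 < 1 / η := by positivity
  rw [one_le_inv₀ (by linarith)]
  linarith

theorem integrable_schwartz_mul {p : ℝ} (hp : 1 ≤ p) {u : Rd d → ℂ}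
    (hu : MemLp u (ENNReal.ofReal p)) (φ : 𝓢(Rd d, ℂ)) : Integrable fun x ↦ φ x * u x := by
  have := ENNReal.HolderConjugate.inv_one_sub_inv' (a := ENNReal.ofReal p) (by simpa using hp)
  have h := hu.integrable_mul (q := (1 - (ENNReal.ofReal p)⁻¹)⁻¹) (φ.memLp _ volume)
  refine h.congr (Eventually.of_forall fun x ↦ ?_)
  simp [mul_comm]

/-- The tempered distribution of an `L^p` function. -/
theorem exists_temperedDistribution_eq_integral {p : ℝ} (hp : 1 ≤ p) {u : Rd d → ℂ}
    (hu : MemLp u (ENNReal.ofReal p)) :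
    ∃ U : 𝓢'(Rd d, ℂ), ∀ φ : 𝓢(Rd d, ℂ), U φ = ∫ x, φ x * u x := by
  have : Fact (1 ≤ p) := ⟨hp⟩
  refine ⟨(hu.toLp u : 𝓢'(Rd d, ℂ)), fun φ ↦ ?_⟩
  rw [Lp.toTemperedDistribution_apply]
  refine integral_congr_ae ?_
  filter_upwards [hu.coeFn_toLp] with x hx
  rw [hx, smul_eq_mul]

theorem besselConv_mul_eq (s : ℝ) (g : Rd d → ℝ) (f : L2 d) (x : Rd d) :
    besselConv d s (fun x ↦ ((g x * f x : ℝ) : ℂ)) x =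
      ((∫ y, besselKernel d s (x - y) * g y * f y : ℝ) : ℂ) := by
  rw [besselConv, ← integral_complex_ofReal]
  refine integral_congr_ae (Eventually.of_forall fun y ↦ ?_)
  simp only
  push_cast
  ring

theorem measurable_besselKernel_mul (s : ℝ) {g : Rd d → ℝ} (hg : Measurable g) :
    Measurable (Function.uncurry fun x y : Rd d ↦ besselKernel d s (x - y) * g y) :=
  (measurable_besselKernel.comp measurable_sub).mul (hg.comp measurable_snd)

/-- Multiplication by a function whose square function is in `L^q` as an operator into
`H^{-s,q}`. -/
theorem exists_isMulOperator [Fact (1 ≤ q)] {s η : ℝ} (hs : 0 < s) (hη : 2 ≤ η) {g : Rd d → ℝ}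
    (hgm : Measurable g) (hg : MemLp g (ENNReal.ofReal η))
    (hF : ∫⁻ x, (∫⁻ y, ‖besselKernel d s (x - y) * g y‖ₑ ^ (2 : ℝ)) ^ (q / 2) ≠ ∞) :
    ∃ T : L2 d →L[ℝ] BesselSpace d (-s) q, IsMulOperator g T ∧
      ∀ f, ‖T f‖ₑ ^ q = ∫⁻ x, ‖∫ y, besselKernel d s (x - y) * g y * f y‖ₑ ^ q := by
  obtain ⟨A, hA⟩ := exists_kernelOperator (measurable_besselKernel_mul s hgm) hF
  set e : Lp ℂ (ENNReal.ofReal q) (volume : Measure (Rd d)) →L[ℝ] BesselSpace d (-s) q :=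
    (BesselSpace.toLpEquiv (d := d) (σ := -s)
      (q := q)).symm.toContinuousLinearEquiv.toContinuousLinearMap.restrictScalars ℝ with he
  have heq : ∀ w, e w = BesselSpace.ofLp w := fun w ↦ by
    apply BesselSpace.toLp_injective
    rw [BesselSpace.toLp_ofLp]
    exact (BesselSpace.toLpEquiv (d := d) (σ := -s) (q := q)).apply_symm_apply w
  refine ⟨e ∘L A, fun f φ ↦ ?_, fun f ↦ ?_⟩
  · have hp := one_le_inv_one_div_add_half hη
    have hu := memLp_mul_coeFn hη hg f
    refine ⟨integrable_schwartz_mul hp hu φ, ?_⟩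
    obtain ⟨U, hU⟩ := exists_temperedDistribution_eq_integral hp hu
    -- The kernel operator outputs `(1 - Δ)^{-s/2} (g f)`; the inverse isometry then recovers the
    -- product `g f` itself.
    have hAU : (A f : 𝓢'(Rd d, ℂ)) = besselOp d (-s) U := by
      ext ψ
      rw [besselOp_neg_apply_of_integral hs hp hu hU, Lp.toTemperedDistribution_apply]
      refine integral_congr_ae ?_
      filter_upwards [hA f] with x hx
      rw [hx, besselConv_mul_eq, smul_eq_mul]
    rw [ContinuousLinearMap.comp_apply, heq, BesselSpace.toDistribution_ofLp, hAU,
      besselOp_neg_besselOp, hU]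
  · rw [ContinuousLinearMap.comp_apply, heq, ← ofReal_norm, BesselSpace.norm_eq,
      BesselSpace.toLp_ofLp, ofReal_norm, enorm_lp_rpow_eq]
    refine lintegral_congr_ae ?_
    filter_upwards [hA f] with x hx
    rw [hx, ← ofReal_norm, ← ofReal_norm, Complex.norm_real]

theorem IsMulOperator.congr_ae [Fact (1 ≤ q)] {σ : ℝ} {g g' : Rd d → ℝ} (h : g =ᵐ[volume] g')
    {T : L2 d →L[ℝ] BesselSpace d σ q} (hT : IsMulOperator g' T) : IsMulOperator g T := by
  intro f φ
  have hae : (fun x ↦ φ x * ((g' x * f x : ℝ) : ℂ)) =ᵐ[volume]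
      fun x ↦ φ x * ((g x * f x : ℝ) : ℂ) := by
    filter_upwards [h] with x hx
    rw [hx]
  exact ⟨(hT f φ).1.congr hae, (hT f φ).2.trans (integral_congr_ae hae)⟩

/-- The convolution bound is applied to `|g|²`, whose `L^{η/2}` integral is `‖g‖_η^η`. The constant
combines that bound with the `q`-th Gaussian moment. -/
theorem sufficient_conditions (hd : 1 ≤ d) (s q η : ℝ) [Fact (1 ≤ q)]
    (hc : (d / 2 < s ∧ s < d ∧ 2 < η ∧ η < q ∧ 1 / η + 1 / 2 ≤ s / d + 1 / q) ∨
        (d / 2 < s ∧ η = q ∧ 2 ≤ q) ∨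
        (d / 2 < s ∧ η = 2 ∧ 2 ≤ q ∧ 1 < s / d + 1 / q)) :
    ∃ C : ℝ≥0, ∀ (Ω : Type u) [MeasurableSpace Ω] (P : Measure Ω) [IsProbabilityMeasure P]
      (γ : ℕ → Ω → ℝ) (_ : IsGaussianSequence P γ) (h : HilbertBasis ℕ ℝ (L2 d))
      (g : Rd d → ℝ), MemLp g (ENNReal.ofReal η) volume →
        ∃ T : L2 d →L[ℝ] BesselSpace d (-s) q, IsMulOperator g T ∧
          IsGammaRadonifying P γ h T ∧
          gammaNorm P γ h T ≤ C * eLpNorm g (ENNReal.ofReal η) volume := by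
  have hd' : (0 : ℝ) < d := by exact_mod_cast hd
  have hs : 0 < s := by
    have : (d : ℝ) / 2 < s := by rcases hc with h | h | h <;> exact h.1
    linarith [half_pos hd']
  have hη : 2 ≤ η := by
    rcases hc with ⟨-, -, h, -⟩ | ⟨-, rfl, h⟩ | ⟨-, h, -⟩
    exacts [h.le, h, h.ge]
  have hq : 2 ≤ q := by
    rcases hc with ⟨-, -, h, h', -⟩ | ⟨-, -, h⟩ | ⟨-, -, h, -⟩
    exacts [(h.trans h').le, h, h]
  have hq0 : 0 < q := by linarith
  have hη0 : 0 < η := by linarith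
  obtain ⟨C, hC⟩ := exists_lintegral_besselKernel_sq_conv_le hd hc
  have hM := gaussianMoment_ne_top hq0
  refine ⟨((gaussianMoment q * C) ^ (1 / q)).toNNReal, fun Ω _ P _ γ hγ h g hg ↦ ?_⟩
  rw [ENNReal.coe_toNNReal (ENNReal.rpow_ne_top_of_nonneg (by positivity)
    (ENNReal.mul_ne_top hM ENNReal.coe_ne_top))]
  obtain ⟨g', hg'm, hgg'⟩ := hg.1.aemeasurable
  have hg' : MemLp g' (ENNReal.ofReal η) := hg.ae_eq hgg'
  have hpow : ∫⁻ x, (‖g' x‖ₑ ^ (2 : ℝ)) ^ (η / 2) = eLpNorm g' (ENNReal.ofReal η) ^ η := by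
    simp_rw [← ENNReal.rpow_mul, mul_div_cancel₀ η two_ne_zero]
    exact lintegral_enorm_rpow_eq_eLpNorm_rpow hη0 g'
  have hbound := hC (fun y ↦ ‖g' y‖ₑ ^ (2 : ℝ)) (hg'm.enorm.pow_const _)
    (by rw [hpow]; exact ENNReal.rpow_ne_top_of_nonneg hη0.le hg'.2.ne)
  rw [hpow, ← ENNReal.rpow_mul, mul_div_cancel₀ q hη0.ne'] at hbound
  simp_rw [← ENNReal.mul_rpow_of_nonneg _ _ zero_le_two, ← enorm_mul] at hbound
  have hF : ∫⁻ x, (∫⁻ y, ‖besselKernel d s (x - y) * g' y‖ₑ ^ (2 : ℝ)) ^ (q / 2) ≠ ∞ :=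
    ne_top_of_le_ne_top (ENNReal.mul_ne_top ENNReal.coe_ne_top
      (ENNReal.rpow_ne_top_of_nonneg hq0.le hg'.2.ne)) hbound
  have hfinal : (gaussianMoment q * ∫⁻ x, (∫⁻ y, ‖besselKernel d s (x - y) * g' y‖ₑ ^ (2 : ℝ)) ^
      (q / 2)) ^ (1 / q) ≤
      (gaussianMoment q * C) ^ (1 / q) * eLpNorm g (ENNReal.ofReal η) volume := by
    rw [eLpNorm_congr_ae hgg']
    refine (ENNReal.rpow_le_rpow (mul_le_mul_right hbound _) (by positivity)).trans (le_of_eq ?_)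
    rw [← mul_assoc, ENNReal.mul_rpow_of_nonneg _ _ (by positivity), ← ENNReal.rpow_mul,
      mul_one_div_cancel hq0.ne', ENNReal.rpow_one]
  obtain ⟨T, hT, hTn⟩ := exists_isMulOperator hs hη hg'm hg' hF
  have hγT := isGammaRadonifying_of_kernel hγ h hq
    (measurable_besselKernel_mul s hg'm) hF T fun f ↦ (hTn f).le
  exact ⟨T, hT.congr_ae hgg', hγT.1, hγT.2.trans hfinal⟩

end Sufficiency

/-! ### From `γ`-bounds to square functions of balls. -/

section SquareFunctionBound

variable {d : ℕ} {q : ℝ}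

/-- Passing from order `s` to a larger `s'` convolves with a kernel of mass at most `1`, a
contraction on `L^q`. This freedom is needed because, before `s > d/2` is known, the kernel of order
`s` need not be square integrable, or even available if `s = 0`. -/
theorem IsMulOperator.lintegral_besselKernel_le [Fact (1 ≤ q)] {s s' η : ℝ}
    (hss' : s ≤ s') (hs' : 0 < s') (hη : 2 ≤ η) {g : Rd d → ℝ} (hg : MemLp g (ENNReal.ofReal η))
    {T : L2 d →L[ℝ] BesselSpace d (-s) q} (hT : IsMulOperator g T) (f : L2 d) :
    ∫⁻ x, ‖∫ y, besselKernel d s' (x - y) * g y * f y‖ₑ ^ q ≤ ‖T f‖ₑ ^ q := by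
  have hq1 : 1 ≤ q := Fact.out
  have hq0 : 0 < q := by linarith
  have hp := one_le_inv_one_div_add_half hη
  have hu := memLp_mul_coeFn hη hg f
  set u : Rd d → ℂ := fun x ↦ ((g x * f x : ℝ) : ℂ) with hudef
  set w := BesselSpace.toLp (T f) with hw
  have hD := fun φ ↦ (hT f φ).2
  have hwD : (w : 𝓢'(Rd d, ℂ)) = besselOp d (-s) (T f).toDistribution := BesselSpace.toLp_spec (T f)
  have hconv : ∀ x, ‖∫ y, besselKernel d s' (x - y) * g y * f y‖ₑ = ‖besselConv d s' u x‖ₑ :=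
    fun x ↦ by rw [hudef, besselConv_mul_eq, ← ofReal_norm, ← ofReal_norm, Complex.norm_real]
  have hloc : LocallyIntegrable (besselConv d s' u) :=
    (hu.besselConv hs' hp).locallyIntegrable (by simpa using hp)
  have hTf : ‖T f‖ₑ = eLpNorm w (ENNReal.ofReal q) := by
    rw [← Lp.enorm_def, ← ofReal_norm, BesselSpace.norm_eq, ofReal_norm]
  simp_rw [hconv]
  rw [lintegral_enorm_rpow_eq_eLpNorm_rpow hq0, hTf]
  refine ENNReal.rpow_le_rpow ?_ hq0.le
  rcases hss'.eq_or_lt with rfl | hlt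
  · have hae : besselConv d s u =ᵐ[volume] w := by
      refine ae_eq_of_integral_schwartz_eq hloc
        ((Lp.memLp w).locallyIntegrable (by simpa using hq1)) fun φ ↦ ?_
      rw [← besselOp_neg_apply_of_integral hs' hp hu hD φ, ← hwD, Lp.toTemperedDistribution_apply]
      simp
    exact (eLpNorm_congr_ae hae).le
  · have hr : 0 < s' - s := by linarith
    have hae : besselConv d s' u =ᵐ[volume] besselConv d (s' - s) w := by
      refine ae_eq_of_integral_schwartz_eq hloc
        (((Lp.memLp w).besselConv hr hq1).locallyIntegrable (by simpa using hq1)) fun φ ↦ ?_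
      rw [← besselOp_neg_apply_of_integral hs' hp hu hD φ,
        ← besselOp_neg_toTemperedDistribution hr hq1, hwD, besselOp_add]
      rw [show -s + -(s' - s) = -s' by ring]
    rw [eLpNorm_congr_ae hae]
    exact eLpNorm_besselConv_le hr hq1 (Lp.memLp w).1

theorem volume_ball_eq (hd : 1 ≤ d) (x : Rd d) {R : ℝ} (hR : 0 ≤ R) :
    volume (Metric.ball x R) =
      ENNReal.ofReal (R ^ (d : ℝ)) * volume (Metric.ball (0 : Rd d) 1) := by
  have : Nonempty (Fin d) := ⟨⟨0, hd⟩⟩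
  rw [Measure.addHaar_ball _ _ hR, finrank_euclideanSpace_fin, Real.rpow_natCast]

/-- A `γ`-radonifying bound on all multiplication operators bounds the square functions of
indicators of balls. -/
theorem exists_lintegral_ball_le {Ω : Type u} [MeasurableSpace Ω] {P : Measure Ω}
    [IsProbabilityMeasure P] {γ : ℕ → Ω → ℝ} (hγ : IsGaussianSequence P γ)
    (h : HilbertBasis ℕ ℝ (L2 d)) (hd : 1 ≤ d) [Fact (1 ≤ q)] {s η : ℝ}
    (hη : 2 ≤ η) {C : ℝ≥0} (hC : ∀ g : Rd d → ℝ, MemLp g (ENNReal.ofReal η) volume →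
      ∃ T : L2 d →L[ℝ] BesselSpace d (-s) q, IsMulOperator g T ∧
        IsGammaRadonifying P γ h T ∧
        gammaNorm P γ h T ≤ C * eLpNorm g (ENNReal.ofReal η) volume) :
    ∃ C' : ℝ≥0∞, C' ≠ ∞ ∧ ∀ s' : ℝ, s ≤ s' → (d : ℝ) / 2 < s' → ∀ R : ℝ, 0 < R →
      ∫⁻ x, (∫⁻ y in Metric.ball (0 : Rd d) R, ‖besselKernel d s' (x - y)‖ₑ ^ (2 : ℝ)) ^ (q / 2) ≤
        C' * ENNReal.ofReal (R ^ (d * q / η)) := by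
  have hq1 : 1 ≤ q := Fact.out
  have hq0 : 0 < q := by linarith
  have hη0 : 0 < η := by linarith
  have hd' : (0 : ℝ) < d := by exact_mod_cast hd
  have hm0 : gaussianMoment 1 ^ q ≠ 0 := by
    simp [gaussianMoment_ne_zero one_pos, not_lt.2 hq0.le]
  have hmt : gaussianMoment 1 ^ q ≠ ∞ :=
    ENNReal.rpow_ne_top_of_nonneg hq0.le (gaussianMoment_ne_top one_pos)
  have hV : volume (Metric.ball (0 : Rd d) 1) ≠ ∞ := measure_ball_lt_top.ne
  -- The constant depends neither on `R` nor on `s'`; the latter permits the limit `s' ↓ d/2` later.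
  refine ⟨(gaussianMoment 1 ^ q)⁻¹ * (C * volume (Metric.ball (0 : Rd d) 1) ^ (1 / η)) ^ q, ?_,
    fun s' hss' hs' R hR ↦ ?_⟩
  · exact ENNReal.mul_ne_top (ENNReal.inv_ne_top.2 hm0) (ENNReal.rpow_ne_top_of_nonneg hq0.le
      (ENNReal.mul_ne_top ENNReal.coe_ne_top (ENNReal.rpow_ne_top_of_nonneg (by positivity) hV)))
  have hs'0 : 0 < s' := lt_trans (by positivity) hs'
  set g : Rd d → ℝ := (Metric.ball (0 : Rd d) R).indicator fun _ ↦ 1 with hg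
  have hgm : Measurable g := measurable_const.indicator measurableSet_ball
  have hgL : MemLp g (ENNReal.ofReal η) :=
    memLp_indicator_const _ measurableSet_ball _ (Or.inr measure_ball_lt_top.ne)
  have hgn : eLpNorm g (ENNReal.ofReal η) = volume (Metric.ball (0 : Rd d) R) ^ (1 / η) := by
    rw [hg, eLpNorm_indicator_const measurableSet_ball (by simpa using hη0) ENNReal.ofReal_ne_top,
      ENNReal.toReal_ofReal hη0.le]
    simp
  have hsq : ∀ x, ∫⁻ y, ‖besselKernel d s' (x - y) * g y‖ₑ ^ (2 : ℝ) =
      ∫⁻ y in Metric.ball (0 : Rd d) R, ‖besselKernel d s' (x - y)‖ₑ ^ (2 : ℝ) := by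
    intro x
    rw [← lintegral_indicator measurableSet_ball]
    refine lintegral_congr fun y ↦ ?_
    by_cases hy : y ∈ Metric.ball (0 : Rd d) R
    · rw [hg, Set.indicator_of_mem hy, Set.indicator_of_mem hy, mul_one]
    · rw [hg, Set.indicator_of_notMem hy, Set.indicator_of_notMem hy, mul_zero, enorm_zero,
        ENNReal.zero_rpow_of_pos two_pos]
  have hfin : ∀ x, ∫⁻ y, ‖besselKernel d s' (x - y) * g y‖ₑ ^ (2 : ℝ) ≠ ∞ := by
    intro x
    rw [hsq]
    refine ne_top_of_le_ne_top ?_ (setLIntegral_le_lintegral _ _)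
    rw [lintegral_sub_left_eq_self (fun z ↦ ‖besselKernel d s' z‖ₑ ^ (2 : ℝ)) x]
    exact (lintegral_besselKernel_rpow_lt_top hs'0 one_le_two (by linarith)).ne
  obtain ⟨T, hT, -, hTn⟩ := hC g hgL
  have hmain := lintegral_square_function_le_gammaNorm hγ h hq1
    (measurable_besselKernel_mul s' hgm) (Eventually.of_forall hfin) T
    fun f ↦ hT.lintegral_besselKernel_le hss' hs'0 hη hgL f
  simp_rw [hsq] at hmain
  rw [mul_comm, ← ENNReal.le_div_iff_mul_le (Or.inl hm0) (Or.inl hmt)] at hmain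
  refine hmain.trans ?_
  rw [ENNReal.div_eq_inv_mul, mul_assoc]
  refine mul_le_mul_right ((ENNReal.rpow_le_rpow hTn hq0.le).trans (le_of_eq ?_)) _
  rw [hgn, volume_ball_eq hd _ hR.le,
    ENNReal.mul_rpow_of_nonneg (ENNReal.ofReal _) _ (by positivity : 0 ≤ 1 / η),
    ENNReal.ofReal_rpow_of_nonneg (by positivity) (by positivity), ← Real.rpow_mul hR.le,
    mul_comm (ENNReal.ofReal _), ← mul_assoc, ENNReal.mul_rpow_of_nonneg _ _ hq0.le,
    ENNReal.ofReal_rpow_of_nonneg (by positivity) hq0.le, ← Real.rpow_mul hR.le]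
  congr 3
  ring

end SquareFunctionBound

/-! ### Tools for testing on balls. -/

section Necessity

variable {d : ℕ} {q : ℝ}

/-- Divide by `R^β` and let `R → ∞`. Small radii are handled through `R⁻¹`. -/
theorem le_of_forall_mul_rpow_le {a C : ℝ≥0∞} (ha : a ≠ 0) (hC : C ≠ ∞) {α β : ℝ}
    (h : ∀ R : ℝ, 1 ≤ R → a * ENNReal.ofReal (R ^ α) ≤ C * ENNReal.ofReal (R ^ β)) : α ≤ β := by
  by_contra! hlt
  have h1 : ∀ R : ℝ, 1 ≤ R → a * ENNReal.ofReal (R ^ (α - β)) ≤ C := by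
    intro R hR
    have hR0 : 0 < R := by linarith
    have h2 := mul_le_mul_left (h R hR) (ENNReal.ofReal (R ^ (-β)))
    rw [mul_assoc, mul_assoc, ← ENNReal.ofReal_mul (by positivity),
      ← ENNReal.ofReal_mul (by positivity), ← Real.rpow_add hR0, ← Real.rpow_add hR0] at h2
    simpa [sub_eq_add_neg] using h2
  have h2 : Tendsto (fun R : ℝ ↦ a * ENNReal.ofReal (R ^ (α - β))) atTop (𝓝 (a * ∞)) :=
    ENNReal.Tendsto.const_mul (ENNReal.tendsto_ofReal_atTop.comp
      (tendsto_rpow_atTop (sub_pos.2 hlt))) (Or.inl ENNReal.top_ne_zero)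
  rw [ENNReal.mul_top ha] at h2
  have := le_of_tendsto h2 ((eventually_ge_atTop 1).mono h1)
  exact hC (top_le_iff.1 this)

/-- Polar coordinates reduce this to the divergence of `∫ dt/t` at `0`. -/
theorem lintegral_ball_norm_rpow_neg_eq_top (hd : 1 ≤ d) {ρ : ℝ} (hρ : 0 < ρ) :
    ∫⁻ x in Metric.ball (0 : Rd d) ρ, ENNReal.ofReal (‖x‖ ^ (-(d : ℝ))) = ∞ := by
  have : Nonempty (Fin d) := ⟨⟨0, hd⟩⟩
  by_contra hne
  have hint : IntegrableOn (fun x : Rd d ↦ ‖x‖ ^ (-(d : ℝ))) (Metric.ball 0 ρ) := by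
    refine ⟨Measurable.aestronglyMeasurable (by fun_prop), ?_⟩
    rw [hasFiniteIntegral_iff_ofReal (Eventually.of_forall fun x ↦ by positivity)]
    exact lt_top_iff_ne_top.2 hne
  rw [integrableOn_fun_norm_addHaar (E := Rd d) volume (f := fun t ↦ t ^ (-(d : ℝ))),
    finrank_euclideanSpace_fin] at hint
  have h2 : IntegrableOn (fun t : ℝ ↦ t ^ (-1 : ℝ)) (Set.Ioo 0 ρ) := by
    refine hint.congr_fun (fun t ht ↦ ?_) measurableSet_Ioo
    simp only [smul_eq_mul]
    rw [← Real.rpow_natCast, ← Real.rpow_add ht.1, Nat.cast_sub hd]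
    congr 1
    push_cast
    ring
  rw [intervalIntegral.integrableOn_Ioo_rpow_iff hρ] at h2
  exact lt_irrefl _ h2

/-- Fatou's lemma; no monotonicity is assumed, so it applies to limits in the order of the kernel.
-/
theorem lintegral_le_of_tendsto {α : Type*} [MeasurableSpace α] {μ : Measure α}
    {f : ℕ → α → ℝ≥0∞} {F : α → ℝ≥0∞} {M : ℝ≥0∞} (hf : ∀ n, Measurable (f n))
    (hM : ∀ n, ∫⁻ x, f n x ∂μ ≤ M)
    (hlim : ∀ᵐ x ∂μ, Tendsto (fun n ↦ f n x) atTop (𝓝 (F x))) : ∫⁻ x, F x ∂μ ≤ M := by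
  calc ∫⁻ x, F x ∂μ = ∫⁻ x, liminf (fun n ↦ f n x) atTop ∂μ :=
        lintegral_congr_ae (hlim.mono fun x hx ↦ hx.liminf_eq.symm)
    _ ≤ liminf (fun n ↦ ∫⁻ x, f n x ∂μ) atTop := lintegral_liminf_le hf
    _ ≤ M := by
        refine liminf_le_of_frequently_le' (Frequently.of_forall hM)

theorem ae_ne_zero (hd : 1 ≤ d) : ∀ᵐ x : Rd d, x ≠ 0 := by
  have : Nonempty (Fin d) := ⟨⟨0, hd⟩⟩
  rw [ae_iff]
  simp

/-- The ball of radius `r` about `x` is contained in the ball of radius `R` about `0`; substitute `z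
= x - y`. -/
theorem setLIntegral_ball_le_sub {k : Rd d → ℝ≥0∞} {r R : ℝ} {x : Rd d} (hx : ‖x‖ + r ≤ R) :
    ∫⁻ z in Metric.ball (0 : Rd d) r, k z ≤ ∫⁻ y in Metric.ball (0 : Rd d) R, k (x - y) := by
  rw [← lintegral_indicator measurableSet_ball, ← lintegral_indicator measurableSet_ball,
    ← lintegral_sub_left_eq_self _ x]
  refine lintegral_mono fun y ↦ ?_
  by_cases hy : x - y ∈ Metric.ball (0 : Rd d) r
  · have hy' : y ∈ Metric.ball (0 : Rd d) R := by
      rw [mem_ball_zero_iff] at hy ⊢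
      calc ‖y‖ = ‖x - (x - y)‖ := by rw [sub_sub_cancel]
        _ ≤ ‖x‖ + ‖x - y‖ := norm_sub_le _ _
        _ < R := by linarith
    rw [Set.indicator_of_mem hy, Set.indicator_of_mem hy']
  · rw [Set.indicator_of_notMem hy]
    exact zero_le

theorem besselKernel_pos {s : ℝ} (hs : 0 < s) {x : Rd d} (hx : x ≠ 0) :
    0 < besselKernel d s x := by
  have hpi := Real.pi_pos
  refine mul_pos (inv_pos.2 (Real.Gamma_pos_of_pos (half_pos hs))) ?_
  rw [setIntegral_pos_iff_support_of_nonneg_ae ((ae_restrict_mem measurableSet_Ioi).mono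
    fun t ht ↦ mul_nonneg (besselWeight_nonneg ht) (heatKernel_nonneg ht x))
    (integrableOn_besselIntegrand hs hx)]
  have hsub : Set.Ioi (0 : ℝ) ⊆ Function.support (fun t ↦ besselWeight s t * heatKernel d t x) ∩
      Set.Ioi 0 := fun t ht ↦ by
    have ht' : 0 < t := ht
    refine ⟨?_, ht⟩
    rw [Function.mem_support, besselWeight, heatKernel]
    positivity
  refine lt_of_lt_of_le ?_ (measure_mono hsub)
  simp

theorem setLIntegral_besselKernel_sq_ne_zero (hd : 1 ≤ d) {s : ℝ} (hs : 0 < s) {r : ℝ}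
    (hr : 0 < r) :
    ∫⁻ z in Metric.ball (0 : Rd d) r, ‖besselKernel d s z‖ₑ ^ (2 : ℝ) ≠ 0 := by
  intro h
  rw [lintegral_eq_zero_iff (measurable_besselKernel.enorm.pow_const _)] at h
  have hF : ∀ᵐ z ∂(volume.restrict (Metric.ball (0 : Rd d) r)), False := by
    filter_upwards [h, ae_restrict_of_ae (ae_ne_zero hd)] with z hz hz0
    have := besselKernel_pos (d := d) hs hz0
    simp [this.ne'] at hz
  rw [eventually_false_iff_eq_bot, ae_eq_bot, Measure.restrict_eq_zero] at hF
  exact (Metric.measure_ball_pos volume (0 : Rd d) hr).ne' hF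

/-- If `F ≥ A` on the ball of radius `ρ`, then the `L^{q/2}` integral of `F` is bounded below. -/
theorem ball_mul_rpow_le_lintegral (hd : 1 ≤ d) {F : Rd d → ℝ≥0∞} {A : ℝ≥0∞} {ρ : ℝ} (hρ : 0 ≤ ρ)
    (hq : 0 ≤ q) (h : ∀ x ∈ Metric.ball (0 : Rd d) ρ, A ≤ F x) :
    A ^ (q / 2) * (ENNReal.ofReal (ρ ^ (d : ℝ)) * volume (Metric.ball (0 : Rd d) 1)) ≤
      ∫⁻ x, F x ^ (q / 2) := by
  rw [← volume_ball_eq hd 0 hρ, ← setLIntegral_const]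
  refine (setLIntegral_mono' measurableSet_ball fun x hx ↦
    ENNReal.rpow_le_rpow (h x hx) (by linarith)).trans (setLIntegral_le_lintegral _ _)

end Necessity

/-! ### The necessary conditions and the critical case. -/

section NecessaryConditions

variable {d : ℕ} {s q η : ℝ} {C : ℝ≥0∞}

/-- The constant in the lower bound `besselKernel d s x ≥ c * ‖x‖ ^ (s - d)` near the origin. -/
noncomputable def besselLowerConst (d : ℕ) (s : ℝ) : ℝ :=
  (Real.Gamma (s / 2))⁻¹ * ((4 * Real.pi) ^ (-((d : ℝ) / 2)) * Real.exp (-2) *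
    Real.exp (-(1 / 4)) * 2 ^ ((s - d) / 2 - 1))

theorem besselLowerConst_pos (hs : 0 < s) : 0 < besselLowerConst d s := by
  have := Real.Gamma_pos_of_pos (half_pos hs)
  have := Real.pi_pos
  rw [besselLowerConst]
  positivity

theorem continuousAt_besselLowerConst (hs : 0 < s) : ContinuousAt (besselLowerConst d) s := by
  have h1 : ContinuousAt (fun t : ℝ ↦ Real.Gamma (t / 2)) s :=
    ContinuousAt.comp (f := fun t : ℝ ↦ t / 2)
      (Real.differentiableAt_Gamma fun m ↦ by
        have : (0 : ℝ) ≤ m := m.cast_nonneg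
        linarith).continuousAt (by fun_prop)
  have h2 : ContinuousAt (fun t : ℝ ↦ (2 : ℝ) ^ ((t - d) / 2 - 1)) s :=
    (Real.continuous_const_rpow two_ne_zero).continuousAt.comp
      (f := fun t : ℝ ↦ (t - d) / 2 - 1) (by fun_prop)
  exact (h1.inv₀ (Real.Gamma_pos_of_pos (half_pos hs)).ne').mul (continuousAt_const.mul h2)

theorem ofReal_le_enorm_besselKernel (hs : 0 < s) (hsd : s ≤ d) {x : Rd d} (hx : x ≠ 0)
    (hx1 : ‖x‖ ≤ 1) :
    ENNReal.ofReal (besselLowerConst d s * ‖x‖ ^ (s - d)) ≤ ‖besselKernel d s x‖ₑ := by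
  rw [Real.enorm_of_nonneg (besselKernel_nonneg hs _)]
  exact ENNReal.ofReal_le_ofReal (le_besselKernel hs hsd hx hx1)

/-- As `s ≤ d`, the power `|x - y|^{s-d}` is smallest at the largest distance, so it may be replaced
by `ρ^{s-d}` on the whole ball. -/
theorem ofReal_le_setLIntegral_besselKernel_sq (hd : 1 ≤ d) (hs : 0 < s) (hsd : s ≤ d)
    {x : Rd d} {R ρ : ℝ} (hR : 0 ≤ R) (hρ : 0 < ρ) (hρ1 : ρ ≤ 1)
    (hx : ∀ y ∈ Metric.ball (0 : Rd d) R, ‖x - y‖ ≤ ρ) :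
    ENNReal.ofReal ((besselLowerConst d s * ρ ^ (s - d)) ^ (2 : ℝ) *
        (R ^ (d : ℝ) * volume.real (Metric.ball (0 : Rd d) 1))) ≤
      ∫⁻ y in Metric.ball (0 : Rd d) R, ‖besselKernel d s (x - y)‖ₑ ^ (2 : ℝ) := by
  have : Nonempty (Fin d) := ⟨⟨0, hd⟩⟩
  have hc := besselLowerConst_pos (d := d) hs
  rw [ENNReal.ofReal_mul (by positivity), ENNReal.ofReal_mul (by positivity),
    ofReal_measureReal measure_ball_lt_top.ne, ← volume_ball_eq hd 0 hR, ← setLIntegral_const,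
    ← ENNReal.ofReal_rpow_of_nonneg (by positivity) two_pos.le]
  refine lintegral_mono_ae ?_
  have hne : ∀ᵐ y : Rd d, y ≠ x := by
    rw [ae_iff]
    simp
  filter_upwards [ae_restrict_mem measurableSet_ball, ae_restrict_of_ae hne] with y hy hyx
  refine ENNReal.rpow_le_rpow (le_trans (ENNReal.ofReal_le_ofReal ?_)
    (ofReal_le_enorm_besselKernel hs hsd (sub_ne_zero.2 hyx.symm) ((hx y hy).trans hρ1))) two_pos.le
  refine mul_le_mul_of_nonneg_left ?_ hc.le
  exact Real.rpow_le_rpow_of_nonpos (norm_pos_iff.2 (sub_ne_zero.2 hyx.symm)) (hx y hy)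
    (by linarith)

/-- If `s ≤ d/2`, every order `s'` above `d/2` is admissible with the same bound, so the `L²` mass
of its kernel near `0` stays bounded as `s' ↓ d/2`. Fatou and the lower bound `|z|^{s'-d}` would
make `|z|^{-d}` integrable. -/
theorem half_lt_of_lintegral_ball_le (hd : 1 ≤ d) (hq : 0 < q) (hC : C ≠ ∞)
    (h : ∀ s' : ℝ, s ≤ s' → (d : ℝ) / 2 < s' →
      ∫⁻ x, (∫⁻ y in Metric.ball (0 : Rd d) 1, ‖besselKernel d s' (x - y)‖ₑ ^ (2 : ℝ)) ^ (q / 2) ≤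
        C) :
    (d : ℝ) / 2 < s := by
  by_contra! hs
  have hd' : (1 : ℝ) ≤ d := by exact_mod_cast hd
  have : Nonempty (Fin d) := ⟨⟨0, hd⟩⟩
  -- The increment is at most `1/2`, so `d ≥ 1` keeps these orders at most `d`, where the lower
  -- kernel bound applies.
  set σ : ℕ → ℝ := fun n ↦ d / 2 + 1 / 2 * (1 / ((n : ℝ) + 1)) with hσ
  have hσ1 : ∀ n, (d : ℝ) / 2 < σ n := fun n ↦ by
    have : (0 : ℝ) < 1 / 2 * (1 / ((n : ℝ) + 1)) := by positivity
    simp only [hσ]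
    linarith
  have hσ2 : ∀ n, σ n ≤ d := fun n ↦ by
    have h1 : (1 : ℝ) / ((n : ℝ) + 1) ≤ 1 := by
      rw [div_le_one (by positivity)]
      linarith [(n.cast_nonneg : (0 : ℝ) ≤ n)]
    simp only [hσ]
    linarith
  have hσ0 : ∀ n, 0 < σ n := fun n ↦ by linarith [hσ1 n]
  have hσlim : Tendsto σ atTop (𝓝 (d / 2)) := by
    have := (tendsto_one_div_add_atTop_nhds_zero_nat (𝕜 := ℝ)).const_mul (1 / 2 : ℝ)
    simpa [hσ] using this.const_add ((d : ℝ) / 2)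
  set W : ℝ≥0∞ := ENNReal.ofReal ((1 / 2 : ℝ) ^ (d : ℝ)) * volume (Metric.ball (0 : Rd d) 1)
  have hW0 : W ≠ 0 := mul_ne_zero (by simp)
    (Metric.measure_ball_pos volume (0 : Rd d) one_pos).ne'
  have hWt : W ≠ ∞ := ENNReal.mul_ne_top ENNReal.ofReal_ne_top measure_ball_lt_top.ne
  have hκ : ∀ n, ∫⁻ z in Metric.ball (0 : Rd d) (1 / 2), ‖besselKernel d (σ n) z‖ₑ ^ (2 : ℝ) ≤
      (C / W) ^ (2 / q) := by
    intro n
    have h1 := (ball_mul_rpow_le_lintegral hd (ρ := 1 / 2) (by norm_num) hq.le fun x hx ↦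
      setLIntegral_ball_le_sub (k := fun z ↦ ‖besselKernel d (σ n) z‖ₑ ^ (2 : ℝ)) (r := 1 / 2)
        (R := 1) (by rw [mem_ball_zero_iff] at hx; linarith)).trans
      (h (σ n) (hs.trans (hσ1 n).le) (hσ1 n))
    rw [← ENNReal.le_div_iff_mul_le (Or.inl hW0) (Or.inl hWt)] at h1
    have h2 := ENNReal.rpow_le_rpow h1 (by positivity : 0 ≤ 2 / q)
    rwa [← ENNReal.rpow_mul, show q / 2 * (2 / q) = 1 by field_simp, ENNReal.rpow_one] at h2
  have hlim := lintegral_le_of_tendsto (μ := volume.restrict (Metric.ball (0 : Rd d) (1 / 2)))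
    (f := fun n z ↦ ENNReal.ofReal (besselLowerConst d (σ n) * ‖z‖ ^ (σ n - d)) ^ (2 : ℝ))
    (F := fun z ↦ ENNReal.ofReal (besselLowerConst d (d / 2) * ‖z‖ ^ ((d : ℝ) / 2 - d)) ^ (2 : ℝ))
    (fun n ↦ by fun_prop) (M := (C / W) ^ (2 / q))
    (fun n ↦ le_trans (lintegral_mono_ae ?_) (hκ n)) ?_
  · have hc := besselLowerConst_pos (d := d) (s := d / 2) (by linarith)
    have heq : ∀ z : Rd d,
        ENNReal.ofReal (besselLowerConst d (d / 2) * ‖z‖ ^ ((d : ℝ) / 2 - d)) ^ (2 : ℝ) =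
        ENNReal.ofReal (besselLowerConst d (d / 2) ^ (2 : ℝ)) *
          ENNReal.ofReal (‖z‖ ^ (-(d : ℝ))) := by
      intro z
      rw [ENNReal.ofReal_rpow_of_nonneg (by positivity) two_pos.le,
        Real.mul_rpow hc.le (by positivity), ENNReal.ofReal_mul (by positivity),
        ← Real.rpow_mul (norm_nonneg _)]
      congr 3
      ring
    simp_rw [heq] at hlim
    rw [lintegral_const_mul' _ _ ENNReal.ofReal_ne_top,
      lintegral_ball_norm_rpow_neg_eq_top hd (by norm_num), ENNReal.mul_top (by simp; positivity),
      top_le_iff] at hlim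
    exact ENNReal.rpow_ne_top_of_nonneg (by positivity) (ENNReal.div_ne_top hC hW0) hlim
  · filter_upwards [ae_restrict_mem measurableSet_ball, ae_restrict_of_ae (ae_ne_zero hd)]
      with z hz hz0
    rw [mem_ball_zero_iff] at hz
    exact ENNReal.rpow_le_rpow
      (ofReal_le_enorm_besselKernel (hσ0 n) (hσ2 n) hz0 (by linarith)) two_pos.le
  · filter_upwards [ae_restrict_of_ae (ae_ne_zero hd)] with z hz0
    refine (ENNReal.continuous_rpow_const.tendsto _).comp
      ((ENNReal.continuous_ofReal.tendsto _).comp (Tendsto.mul ?_ ?_))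
    · exact (continuousAt_besselLowerConst (by linarith)).tendsto.comp hσlim
    · exact ((Real.continuous_const_rpow (norm_ne_zero_iff.2 hz0)).tendsto _).comp
        (hσlim.sub_const _)

/-- For `R ≥ 1` and `|x| < R/2` the inner integral is at least a fixed positive constant, so `R^d ≲
R^{dq/η}`; let `R → ∞`. -/
theorem exponent_le_of_lintegral_ball_le (hd : 1 ≤ d) (hs : 0 < s) (hq : 0 < q) (hη : 0 < η)
    (hC : C ≠ ∞)
    (h : ∀ R : ℝ, 0 < R →
      ∫⁻ x, (∫⁻ y in Metric.ball (0 : Rd d) R, ‖besselKernel d s (x - y)‖ₑ ^ (2 : ℝ)) ^ (q / 2) ≤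
        C * ENNReal.ofReal (R ^ (d * q / η))) :
    η ≤ q := by
  have hd' : (0 : ℝ) < d := by exact_mod_cast hd
  have : Nonempty (Fin d) := ⟨⟨0, hd⟩⟩
  set κ := ∫⁻ z in Metric.ball (0 : Rd d) (1 / 2), ‖besselKernel d s z‖ₑ ^ (2 : ℝ) with hκ
  have hκ0 : κ ≠ 0 := setLIntegral_besselKernel_sq_ne_zero hd hs (by norm_num)
  have hle : (d : ℝ) ≤ d * q / η := by
    refine le_of_forall_mul_rpow_le (C := C)
      (a := κ ^ (q / 2) * (ENNReal.ofReal ((1 / 2) ^ (d : ℝ)) *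
        volume (Metric.ball (0 : Rd d) 1))) ?_ hC fun R hR ↦ ?_
    · refine mul_ne_zero ?_ (mul_ne_zero (by simp)
        (Metric.measure_ball_pos volume (0 : Rd d) one_pos).ne')
      simp only [ne_eq, ENNReal.rpow_eq_zero_iff, hκ0, false_and, false_or, not_and, not_lt]
      intro _
      positivity
    · refine le_trans (le_of_eq ?_) ((ball_mul_rpow_le_lintegral hd (ρ := R / 2) (by linarith) hq.le
        fun x hx ↦ setLIntegral_ball_le_sub (k := fun z ↦ ‖besselKernel d s z‖ₑ ^ (2 : ℝ))
          (r := 1 / 2) (R := R) (by rw [mem_ball_zero_iff] at hx; linarith)).trans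
          (h R (by linarith)))
      rw [← hκ, div_eq_mul_one_div R 2, Real.mul_rpow (by linarith) (by norm_num),
        ENNReal.ofReal_mul (by positivity)]
      ring
  rw [le_div_iff₀ hη] at hle
  exact le_of_mul_le_mul_left hle hd'

/-- For `s ≤ d` and `|x| < R ≤ 1/2` the inner integral is `≳ R^{2(s-d)+d}`, so `R^{(s-d)q + dq/2 +
d} ≲ R^{dq/η}`; let `R → 0`. For `s ≥ d` the conclusion follows from `1/η ≤ 1/2`. -/
theorem scaling_le_of_lintegral_ball_le (hd : 1 ≤ d) (hs : 0 < s) (hq : 0 < q) (hη : 2 ≤ η)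
    (hC : C ≠ ∞)
    (h : ∀ R : ℝ, 0 < R →
      ∫⁻ x, (∫⁻ y in Metric.ball (0 : Rd d) R, ‖besselKernel d s (x - y)‖ₑ ^ (2 : ℝ)) ^ (q / 2) ≤
        C * ENNReal.ofReal (R ^ (d * q / η))) :
    1 / η + 1 / 2 ≤ s / d + 1 / q := by
  have hd' : (0 : ℝ) < d := by exact_mod_cast hd
  have hη0 : 0 < η := by linarith
  have : Nonempty (Fin d) := ⟨⟨0, hd⟩⟩
  rcases le_total (d : ℝ) s with hds | hsd
  · have h1 : 1 / η ≤ 1 / 2 := one_div_le_one_div_of_le two_pos hη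
    have h2 : 1 ≤ s / d := (one_le_div hd').2 hds
    have h3 : 0 < 1 / q := by positivity
    linarith
  have hc := besselLowerConst_pos (d := d) hs
  set c := besselLowerConst d s
  set v := volume.real (Metric.ball (0 : Rd d) 1) with hv
  have hv0 : 0 < v := ENNReal.toReal_pos
    (Metric.measure_ball_pos volume (0 : Rd d) one_pos).ne' measure_ball_lt_top.ne
  have hle : (d - s) * q - d * q / 2 - d ≤ -(d * q / η) := by
    refine le_of_forall_mul_rpow_le (C := C * ENNReal.ofReal ((1 / 2) ^ (d * q / η)))
      (a := ENNReal.ofReal ((c ^ (2 : ℝ) * ((1 / 2) ^ (d : ℝ) * v)) ^ (q / 2) *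
        ((1 / 2) ^ (d : ℝ) * v))) ?_ (ENNReal.mul_ne_top hC ENNReal.ofReal_ne_top) fun r hr ↦ ?_
    · simp
      positivity
    have hr0 : 0 < r := by linarith
    have hri : r⁻¹ ≤ 1 := inv_le_one_of_one_le₀ hr
    -- With both radii equal to `1/(2r)`, distances between points of the two balls are at most `1/r
    -- ≤ 1`.
    have h1 := (ball_mul_rpow_le_lintegral hd (ρ := 1 / 2 * r⁻¹) (by positivity) hq.le fun x hx ↦
      ofReal_le_setLIntegral_besselKernel_sq hd hs hsd (x := x) (R := 1 / 2 * r⁻¹) (ρ := r⁻¹)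
        (by positivity) (by positivity) hri fun y hy ↦ by
          rw [mem_ball_zero_iff] at hx hy
          linarith [norm_sub_le x y]).trans (h (1 / 2 * r⁻¹) (by positivity))
    rw [← ofReal_measureReal (measure_ball_lt_top (μ := volume) (x := (0 : Rd d)) (r := 1)).ne,
      ← ENNReal.ofReal_mul (by positivity), ← hv,
      ENNReal.ofReal_rpow_of_nonneg (by positivity) (by positivity),
      ← ENNReal.ofReal_mul (by positivity)] at h1
    rw [← ENNReal.ofReal_mul (by positivity), mul_assoc C, ← ENNReal.ofReal_mul (by positivity)]
    have hp : ∀ a : ℝ, r⁻¹ ^ a = r ^ (-a) := fun a ↦ by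
      rw [Real.inv_rpow hr0.le, Real.rpow_neg hr0.le]
    have e0 : ∀ a : ℝ, (1 / 2 * r⁻¹) ^ a = (1 / 2) ^ a * r ^ (-a) := fun a ↦ by
      rw [Real.mul_rpow (by norm_num) (by positivity), hp]
    have e1 : (c * r⁻¹ ^ (s - d)) ^ (2 : ℝ) * ((1 / 2 * r⁻¹) ^ (d : ℝ) * v) =
        c ^ (2 : ℝ) * ((1 / 2) ^ (d : ℝ) * v) * r ^ (-(s - d) * 2 - d) := by
      rw [Real.mul_rpow hc.le (by positivity), hp, ← Real.rpow_mul hr0.le, e0,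
        sub_eq_add_neg (-(s - d) * 2) (d : ℝ), Real.rpow_add hr0]
      ring
    have e2 : (d - s) * q - d * q / 2 - d = (-(s - d) * 2 - d) * (q / 2) + -(d : ℝ) := by ring
    refine (ENNReal.ofReal_le_ofReal (le_of_eq ?_)).trans
      (h1.trans (mul_le_mul_right (ENNReal.ofReal_le_ofReal (e0 _).le) _))
    change _ = ((c * r⁻¹ ^ (s - d)) ^ (2 : ℝ) * ((1 / 2 * r⁻¹) ^ (d : ℝ) * v)) ^ (q / 2) *
      ((1 / 2 * r⁻¹) ^ (d : ℝ) * v)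
    rw [e1, Real.mul_rpow (y := r ^ _) (by positivity) (by positivity), ← Real.rpow_mul hr0.le,
      e2, Real.rpow_add hr0, e0]
    ring
  have e : s / d + 1 / q - (1 / η + 1 / 2) =
      (-(d * q / η) - ((d - s) * q - d * q / 2 - d)) / (d * q) := by
    field_simp
    ring
  have h3 : 0 ≤ s / d + 1 / q - (1 / η + 1 / 2) := by
    rw [e]
    exact div_nonneg (by linarith) (by positivity)
  linarith

/-- At the critical exponents the embedding fails for `η = 2`. -/
theorem not_lintegral_ball_le (hd : 1 ≤ d) (hs : 0 < s) (hsd : s ≤ d) (hq : 0 < q)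
    (hsq : (s - d) * q = -d) (hC : C ≠ ∞)
    (h : ∀ R : ℝ, 0 < R →
      ∫⁻ x, (∫⁻ y in Metric.ball (0 : Rd d) R, ‖besselKernel d s (x - y)‖ₑ ^ (2 : ℝ)) ^ (q / 2) ≤
        C * ENNReal.ofReal (R ^ (d * q / 2))) : False := by
  have hd' : (0 : ℝ) < d := by exact_mod_cast hd
  have : Nonempty (Fin d) := ⟨⟨0, hd⟩⟩
  have hc := besselLowerConst_pos (d := d) hs
  set c := besselLowerConst d s
  set v := volume.real (Metric.ball (0 : Rd d) 1) with hv
  have hv0 : 0 < v := ENNReal.toReal_pos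
    (Metric.measure_ball_pos volume (0 : Rd d) one_pos).ne' measure_ball_lt_top.ne
  set K : ℝ := c ^ q * v ^ (q / 2) * 2 ^ (-(d : ℝ)) with hK
  have hK0 : 0 < K := by positivity
  have hKE : ENNReal.ofReal K ≠ 0 := by simpa using hK0
  -- For `ε ≤ |x| < 1/2` and `|y| < ε` one has `|x - y| ≤ 2|x| ≤ 1`. The left side is then `≳
  -- |x|^{(s-d)q} ε^{dq/2} = |x|^{-d} ε^{dq/2}`, and the power of `ε` cancels against the right
  -- side, which leaves a bound uniform in `ε`.
  have hstep : ∀ ε : ℝ, 0 < ε →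
      ∫⁻ x in Metric.ball (0 : Rd d) (1 / 2),
        (Metric.ball (0 : Rd d) ε)ᶜ.indicator (fun x ↦ ENNReal.ofReal (‖x‖ ^ (-(d : ℝ)))) x ≤
      C / ENNReal.ofReal K := by
    intro ε hε
    have hpow : ENNReal.ofReal (ε ^ (d * q / 2)) ≠ 0 := by simp; positivity
    rw [ENNReal.le_div_iff_mul_le (Or.inl hKE) (Or.inl ENNReal.ofReal_ne_top),
      ← ENNReal.mul_le_mul_iff_left hpow ENNReal.ofReal_ne_top]
    refine le_trans ?_ (h ε hε)
    rw [mul_assoc, ← ENNReal.ofReal_mul hK0.le, ← lintegral_mul_const' _ _ ENNReal.ofReal_ne_top]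
    refine le_trans (setLIntegral_mono' measurableSet_ball fun x hx ↦ ?_)
      (setLIntegral_le_lintegral _ _)
    by_cases hxε : x ∈ (Metric.ball (0 : Rd d) ε)ᶜ
    · rw [Set.indicator_of_mem hxε]
      rw [Set.mem_compl_iff, mem_ball_zero_iff, not_lt] at hxε
      rw [mem_ball_zero_iff] at hx
      have hx0 : 0 < ‖x‖ := by linarith
      have h1 := ENNReal.rpow_le_rpow (ofReal_le_setLIntegral_besselKernel_sq hd hs hsd (x := x)
        (R := ε) (ρ := 2 * ‖x‖) hε.le (by positivity) (by linarith) fun y hy ↦ by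
          rw [mem_ball_zero_iff] at hy
          linarith [norm_sub_le x y]) (by positivity : 0 ≤ q / 2)
      rw [ENNReal.ofReal_rpow_of_nonneg (by positivity) (by positivity)] at h1
      refine le_trans (le_of_eq ?_) h1
      rw [← ENNReal.ofReal_mul (by positivity)]
      congr 1
      rw [Real.mul_rpow (by positivity) (by positivity), ← Real.rpow_mul (by positivity),
        Real.mul_rpow (by positivity) hv0.le, ← Real.rpow_mul hε.le,
        show 2 * (q / 2) = q by ring, Real.mul_rpow hc.le (by positivity),
        ← Real.rpow_mul (by positivity), hsq, Real.mul_rpow two_pos.le hx0.le, hK,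
        show (d : ℝ) * (q / 2) = d * q / 2 by ring]
      ring
    · rw [Set.indicator_of_notMem hxε, zero_mul]
      exact zero_le
  have hlim := lintegral_le_of_tendsto (μ := volume.restrict (Metric.ball (0 : Rd d) (1 / 2)))
    (f := fun (n : ℕ) x ↦ (Metric.ball (0 : Rd d) (1 / ((n : ℝ) + 1)))ᶜ.indicator
      (fun x ↦ ENNReal.ofReal (‖x‖ ^ (-(d : ℝ)))) x)
    (F := fun x ↦ ENNReal.ofReal (‖x‖ ^ (-(d : ℝ))))
    (fun n ↦ Measurable.indicator (by fun_prop) measurableSet_ball.compl)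
    (fun n ↦ hstep _ (by positivity)) ?_
  · rw [lintegral_ball_norm_rpow_neg_eq_top hd (by norm_num), top_le_iff] at hlim
    exact ENNReal.div_ne_top hC hKE hlim
  · filter_upwards [ae_restrict_of_ae (ae_ne_zero hd)] with x hx
    refine tendsto_const_nhds.congr' ?_
    filter_upwards [(tendsto_one_div_add_atTop_nhds_zero_nat (𝕜 := ℝ)).eventually_lt_const
      (norm_pos_iff.2 hx)] with n hn
    rw [Set.indicator_of_mem]
    rw [Set.mem_compl_iff, mem_ball_zero_iff, not_lt]
    exact hn.le

end NecessaryConditions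

/-- The bound `s > d/2` comes first, from orders `s' ≥ s`; only then may the ball estimate be used
with the order `s` itself. -/
theorem necessary_conditions {d : ℕ} (hd : 1 ≤ d) {s q η : ℝ} [Fact (1 ≤ q)] (hη : 2 ≤ η)
    (hq : 2 ≤ q) {Ω : Type u} [MeasurableSpace Ω] {P : Measure Ω} [IsProbabilityMeasure P]
    {γ : ℕ → Ω → ℝ} (hγ : IsGaussianSequence P γ) (h : HilbertBasis ℕ ℝ (L2 d)) {C : ℝ≥0}
    (hC : ∀ g : Rd d → ℝ, MemLp g (ENNReal.ofReal η) volume →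
      ∃ T : L2 d →L[ℝ] BesselSpace d (-s) q, IsMulOperator g T ∧
        IsGammaRadonifying P γ h T ∧
        gammaNorm P γ h T ≤ C * eLpNorm g (ENNReal.ofReal η) volume) :
    (1 / η + 1 / 2 ≤ s / d + 1 / q ∧ η ≤ q ∧ d / 2 < s) ∧
      (s / d + 1 / q = 1 / η + 1 / 2 → (d / 2 < s ∧ s < d) ∧ 2 < η ∧ η < q) := by
  have hd' : (0 : ℝ) < d := by exact_mod_cast hd
  have hq0 : 0 < q := by linarith
  have hη0 : 0 < η := by linarith
  obtain ⟨C', hC', hN⟩ := exists_lintegral_ball_le hγ h hd hη hC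
  have hds : (d : ℝ) / 2 < s := by
    refine half_lt_of_lintegral_ball_le hd hq0 hC' fun s' hs' hds' ↦ ?_
    simpa using hN s' hs' hds' 1 one_pos
  have hs : 0 < s := by linarith
  have hNs := hN s le_rfl hds
  have hηq := exponent_le_of_lintegral_ball_le hd hs hq0 hη0 hC' hNs
  refine ⟨⟨scaling_le_of_lintegral_ball_le hd hs hq0 hη hC' hNs, hηq, hds⟩, fun heq ↦ ?_⟩
  have h1q : 0 < 1 / q := by positivity
  -- At equality, `s ≥ d` contradicts `1/η ≤ 1/2` and `1/q > 0`. Below, `η = 2` turns the equality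
  -- into `(s - d) q = -d`, the divergent case, and `η = q` turns it into `s = d/2`.
  have hsd : s < d := by
    by_contra! hle
    have h1 : 1 / η ≤ 1 / 2 := one_div_le_one_div_of_le two_pos hη
    have h2 : 1 ≤ s / d := (one_le_div hd').2 hle
    linarith
  refine ⟨⟨hds, hsd⟩, lt_of_le_of_ne hη ?_, lt_of_le_of_ne hηq ?_⟩
  · rintro rfl
    refine not_lintegral_ball_le hd hs hsd.le hq0 ?_ hC' hNs
    field_simp at heq
    linarith
  · rintro rfl
    have h1 : s / d = 1 / 2 := by linarith
    rw [div_eq_iff hd'.ne'] at h1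
    linarith

theorem mainTheorem4 (d : ℕ) (hd : 1 ≤ d) (s q η : ℝ) [Fact (1 ≤ q)] :
    -- sufficient conditions
    (((d / 2 < s ∧ s < d ∧ 2 < η ∧ η < q ∧ 1 / η + 1 / 2 ≤ s / d + 1 / q) ∨
        (d / 2 < s ∧ η = q ∧ 2 ≤ q) ∨
        (d / 2 < s ∧ η = 2 ∧ 2 ≤ q ∧ 1 < s / d + 1 / q)) →
      ∃ C : ℝ≥0, ∀ (Ω : Type u) [MeasurableSpace Ω] (P : Measure Ω) [IsProbabilityMeasure P]
        (γ : ℕ → Ω → ℝ) (_ : IsGaussianSequence P γ) (h : HilbertBasis ℕ ℝ (L2 d))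
        (g : Rd d → ℝ), MemLp g (ENNReal.ofReal η) volume →
          ∃ T : L2 d →L[ℝ] BesselSpace d (-s) q, IsMulOperator g T ∧
            IsGammaRadonifying P γ h T ∧
            gammaNorm P γ h T ≤ C * eLpNorm g (ENNReal.ofReal η) volume) ∧
    -- necessary conditions
    (0 ≤ s → 2 ≤ η → 2 ≤ q →
      ∀ (Ω : Type u) [MeasurableSpace Ω] (P : Measure Ω) [IsProbabilityMeasure P]
        (γ : ℕ → Ω → ℝ) (_ : IsGaussianSequence P γ) (h : HilbertBasis ℕ ℝ (L2 d)),
        (∃ C : ℝ≥0, ∀ g : Rd d → ℝ, MemLp g (ENNReal.ofReal η) volume →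
          ∃ T : L2 d →L[ℝ] BesselSpace d (-s) q, IsMulOperator g T ∧
            IsGammaRadonifying P γ h T ∧
            gammaNorm P γ h T ≤ C * eLpNorm g (ENNReal.ofReal η) volume) →
        (1 / η + 1 / 2 ≤ s / d + 1 / q ∧ η ≤ q ∧ d / 2 < s) ∧
        (s / d + 1 / q = 1 / η + 1 / 2 → (d / 2 < s ∧ s < d) ∧ 2 < η ∧ η < q)) := by
  exact ⟨sufficient_conditions hd s q η, fun _ hη hq Ω _ P _ γ hγ h ⟨C, hC⟩ ↦
    necessary_conditions hd hη hq hγ h hC⟩
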